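/- Let $\mathbb T=\mathbb R/\mathbb Z$, let $s>5/2$ and $T>0$. For an interval $I\ni 0$ consider the periodic Cauchy problem for Novikov's equation in nonlocal form, $$u_t+u^2u_x=-(1-\partial_x^2)^{-1}\bigl(3u^2u_x+2u_x^3+3u\,u_x u_{xx}\bigr),\qquad u(0,x)=u_0(x),\qquad x\in\mathbb T,\ t\in I .$$ A solution on $I$ is a real-valued $u\in C(I,H^s(\mathbb T))$ with $u(0)=u_0$ which is differentiable in $t$ with values in $H^{s-1}(\mathbb T)$ and satisfies the equation for every $t\in I$ (one-sided derivatives at endpoints belonging to $I$; automatically $u\in C^1(I,H^{s-1}(\mathbb T))$). Put $\|f\|_{C^1}=\sup|f|+\sup|f_x|$. Let $u\in C([0,T],H^s(\mathbb T))$ be a solution on $[0,T]$, and let $J$ be $[0,\infty)$ or $\mathbb R$. Suppose that the $C^1$ norm stays bounded for as long as the solution exists: there is a constant $K>0$ such that, for every compact interval $[a,b]$ with $[0,T]\subseteq[a,b]\subseteq J$ and every solution $v$ on $[a,b]$ with $v=u$ on $[0,T]$, $$\|v(t)\|_{C^1}\le K\qquad\text{for all } t\in[a,b].$$ Then $u$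 extends to all time in $J$: there is a solution $v\in C(J,H^s(\mathbb T))$ on $J$ with $v=u$ on $[0,T]$. -/

import Mathlib

open scoped ENNReal Topology

noncomputable section

namespace Novikov

/-- The `n`-th Fourier coefficient `∫ f(x) e^{-2πinx} dx` of a real function on the circle
`𝕋 = ℝ/ℤ`. -/
def coeff (f : UnitAddCircle → ℝ) (n : ℤ) : ℂ :=
  fourierCoeff (fun x => (f x : ℂ)) n

/-- The symbol `1 + (2πn)²` of the operator `Λ² = 1 - ∂ₓ²` on `𝕋 = ℝ/ℤ`. -/
def symb (n : ℤ) : ℝ := 1 + (2 * Real.pi * (n : ℝ)) ^ 2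

/-- The Sobolev norm `‖f‖_{H^s} = ‖Λ^s f‖_{L²} = (∑ₙ (1 + (2πn)²)^s |f̂(n)|²)^{1/2}`, with values
in `[0, ∞]`. It is applied to continuous functions only. -/
def hsENorm (s : ℝ) (f : UnitAddCircle → ℝ) : ℝ≥0∞ :=
  (∑' n : ℤ, ENNReal.ofReal (symb n ^ s * ‖coeff f n‖ ^ 2)) ^ (1 / 2 : ℝ)

/-- `f ∈ H^s(𝕋)`, for `s > 1/2`: elements of `H^s(𝕋)` are identified with their continuous
representatives. -/
def MemHs (s : ℝ) (f : UnitAddCircle → ℝ) : Prop :=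
  Continuous f ∧ hsENorm s f < ∞

/-- The derivative `∂ₓ f` of a function on the circle. -/
def dx (f : UnitAddCircle → ℝ) : UnitAddCircle → ℝ :=
  fun x => deriv (fun h : ℝ => f (x + (h : UnitAddCircle))) 0

/-- The norm `‖f‖_{C¹} = sup |f| + sup |∂ₓ f|`, with values in `[0, ∞]`; it is applied to
continuously differentiable functions only. -/
def c1ENorm (f : UnitAddCircle → ℝ) : ℝ≥0∞ :=
  (⨆ x, ‖f x‖ₑ) + ⨆ x, ‖dx f x‖ₑ

/-- The inverse `Λ⁻²` of `1 - ∂ₓ²`, as the Fourier multiplier with symbol `1 / (1 + (2πn)²)`.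
The series converges absolutely for integrable `g`, and its sum is real. -/
def invLambdaSq (g : UnitAddCircle → ℝ) : UnitAddCircle → ℝ :=
  fun x => (∑' n : ℤ, (coeff g n / (symb n : ℂ)) * fourier n x).re

/-- The right-hand side of the nonlocal form
`u_t = - u² u_x - Λ⁻²(3 u² u_x + 2 u_x³ + 3 u u_x u_xx)` of Novikov's equation. -/
def rhs (f : UnitAddCircle → ℝ) : UnitAddCircle → ℝ :=
  fun x => -(f x ^ 2 * dx f x)
    - invLambdaSq (fun y => 3 * f y ^ 2 * dx f y + 2 * dx f y ^ 3
        + 3 * f y * dx f y * dx (dx f) y) x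

/-- `u ∈ C(I, H^s(𝕋))` solves the periodic Cauchy problem for Novikov's equation on the time
interval `I ∋ 0` with initial datum `u₀`; the time derivative is the limit of the difference
quotients in `H^{s-1}(𝕋)`, one-sided at an endpoint that belongs to `I`. For `s > 5/2` the
right-hand side is continuous from `H^s` to `H^{s-1}`, so that `u ∈ C¹(I, H^{s-1}(𝕋))`. -/
structure IsSolution (s : ℝ) (u₀ : UnitAddCircle → ℝ) (I : Set ℝ)
    (u : ℝ → UnitAddCircle → ℝ) : Prop where
  init : u 0 = u₀
  mem : ∀ t ∈ I, MemHs s (u t)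
  cont : ∀ t ∈ I,
    Filter.Tendsto (fun τ => hsENorm s (fun x => u τ x - u t x)) (𝓝[I] t) (𝓝 0)
  eqn : ∀ t ∈ I,
    Filter.Tendsto
      (fun τ => hsENorm (s - 1) (fun x => (u τ x - u t x) / (τ - t) - rhs (u t) x))
      (𝓝[I \ {t}] t) (𝓝 0)

end Novikov

end

/-!
The proof runs on the Fourier side. For `u = ∑ aₙ e^{2πinx}` the right-hand side of the equation
has the coefficients `nl a n = -i ∑_{k+l+m=n} lam k l m · a_k a_l a_m` (`coeff_rhs`), where `lam`
is `ξ_n / 3` plus a part of order zero, and all pairings of the nonlinearity with `u` are sums over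
quadruples of frequencies adding up to zero.

*Local existence, with a time that depends on the `H²` norm only.* After symmetrization over the
four frequencies the loss of one derivative in the pairing of `nl a` with `p² a` disappears. This
gives `|d/dt ∑ p(⟨n⟩)² |aₙ|²| ≤ c (∑ ⟨n⟩ |aₙ|)² ∑ p(⟨n⟩)² |aₙ|²` for every weight `p` satisfying
`IsWeight` (`abs_energy_le`). The factor `(∑ ⟨n⟩ |aₙ|)²` is bounded by the `H²` energy
(`sum_jb_sq_le`). Galerkin approximations whose vector field is cut off at high `H²` energy exist on
a fixed time interval, and on an interval of length `lifespan R` the cut-off is inactive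
(`IsGalerkin.uncut`). The weights `wt s L x = x^s √(min 1 (x/L))` satisfy `IsWeight` with a constant
that does not depend on `L`; at `L = 1` they give the `H^s` norm, and for large `L` the energy is
small on the datum, hence uniformly small along the approximations. So no mass escapes to high
frequencies, and a coefficientwise limit is a solution that is continuous in `H^s` and
differentiable in `H^{s-1}` (`exists_isSolution_local`), with no separate argument for the strong
continuity.

*The `H²` norm is controlled by the `C¹` norm.* The momentum `m = u - u_xx` satisfies
`m_t = -u² m_x - 3 u u_x m`, and hence `d/dt ∫ m² = -4 ∫ u u_x m²`. At the regularity of `H^s`,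
`s > 5/2`, this is proved as an identity between sums over resonant quadruples
(`hasSum_momentum_pairing`): the difference of the two symbols cancels when it is summed over the
even permutations of the four frequencies. If `‖u‖_{C¹} ≤ K`, Grönwall's inequality bounds
`‖m‖²_{L²} = ‖u‖²_{H²}` by its value at time `0` times `exp(4K²|t|)` (`IsSolution.en_le`).

*Continuation.* On a bounded time interval the length of each local continuation is therefore
bounded below, so finitely many of them extend a solution by a unit of time
(`exists_unit_continuation`), and countably many such extensions exhaust `J`
(`exists_isSolution_of_steps`). Each step extends the function constructed before, so uniqueness of
solutions is not needed.
-/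

open scoped ENNReal Topology
open MeasureTheory Filter

noncomputable section

namespace Novikov

/-! ### Absolutely convergent trigonometric series -/

/-- The wave number `2πn` of the `n`-th Fourier mode on `ℝ/ℤ`. -/
def xi (n : ℤ) : ℝ := 2 * Real.pi * n

/-- The `n`-th Fourier mode `e^{2πinx}`. -/
def mode (n : ℤ) (x : UnitAddCircle) : ℂ := fourier n x

@[simp] lemma norm_mode (n : ℤ) (x : UnitAddCircle) : ‖mode n x‖ = 1 := by
  rw [mode, fourier_apply]
  exact Circle.norm_coe _

lemma mode_add (m n : ℤ) (x : UnitAddCircle) : mode (m + n) x = mode m x * mode n x :=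
  fourier_add

lemma conj_mode (n : ℤ) (x : UnitAddCircle) : (starRingEnd ℂ) (mode n x) = mode (-n) x :=
  fourier_neg.symm

lemma continuous_mode (n : ℤ) : Continuous (mode n) := (fourier n).continuous

lemma hasDerivAt_mode (n : ℤ) (x : UnitAddCircle) (y : ℝ) :
    HasDerivAt (fun h : ℝ => mode n (x + (h : UnitAddCircle)))
      (Complex.I * xi n * mode n (x + (y : UnitAddCircle))) y := by
  obtain ⟨x, rfl⟩ := QuotientAddGroup.mk_surjective x
  have h := (hasDerivAt_fourier 1 n (x + y)).comp_const_add x y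
  refine h.congr_deriv ?_
  have e : ((QuotientAddGroup.mk x : UnitAddCircle) + (y : UnitAddCircle)) =
    ((x + y : ℝ) : UnitAddCircle) := rfl
  rw [e, mode, xi, Complex.ofReal_one, div_one]
  push_cast
  ring

/-- `f` is the sum of the absolutely convergent trigonometric series `∑ᵢ cᵢ e^{2πi φ(i) x}`. The
index type is arbitrary and `φ` need not be injective, so that a product of two such series is
again one, indexed by pairs; no convolution has to be formed. -/
structure HasTrig {ι : Type*} (f : UnitAddCircle → ℝ) (φ : ι → ℤ) (c : ι → ℂ) : Prop where
  summable : Summable fun i => ‖c i‖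
  hasSum : ∀ x, HasSum (fun i => c i * mode (φ i) x) (f x : ℂ)

lemma hasSum_of_forall_eq {ι M : Type*} [AddCommMonoid M] [TopologicalSpace M] {f g : ι → M}
    {a : M} (h : ∀ i, f i = g i)
    (hg : HasSum g a) : HasSum f a := by
  rwa [funext h]

section

variable {ι κ : Type*} {f g : UnitAddCircle → ℝ} {φ : ι → ℤ} {c d : ι → ℂ}

lemma HasTrig.mul {ψ : κ → ℤ} {e : κ → ℂ} (hf : HasTrig f φ c) (hg : HasTrig g ψ e) :
    HasTrig (fun x => f x * g x) (fun p : ι × κ => φ p.1 + ψ p.2)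
      (fun p => c p.1 * e p.2) := by
  refine ⟨?_, fun x => ?_⟩
  · simpa only [norm_mul] using hf.summable.mul_of_nonneg hg.summable
      (fun _ => norm_nonneg _) (fun _ => norm_nonneg _)
  · have h1 : Summable fun i => ‖c i * mode (φ i) x‖ := by
      simpa only [norm_mul, norm_mode, mul_one] using hf.summable
    have h2 : Summable fun i => ‖e i * mode (ψ i) x‖ := by
      simpa only [norm_mul, norm_mode, mul_one] using hg.summable
    have hs := summable_mul_of_summable_norm h1 h2
    have h := HasSum.mul (hf.hasSum x) (hg.hasSum x) hs
    rw [Complex.ofReal_mul]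
    refine hasSum_of_forall_eq (fun p => ?_) h
    rw [mode_add]
    exact mul_mul_mul_comm _ _ _ _

lemma HasTrig.add (hf : HasTrig f φ c) (hg : HasTrig g φ d) :
    HasTrig (fun x => f x + g x) φ (fun i => c i + d i) where
  summable := (hf.summable.add hg.summable).of_nonneg_of_le (fun _ => norm_nonneg _)
    (fun _ => norm_add_le _ _)
  hasSum x := by
    simpa only [Complex.ofReal_add, add_mul] using (hf.hasSum x).add (hg.hasSum x)

lemma HasTrig.smul (r : ℝ) (hf : HasTrig f φ c) :
    HasTrig (fun x => r * f x) φ (fun i => r * c i) where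
  summable := by simpa only [norm_mul] using hf.summable.mul_left ‖(r : ℂ)‖
  hasSum x := by simpa only [Complex.ofReal_mul, mul_assoc] using (hf.hasSum x).mul_left (r : ℂ)

lemma HasTrig.congr {ψ : ι → ℤ} (hf : HasTrig f φ c) (hfg : ∀ x, f x = g x) (hφ : ∀ i, φ i = ψ i)
    (hc : ∀ i, c i = d i) : HasTrig g ψ d := by
  obtain rfl : f = g := funext hfg
  obtain rfl : φ = ψ := funext hφ
  obtain rfl : c = d := funext hc
  exact hf

lemma HasTrig.continuous (hf : HasTrig f φ c) : Continuous f := by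
  have h : Continuous fun x => ∑' i, c i * mode (φ i) x :=
    continuous_tsum (fun i => continuous_const.mul (continuous_mode _)) hf.summable
      fun i x => by simp
  have h2 : f = fun x => (∑' i, c i * mode (φ i) x).re :=
    funext fun x => by rw [(hf.hasSum x).tsum_eq, Complex.ofReal_re]
  rw [h2]
  exact Complex.continuous_re.comp h

lemma HasTrig.hasDerivAt_ofReal (hf : HasTrig f φ c)
    (h1 : Summable fun i => |xi (φ i)| * ‖c i‖) (x : UnitAddCircle) :
    HasDerivAt (fun h : ℝ => (f (x + (h : UnitAddCircle)) : ℂ))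
      (∑' i, Complex.I * xi (φ i) * c i * mode (φ i) x) 0 := by
  have hd : ∀ (i : ι) (y : ℝ), HasDerivAt
      (fun h : ℝ => c i * mode (φ i) (x + (h : UnitAddCircle)))
      (Complex.I * xi (φ i) * c i * mode (φ i) (x + (y : UnitAddCircle))) y := fun i y => by
    have h := (hasDerivAt_mode (φ i) x y).const_mul (c i)
    rwa [← mul_assoc, mul_comm (c i)] at h
  have hb : ∀ (i : ι) (y : ℝ), ‖Complex.I * xi (φ i) * c i *
      mode (φ i) (x + (y : UnitAddCircle))‖ ≤ |xi (φ i)| * ‖c i‖ := fun i y => by simp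
  have h := hasDerivAt_tsum h1 hd hb (y₀ := 0) ((hf.hasSum _).summable) 0
  simp only [(hf.hasSum _).tsum_eq] at h
  simpa using h

lemma HasTrig.hasDerivAt (hf : HasTrig f φ c)
    (h1 : Summable fun i => |xi (φ i)| * ‖c i‖) (x : UnitAddCircle) :
    HasDerivAt (fun h : ℝ => f (x + (h : UnitAddCircle))) (dx f x) 0 := by
  have h := Complex.reCLM.hasFDerivAt.comp_hasDerivAt (0 : ℝ) (hf.hasDerivAt_ofReal h1 x)
  have h2 : DifferentiableAt ℝ (fun h : ℝ => f (x + (h : UnitAddCircle))) 0 :=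
    HasDerivAt.differentiableAt (by simpa [Function.comp_def] using h)
  exact h2.hasDerivAt

lemma HasTrig.dx (hf : HasTrig f φ c) (h1 : Summable fun i => |xi (φ i)| * ‖c i‖) :
    HasTrig (dx f) φ (fun i => Complex.I * xi (φ i) * c i) where
  summable := by simpa using h1
  hasSum x := by
    have hs : Summable fun i => Complex.I * xi (φ i) * c i * mode (φ i) x :=
      Summable.of_norm (by simpa using h1)
    rw [(hf.hasDerivAt h1 x).ofReal_comp.unique (hf.hasDerivAt_ofReal h1 x)]
    exact hs.hasSum

lemma integrable_of_continuous {g : UnitAddCircle → ℂ} (hg : Continuous g) :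
    Integrable g AddCircle.haarAddCircle :=
  hg.integrable_of_hasCompactSupport (HasCompactSupport.of_compactSpace g)

lemma coeff_sub {f g : UnitAddCircle → ℝ} (hf : Continuous f) (hg : Continuous g) (n : ℤ) :
    coeff (fun x => f x - g x) n = coeff f n - coeff g n := by
  have h1 := integrable_of_continuous (Complex.continuous_ofReal.comp hf)
  have h2 := integrable_of_continuous (Complex.continuous_ofReal.comp hg)
  have h := integral_sub (h1.fourier_smul (-n)) (h2.fourier_smul (-n))
  simp only [coeff, fourierCoeff, Complex.ofReal_sub, smul_sub]
  exact h

lemma coeff_div (f : UnitAddCircle → ℝ) (r : ℝ) (n : ℤ) :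
    coeff (fun x => f x / r) n = coeff f n / r := by
  have := fourierCoeff.const_mul (fun x => (f x : ℂ)) (r : ℂ)⁻¹ n
  simp only [coeff, div_eq_inv_mul, Complex.ofReal_mul, Complex.ofReal_inv]
  exact this

lemma coeff_neg_index (f : UnitAddCircle → ℝ) (n : ℤ) :
    coeff f (-n) = (starRingEnd ℂ) (coeff f n) := by
  simp only [coeff, fourierCoeff, ← integral_conj, smul_eq_mul, map_mul, Complex.conj_ofReal,
    ← fourier_neg, neg_neg]

/-- The Fourier coefficients of the sum of a trigonometric series are its fibre sums. -/
lemma HasTrig.coeff_eq [Countable ι] (hf : HasTrig f φ c) (n : ℤ) :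
    HasSum (fun i => if φ i = n then c i else 0) (coeff f n) := by
  have hc : ∀ i, Continuous fun x => mode (-n) x * (c i * mode (φ i) x) := fun i =>
    (continuous_mode _).mul (continuous_const.mul (continuous_mode _))
  have h := hasSum_integral_of_summable_integral_norm
    (μ := AddCircle.haarAddCircle (T := 1))
    (F := fun i x => mode (-n) x * (c i * mode (φ i) x))
    (fun i => integrable_of_continuous (hc i)) (by simpa using hf.summable)
  have e1 : ∫ x, ∑' i, mode (-n) x * (c i * mode (φ i) x) ∂AddCircle.haarAddCircle
      = coeff f n := by
    simp only [coeff, fourierCoeff, smul_eq_mul]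
    refine integral_congr_ae (Eventually.of_forall fun x => ?_)
    simp only [tsum_mul_left, (hf.hasSum x).tsum_eq]
    rfl
  rw [e1] at h
  refine hasSum_of_forall_eq (fun i => ?_) h
  have e2 := congrFun (fourierCoeff_fourier (T := 1) (φ i)) n
  simp only [fourierCoeff, smul_eq_mul] at e2
  have e3 : ∫ x, mode (-n) x * (c i * mode (φ i) x) ∂AddCircle.haarAddCircle
      = c i * ∫ x, mode (-n) x * mode (φ i) x ∂AddCircle.haarAddCircle (T := 1) := by
    rw [← integral_const_mul]
    congr 1
    ext x
    ring
  rw [e3]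
  simp only [mode]
  rw [e2, Pi.single_apply]
  by_cases hn : φ i = n
  · simp [hn]
  · simp [hn, Ne.symm hn]

lemma symb_eq (n : ℤ) : symb n = 1 + xi n ^ 2 := rfl

lemma one_le_symb (n : ℤ) : 1 ≤ symb n := by
  rw [symb_eq]; nlinarith [sq_nonneg (xi n)]

lemma symb_pos (n : ℤ) : 0 < symb n := by linarith [one_le_symb n]

lemma xi_neg (n : ℤ) : xi (-n) = -xi n := by simp [xi]

lemma xi_add (m n : ℤ) : xi (m + n) = xi m + xi n := by simp [xi]; ring

lemma symb_neg (n : ℤ) : symb (-n) = symb n := by simp [symb_eq, xi_neg]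

lemma HasTrig.invLambdaSq [Countable ι] (hf : HasTrig f φ c) :
    HasTrig (invLambdaSq f) φ (fun i => c i / symb (φ i)) where
  summable := hf.summable.of_nonneg_of_le (fun _ => norm_nonneg _) fun i => by
    rw [norm_div, Complex.norm_real, Real.norm_eq_abs, abs_of_pos (symb_pos _)]
    exact div_le_self (norm_nonneg _) (one_le_symb _)
  hasSum x := by
    have hs : Summable fun i => ‖c i / symb (φ i) * mode (φ i) x‖ := by
      refine hf.summable.of_nonneg_of_le (fun _ => norm_nonneg _) fun i => ?_
      rw [norm_mul, norm_mode, mul_one, norm_div, Complex.norm_real, Real.norm_eq_abs,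
        abs_of_pos (symb_pos _)]
      exact div_le_self (norm_nonneg _) (one_le_symb _)
    have h := hs.of_norm.hasSum
    set z := ∑' i, c i / symb (φ i) * mode (φ i) x with hz
    have h2 : HasSum (fun n => coeff f n / symb n * mode n x) z := by
      have h3 := h.tsum_fiberwise φ
      refine hasSum_of_forall_eq (fun n => ?_) h3
      have h4 : ∀ b : φ ⁻¹' {n}, c b / symb (φ b) * mode (φ b) x
          = c b * ((symb n : ℂ)⁻¹ * mode n x) := by
        rintro ⟨b, rfl⟩
        simp only [div_eq_mul_inv, mul_assoc]
      simp only [h4]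
      rw [tsum_mul_right]
      have h5 : ∑' b : φ ⁻¹' {n}, c b = coeff f n := by
        rw [tsum_subtype (φ ⁻¹' {n}) c, ← (hf.coeff_eq n).tsum_eq]
        refine tsum_congr fun i => ?_
        by_cases hi : φ i = n
        · rw [Set.indicator_of_mem (s := φ ⁻¹' {n}) hi, if_pos hi]
        · rw [Set.indicator_of_notMem (s := φ ⁻¹' {n}) hi, if_neg hi]
      rw [h5]
      ring
    have h3 : (starRingEnd ℂ) z = z := by
      have h4 := h2.map (starRingEnd ℂ) Complex.continuous_conj
      have h5 := (Equiv.neg ℤ).hasSum_iff.mpr h2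
      refine h4.unique ?_
      refine hasSum_of_forall_eq (fun n => ?_) h5
      simp [coeff_neg_index, symb_neg, conj_mode]
    have h4 : ((Novikov.invLambdaSq f x : ℝ) : ℂ) = z := by
      rw [← Complex.conj_eq_iff_re.mp h3, ← h2.tsum_eq]
      rfl
    rw [h4]
    exact h

end

/-! ### The nonlinearity on the Fourier side -/

/-- The symbol of Novikov's nonlinearity, up to the factor `-i`: the mode `e^{2πi(k+l+m)x}` of
`rhs u` receives `-i λ(k, l, m) û(k) û(l) û(m)`. Since `u uₓ uₓₓ = ½ (u uₓ²)ₓ - ½ uₓ³`, the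
nonlocal term is `Λ⁻²((u³ + 3/2 u uₓ²)ₓ + ½ uₓ³)`, in which no factor is differentiated twice. -/
def lam (k l m : ℤ) : ℝ :=
  xi (k + l + m) / 3 + (xi (k + l + m) * (1 - 3 / 2 * (xi l * xi m))
    - 1 / 2 * (xi k * xi l * xi m)) / symb (k + l + m)

/-- The `n`-th Fourier coefficient of `rhs u`, in terms of the Fourier coefficients `a` of `u`. -/
def nl (a : ℤ → ℂ) (n : ℤ) : ℂ :=
  ∑' t : ℤ × ℤ × ℤ, if t.1 + t.2.1 + t.2.2 = n then
    -Complex.I * lam t.1 t.2.1 t.2.2 * (a t.1 * a t.2.1 * a t.2.2) else 0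

lemma abs_xi_le_symb (n : ℤ) : |xi n| ≤ symb n := by
  rw [symb_eq, abs_le]
  constructor <;> nlinarith [sq_nonneg (xi n - 1), sq_nonneg (xi n + 1)]

lemma HasTrig.dx_id {a : ℤ → ℂ} (hf : HasTrig f id a) (ha : Summable fun n => symb n * ‖a n‖) :
    HasTrig (Novikov.dx f) id (fun n => Complex.I * xi n * a n) :=
  hf.dx (ha.of_nonneg_of_le (fun _ => by positivity) fun n =>
    mul_le_mul_of_nonneg_right (abs_xi_le_symb n) (norm_nonneg _))

lemma summable_xi_dx {a : ℤ → ℂ} (ha : Summable fun n => symb n * ‖a n‖) :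
    Summable fun n => |xi (id n)| * ‖Complex.I * xi n * a n‖ :=
  ha.of_nonneg_of_le (fun _ => by positivity) fun n => by
    simp only [id, norm_mul, Complex.norm_I, one_mul, Complex.norm_real, Real.norm_eq_abs,
      ← mul_assoc, abs_mul_abs_self, symb_eq]
    nlinarith [norm_nonneg (a n)]

lemma summable_triple {w : ℤ → ℝ} (hw : Summable w) (h0 : ∀ n, 0 ≤ w n) :
    Summable fun t : ℤ × ℤ × ℤ => w t.1 * (w t.2.1 * w t.2.2) :=
  hw.mul_of_nonneg (hw.mul_of_nonneg hw h0 h0) h0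
    (fun t => mul_nonneg (h0 t.1) (h0 t.2))

/-- The Fourier series of the right-hand side of Novikov's equation. -/
theorem HasTrig.rhs {a : ℤ → ℂ} (hf : HasTrig f id a) (ha : Summable fun n => symb n * ‖a n‖) :
    HasTrig (rhs f) (fun t : ℤ × ℤ × ℤ => t.1 + t.2.1 + t.2.2)
      (fun t => -Complex.I * lam t.1 t.2.1 t.2.2 * (a t.1 * a t.2.1 * a t.2.2)) := by
  have h1 := hf.dx_id ha
  have ha1 := summable_xi_dx ha
  have ha0 : Summable fun n => |xi (id n)| * ‖a n‖ :=
    ha.of_nonneg_of_le (fun _ => by positivity) fun n =>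
      mul_le_mul_of_nonneg_right (abs_xi_le_symb n) (norm_nonneg _)
  have hI : (Complex.I) ^ 2 = -1 := Complex.I_sq
  have hsum := summable_triple ha (fun n => mul_nonneg (symb_pos n).le (norm_nonneg _))
  -- the cubic expressions that occur
  have c0 : HasTrig (fun x => f x ^ 3) (fun t : ℤ × ℤ × ℤ => t.1 + t.2.1 + t.2.2)
      (fun t => a t.1 * a t.2.1 * a t.2.2) :=
    (hf.mul (hf.mul hf)).congr (fun x => by ring) (fun t => by simp only [id]; ring)
      (fun t => by ring)
  have c2 : HasTrig (fun x => f x * Novikov.dx f x ^ 2)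
      (fun t : ℤ × ℤ × ℤ => t.1 + t.2.1 + t.2.2)
      (fun t => -(xi t.2.1 * xi t.2.2) * (a t.1 * a t.2.1 * a t.2.2)) := by
    refine (hf.mul (h1.mul h1)).congr (fun x => by ring) (fun t => by simp only [id]; ring)
      (fun t => ?_)
    linear_combination (a t.1 * a t.2.1 * a t.2.2 * xi t.2.1 * xi t.2.2) * hI
  have c3 : HasTrig (fun x => Novikov.dx f x ^ 3)
      (fun t : ℤ × ℤ × ℤ => t.1 + t.2.1 + t.2.2)
      (fun t => -Complex.I * (xi t.1 * xi t.2.1 * xi t.2.2) * (a t.1 * a t.2.1 * a t.2.2)) := by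
    refine (h1.mul (h1.mul h1)).congr (fun x => by ring) (fun t => by simp only [id]; ring)
      (fun t => ?_)
    linear_combination
      (Complex.I * a t.1 * a t.2.1 * a t.2.2 * xi t.1 * xi t.2.1 * xi t.2.2) * hI
  have b0 : Summable fun t : ℤ × ℤ × ℤ => |xi (t.1 + t.2.1 + t.2.2)| *
      ‖a t.1 * a t.2.1 * a t.2.2‖ := by
    refine (hsum.mul_left 3).of_nonneg_of_le (fun _ => by positivity) fun t => ?_
    have e : |xi (t.1 + t.2.1 + t.2.2)| ≤ 3 * (symb t.1 * symb t.2.1 * symb t.2.2) := by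
      rw [xi_add, xi_add]
      have := abs_add_three (xi t.1) (xi t.2.1) (xi t.2.2)
      have s1 := one_le_symb t.1
      have s2 := one_le_symb t.2.1
      have s3 := one_le_symb t.2.2
      have p12 : symb t.1 ≤ symb t.1 * symb t.2.1 := le_mul_of_one_le_right (by linarith) s2
      have p21 : symb t.2.1 ≤ symb t.1 * symb t.2.1 := le_mul_of_one_le_left (by linarith) s1
      have p123 : symb t.1 * symb t.2.1 ≤ symb t.1 * symb t.2.1 * symb t.2.2 :=
        le_mul_of_one_le_right (by positivity) s3
      have p3 : symb t.2.2 ≤ symb t.1 * symb t.2.1 * symb t.2.2 :=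
        le_mul_of_one_le_left (by linarith) (by linarith)
      linarith [abs_xi_le_symb t.1, abs_xi_le_symb t.2.1, abs_xi_le_symb t.2.2]
    calc _ ≤ 3 * (symb t.1 * symb t.2.1 * symb t.2.2) * ‖a t.1 * a t.2.1 * a t.2.2‖ :=
          mul_le_mul_of_nonneg_right e (norm_nonneg _)
      _ = _ := by simp only [norm_mul]; ring
  have b2 : Summable fun t : ℤ × ℤ × ℤ => |xi (t.1 + t.2.1 + t.2.2)| *
      ‖-(xi t.2.1 * xi t.2.2) * (a t.1 * a t.2.1 * a t.2.2)‖ := by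
    refine (hsum.mul_left 3).of_nonneg_of_le (fun _ => by positivity) fun t => ?_
    have e : |xi (t.1 + t.2.1 + t.2.2)| * (|xi t.2.1| * |xi t.2.2|)
        ≤ 3 * (symb t.1 * symb t.2.1 * symb t.2.2) := by
      rw [xi_add, xi_add]
      have h3 := abs_add_three (xi t.1) (xi t.2.1) (xi t.2.2)
      have s1 := one_le_symb t.1
      have s2 := (symb_pos t.2.1).le
      have q1 := abs_xi_le_symb t.1
      have q2 := abs_xi_le_symb t.2.1
      have q3 := abs_xi_le_symb t.2.2
      have r2 : |xi t.2.1| * |xi t.2.1| ≤ symb t.2.1 := by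
        rw [abs_mul_abs_self, symb_eq]; nlinarith
      have r3 : |xi t.2.2| * |xi t.2.2| ≤ symb t.2.2 := by
        rw [abs_mul_abs_self, symb_eq]; nlinarith
      have n1 := abs_nonneg (xi t.1)
      have n2 := abs_nonneg (xi t.2.1)
      have n3 := abs_nonneg (xi t.2.2)
      have g1 : |xi t.1| * (|xi t.2.1| * |xi t.2.2|) ≤ symb t.1 * (symb t.2.1 * symb t.2.2) := by
        gcongr
      have g2 : 1 * (|xi t.2.1| * |xi t.2.1| * |xi t.2.2|)
          ≤ symb t.1 * (symb t.2.1 * symb t.2.2) := by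
        gcongr
      have g3 : 1 * (|xi t.2.1| * (|xi t.2.2| * |xi t.2.2|))
          ≤ symb t.1 * (symb t.2.1 * symb t.2.2) := by
        gcongr
      calc _ ≤ (|xi t.1| + |xi t.2.1| + |xi t.2.2|) * (|xi t.2.1| * |xi t.2.2|) := by gcongr
        _ ≤ _ := by linarith
    calc _ = |xi (t.1 + t.2.1 + t.2.2)| * (|xi t.2.1| * |xi t.2.2|)
            * ‖a t.1 * a t.2.1 * a t.2.2‖ := by
          simp only [norm_mul, norm_neg, Complex.norm_real, Real.norm_eq_abs]; ring
      _ ≤ 3 * (symb t.1 * symb t.2.1 * symb t.2.2) * ‖a t.1 * a t.2.1 * a t.2.2‖ :=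
          mul_le_mul_of_nonneg_right e (norm_nonneg _)
      _ = _ := by simp only [norm_mul]; ring
  have d0 := c0.dx b0
  have d2 := c2.dx b2
  have hD0 : ∀ x, HasDerivAt (fun h : ℝ => f (x + (h : UnitAddCircle))) (Novikov.dx f x) 0 :=
    hf.hasDerivAt ha0
  have hD1 : ∀ x, HasDerivAt (fun h : ℝ => Novikov.dx f (x + (h : UnitAddCircle)))
      (Novikov.dx (Novikov.dx f) x) 0 := h1.hasDerivAt ha1
  have e0 : ∀ x, Novikov.dx (fun y => f y ^ 3) x = 3 * f x ^ 2 * Novikov.dx f x := fun x => by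
    have h := ((hD0 x).fun_pow 3).deriv
    rw [Novikov.dx, h]
    simp
  have e2 : ∀ x, Novikov.dx (fun y => f y * Novikov.dx f y ^ 2) x
      = Novikov.dx f x ^ 3 + 2 * f x * Novikov.dx f x * Novikov.dx (Novikov.dx f) x := fun x => by
    have h := ((hD0 x).fun_mul ((hD1 x).fun_pow 2)).deriv
    rw [Novikov.dx, h]
    simp
    ring
  have hin := ((d0.add (d2.smul (3 / 2))).add (c3.smul (1 / 2))).congr
    (g := fun y => 3 * f y ^ 2 * Novikov.dx f y + 2 * Novikov.dx f y ^ 3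
        + 3 * f y * Novikov.dx f y * Novikov.dx (Novikov.dx f) y)
    (fun x => by rw [e0, e2]; ring) (fun _ => rfl) (fun _ => rfl)
  refine ((d0.smul (-(1 / 3))).add ((hin.invLambdaSq).smul (-1))).congr
    (fun x => by rw [e0, Novikov.rhs]; ring) (fun _ => rfl) (fun t => ?_)
  have hs : (symb (t.1 + t.2.1 + t.2.2) : ℂ) ≠ 0 := by exact_mod_cast (symb_pos _).ne'
  simp only [lam]
  push_cast
  field_simp
  ring

lemma coeff_rhs {a : ℤ → ℂ} (hf : HasTrig f id a) (ha : Summable fun n => symb n * ‖a n‖)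
    (n : ℤ) : coeff (rhs f) n = nl a n :=
  ((hf.rhs ha).coeff_eq n).tsum_eq.symm

/-! ### Weights and symbol inequalities -/

/-- The symbol `⟨n⟩ = (1 + (2πn)²)^{1/2}` of `Λ`. -/
def jb (n : ℤ) : ℝ := √(symb n)

lemma jb_sq (n : ℤ) : jb n ^ 2 = symb n := Real.sq_sqrt (symb_pos n).le

lemma one_le_jb (n : ℤ) : 1 ≤ jb n := Real.one_le_sqrt.mpr (one_le_symb n)

lemma jb_pos (n : ℤ) : 0 < jb n := zero_lt_one.trans_le (one_le_jb n)

lemma jb_neg (n : ℤ) : jb (-n) = jb n := by rw [jb, symb_neg, jb]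

lemma abs_xi_le_jb (n : ℤ) : |xi n| ≤ jb n :=
  Real.abs_le_sqrt (by rw [symb_eq]; linarith)

lemma jb_le_add_abs (m n : ℤ) : jb m ≤ jb n + |xi m - xi n| := by
  refine Real.sqrt_le_iff.mpr ⟨by positivity [jb_pos n], ?_⟩
  have h1 : (xi m - xi n) * xi n ≤ |xi m - xi n| * jb n :=
    (le_abs_self _).trans (by rw [abs_mul]; gcongr; exact abs_xi_le_jb n)
  have h2 := jb_sq n
  have h3 := sq_abs (xi m - xi n)
  rw [symb_eq] at h2 ⊢
  nlinarith

lemma jb_add_le (m n : ℤ) : jb (m + n) ≤ jb m + jb n := by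
  have h := jb_le_add_abs (m + n) m
  rw [xi_add, add_sub_cancel_left] at h
  linarith [abs_xi_le_jb n]

/-- A weight `p` of polynomial growth for the energy method, as a function of `⟨n⟩ ∈ [1, ∞)`. The
energy estimates depend on `p` through the constant `C` only. By `mul_le_mul` the quotient `p(x)/x`
is nondecreasing; `lip` bounds the relative increase of `p²` by `C` times that of its argument. -/
structure IsWeight (C : ℝ) (p : ℝ → ℝ) : Prop where
  one_le : 1 ≤ C
  nonneg : ∀ x, 1 ≤ x → 0 ≤ p x
  mul_le_mul : ∀ x y, 1 ≤ x → x ≤ y → p x * y ≤ p y * x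
  triple : ∀ x, 1 ≤ x → p (3 * x) ≤ C * p x
  lip : ∀ x y, 1 ≤ y → y ≤ x → x * (p x ^ 2 - p y ^ 2) ≤ C * ((x - y) * p x ^ 2)

/-- The weight `x^s min(1, x/L)^{1/2}`. For `L = 1` it is `x^s`; as `L → ∞` it tends to `0`
pointwise, but stays equal to `x^s` on `[L, ∞)`, so that it measures the tail of an `H^s` norm. -/
def wt (s L x : ℝ) : ℝ := x ^ s * √(min 1 (x / L))

lemma wt_sq {s L x : ℝ} (hL : 1 ≤ L) (hx : 1 ≤ x) :
    wt s L x ^ 2 = x ^ (2 * s) * min 1 (x / L) := by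
  rw [wt, mul_pow, Real.sq_sqrt (le_min zero_le_one (by positivity)), mul_comm 2 s,
    Real.rpow_mul (by positivity), Real.rpow_ofNat]

lemma isWeight_wt {s L : ℝ} (hs : 1 ≤ s) (hL : 1 ≤ L) :
    IsWeight (max (3 ^ (s + 1)) (2 * s + 1)) (wt s L) where
  one_le := le_max_of_le_right (by linarith)
  nonneg x hx := by unfold wt; positivity
  mul_le_mul x y hx hxy := by
    have hx0 : 0 < x := by linarith
    have hy0 : 0 < y := by linarith
    have e : ∀ z : ℝ, 0 < z → z ^ s = z ^ (s - 1) * z := fun z hz => by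
      rw [← Real.rpow_add_one hz.ne']; simp
    unfold wt
    rw [e x hx0, e y hy0]
    calc _ = x ^ (s - 1) * √(min 1 (x / L)) * (x * y) := by ring
      _ ≤ y ^ (s - 1) * √(min 1 (y / L)) * (x * y) := by
          have : x ^ (s - 1) ≤ y ^ (s - 1) := Real.rpow_le_rpow hx0.le hxy (by linarith)
          gcongr
      _ = _ := by ring
  triple x hx := by
    have hx0 : 0 < x := by linarith
    unfold wt
    have h1 : √(min 1 (3 * x / L)) ≤ 3 * √(min 1 (x / L)) := by
      refine Real.sqrt_le_iff.mpr ⟨by positivity, ?_⟩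
      have h0 : 0 ≤ min 1 (x / L) := le_min zero_le_one (by positivity)
      rw [mul_pow, Real.sq_sqrt h0]
      have h2 : min 1 (3 * x / L) ≤ 3 * min 1 (x / L) := by
        rw [mul_min_of_nonneg _ _ (by norm_num : (0 : ℝ) ≤ 3)]
        exact min_le_min (by norm_num) (by rw [mul_div_assoc])
      linarith
    calc (3 * x) ^ s * √(min 1 (3 * x / L)) ≤ (3 * x) ^ s * (3 * √(min 1 (x / L))) := by gcongr
      _ = 3 ^ (s + 1) * (x ^ s * √(min 1 (x / L))) := by
          rw [Real.mul_rpow (by norm_num) hx0.le, Real.rpow_add_one (by norm_num)]; ring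
      _ ≤ _ := by gcongr; exact le_max_left _ _
  lip x y hy hyx := by
    have hy0 : 0 < y := by linarith
    have hx0 : 0 < x := by linarith
    rw [wt_sq hL hy, wt_sq hL (by linarith)]
    have hb : x * (x ^ (2 * s) - y ^ (2 * s)) ≤ 2 * s * ((x - y) * x ^ (2 * s)) := by
      have h := one_add_mul_self_le_rpow_one_add (s := y / x - 1) (by
        have : 0 < y / x := by positivity
        linarith) (p := 2 * s) (by linarith)
      have e : y ^ (2 * s) = (1 + (y / x - 1)) ^ (2 * s) * x ^ (2 * s) := by
        rw [← Real.mul_rpow (by simp; positivity) hx0.le]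
        congr 1
        field_simp
        ring
      have h2 : (1 + 2 * s * (y / x - 1)) * x ^ (2 * s) ≤ y ^ (2 * s) := by
        rw [e]; gcongr
      have h3 : x * ((1 + 2 * s * (y / x - 1)) * x ^ (2 * s)) ≤ x * y ^ (2 * s) := by gcongr
      have e3 : x * ((1 + 2 * s * (y / x - 1)) * x ^ (2 * s))
          = (x + 2 * s * (y - x)) * x ^ (2 * s) := by
        field_simp
      rw [e3] at h3
      linarith
    have hθ : x * (min 1 (x / L) - min 1 (y / L)) ≤ (x - y) * min 1 (x / L) := by
      have : y * min 1 (x / L) ≤ x * min 1 (y / L) := by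
        rw [mul_min_of_nonneg _ _ hy0.le, mul_min_of_nonneg _ _ hx0.le]
        exact min_le_min (by linarith) (by
          rw [← mul_div_assoc, ← mul_div_assoc, mul_comm])
      linarith
    have h0 : 0 ≤ min 1 (x / L) := le_min zero_le_one (by positivity)
    have hxy : y ^ (2 * s) ≤ x ^ (2 * s) := Real.rpow_le_rpow hy0.le hyx (by linarith)
    have hp : 0 ≤ (x - y) * min 1 (x / L) := mul_nonneg (by linarith) h0
    calc x * (x ^ (2 * s) * min 1 (x / L) - y ^ (2 * s) * min 1 (y / L))
        = x * (x ^ (2 * s) - y ^ (2 * s)) * min 1 (x / L)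
          + y ^ (2 * s) * (x * (min 1 (x / L) - min 1 (y / L))) := by ring
      _ ≤ 2 * s * ((x - y) * x ^ (2 * s)) * min 1 (x / L)
          + x ^ (2 * s) * ((x - y) * min 1 (x / L)) := by
          refine add_le_add (mul_le_mul_of_nonneg_right hb h0) ?_
          exact (mul_le_mul_of_nonneg_left hθ (by positivity)).trans
            (mul_le_mul_of_nonneg_right hxy hp)
      _ = (2 * s + 1) * ((x - y) * (x ^ (2 * s) * min 1 (x / L))) := by ring
      _ ≤ _ := by
          refine mul_le_mul_of_nonneg_right (le_max_right _ _) ?_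
          exact mul_nonneg (by linarith) (by positivity)

namespace IsWeight

variable {C : ℝ} {p : ℝ → ℝ} (hp : IsWeight C p)
include hp

lemma mono {x y : ℝ} (hx : 1 ≤ x) (hxy : x ≤ y) : p x ≤ p y := by
  have h := hp.mul_le_mul x y hx hxy
  have h2 := hp.nonneg y (hx.trans hxy)
  have h3 : p x * y ≤ p y * y := h.trans (by gcongr)
  exact le_of_mul_le_mul_right h3 (by linarith)

/-- `p(x)/x` is quasi-subadditive. -/
lemma subadd {n x y z : ℝ} (hn : 1 ≤ n) (hx : 1 ≤ x) (hy : 1 ≤ y) (hz : 1 ≤ z)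
    (h : n ≤ x + y + z) :
    p n * (x * y * z) ≤ C * n * (p x * y * z + x * p y * z + x * y * p z) := by
  have key : ∀ w, 1 ≤ w → n ≤ 3 * w → p n * w ≤ C * n * p w := fun w hw hnw => by
    have h1 := hp.mul_le_mul n (3 * w) hn hnw
    have h2 : p (3 * w) * n ≤ C * p w * n := by
      have := hp.triple w hw
      gcongr
    have h3 := mul_nonneg (hp.nonneg n hn) (by linarith : (0 : ℝ) ≤ w)
    nlinarith
  have C0 : 0 ≤ C := zero_le_one.trans hp.one_le
  have px := hp.nonneg x hx
  have py := hp.nonneg y hy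
  have pz := hp.nonneg z hz
  have n0 : 0 ≤ n := by linarith
  have x0 : 0 ≤ x := by linarith
  have y0 : 0 ≤ y := by linarith
  have z0 : 0 ≤ z := by linarith
  have t1 : 0 ≤ C * n * (p x * y * z) := by positivity
  have t2 : 0 ≤ C * n * (x * p y * z) := by positivity
  have t3 : 0 ≤ C * n * (x * y * p z) := by positivity
  by_cases hxm : y ≤ x ∧ z ≤ x
  · have := mul_le_mul_of_nonneg_right (key x hx (by linarith [hxm.1, hxm.2]))
      (mul_nonneg y0 z0)
    linarith
  by_cases hym : x ≤ y ∧ z ≤ y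
  · have := mul_le_mul_of_nonneg_right (key y hy (by linarith [hym.1, hym.2]))
      (mul_nonneg x0 z0)
    linarith
  have hzm : x ≤ z ∧ y ≤ z := by grind
  have := mul_le_mul_of_nonneg_right (key z hz (by linarith [hzm.1, hzm.2]))
    (mul_nonneg x0 y0)
  linarith

end IsWeight

/-- `p(k)⟨l⟩⟨m⟩ + ⟨k⟩p(l)⟨m⟩ + ⟨k⟩⟨l⟩p(m)`. -/
def tri (p : ℝ → ℝ) (k l m : ℤ) : ℝ :=
  p (jb k) * jb l * jb m + jb k * p (jb l) * jb m + jb k * jb l * p (jb m)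

lemma abs_lam_sub_le (k l m : ℤ) :
    |lam k l m - xi (k + l + m) / 3| * jb (k + l + m) ≤ 3 * (jb k * jb l * jb m) := by
  have k1 := one_le_jb k
  have l1 := one_le_jb l
  have m1 := one_le_jb m
  have n1 := one_le_jb (k + l + m)
  rw [lam, add_sub_cancel_left, abs_div, abs_of_pos (symb_pos _), ← jb_sq]
  have hl : |xi l * xi m| ≤ jb l * jb m := by
    rw [abs_mul]; gcongr <;> exact abs_xi_le_jb _
  have hk : |xi k * xi l * xi m| ≤ jb k * jb l * jb m := by
    rw [abs_mul, abs_mul]; gcongr <;> exact abs_xi_le_jb _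
  have hlm : 1 ≤ jb l * jb m := one_le_mul_of_one_le_of_one_le l1 m1
  have hklm : jb l * jb m ≤ jb k * jb l * jb m := by
    rw [mul_assoc]; exact le_mul_of_one_le_left (by positivity) k1
  have h1 : |1 - 3 / 2 * (xi l * xi m)| ≤ 5 / 2 * (jb k * jb l * jb m) := by
    rw [abs_le] at hl ⊢
    constructor <;> linarith [hl.1, hl.2]
  have h2 : |xi (k + l + m) * (1 - 3 / 2 * (xi l * xi m)) - 1 / 2 * (xi k * xi l * xi m)|
      ≤ jb (k + l + m) * (3 * (jb k * jb l * jb m)) := by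
    calc _ ≤ |xi (k + l + m) * (1 - 3 / 2 * (xi l * xi m))| + |1 / 2 * (xi k * xi l * xi m)| :=
          abs_sub _ _
      _ ≤ jb (k + l + m) * (5 / 2 * (jb k * jb l * jb m))
          + jb (k + l + m) * (1 / 2 * (jb k * jb l * jb m)) := by
          refine add_le_add ?_ ?_
          · rw [abs_mul]
            have := abs_xi_le_jb (k + l + m)
            gcongr
          · rw [abs_mul, abs_of_pos (by norm_num : (0 : ℝ) < 1 / 2)]
            calc _ ≤ 1 / 2 * (jb k * jb l * jb m) := by gcongr
              _ ≤ _ := le_mul_of_one_le_left (by positivity) n1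
      _ = _ := by ring
  rw [div_mul_eq_mul_div, div_le_iff₀ (by positivity)]
  calc _ ≤ jb (k + l + m) * (3 * (jb k * jb l * jb m)) * jb (k + l + m) := by gcongr
    _ = _ := by ring

lemma jb_add_three_le (k l m : ℤ) : jb (k + l + m) ≤ jb k + jb l + jb m := by
  linarith [jb_add_le (k + l) m, jb_add_le k l]

lemma jb_add_three_le_mul (k l m : ℤ) : jb (k + l + m) ≤ 3 * (jb k * jb l * jb m) := by
  have k1 := one_le_jb k
  have l1 := one_le_jb l
  have m1 := one_le_jb m
  have h := jb_add_three_le k l m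
  have a1 : jb k ≤ jb k * jb l := le_mul_of_one_le_right (by linarith) l1
  have a2 : jb l ≤ jb k * jb l := le_mul_of_one_le_left (by linarith) k1
  have a3 : jb k * jb l ≤ jb k * jb l * jb m := le_mul_of_one_le_right (by positivity) m1
  have a4 : jb m ≤ jb k * jb l * jb m := le_mul_of_one_le_left (by linarith) (by nlinarith)
  linarith

lemma abs_lam_le (k l m : ℤ) : |lam k l m| ≤ 4 * (jb k * jb l * jb m) := by
  have h1 := abs_lam_sub_le k l m
  have n1 := one_le_jb (k + l + m)
  have h2 : |lam k l m - xi (k + l + m) / 3| ≤ 3 * (jb k * jb l * jb m) :=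
    (le_mul_of_one_le_right (abs_nonneg _) n1).trans h1
  have h3 := jb_add_three_le_mul k l m
  have h4 := abs_xi_le_jb (k + l + m)
  have h5 : |xi (k + l + m) / 3| ≤ jb k * jb l * jb m := by
    rw [abs_div, abs_of_pos (by norm_num : (0 : ℝ) < 3)]; linarith
  have := abs_add_le (lam k l m - xi (k + l + m) / 3) (xi (k + l + m) / 3)
  rw [sub_add_cancel] at this
  linarith

section Symbols

variable {C : ℝ} {p : ℝ → ℝ} (hp : IsWeight C p)
include hp

lemma tri_nonneg (k l m : ℤ) : 0 ≤ tri p k l m := by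
  have := jb_pos k
  have := jb_pos l
  have := jb_pos m
  have := hp.nonneg _ (one_le_jb k)
  have := hp.nonneg _ (one_le_jb l)
  have := hp.nonneg _ (one_le_jb m)
  unfold tri
  positivity

lemma weight_mul_le_tri (k l m : ℤ) :
    p (jb (k + l + m)) * (jb k * jb l * jb m) ≤ C * jb (k + l + m) * tri p k l m :=
  hp.subadd (one_le_jb _) (one_le_jb _) (one_le_jb _) (one_le_jb _) (jb_add_three_le k l m)

/-- The nonlocal part of the nonlinearity is of order zero. -/
lemma nonlocal_symbol_le (k l m : ℤ) :
    p (jb (k + l + m)) * |lam k l m - xi (k + l + m) / 3| ≤ 3 * C * tri p k l m := by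
  have h1 := abs_lam_sub_le k l m
  have h2 := weight_mul_le_tri hp k l m
  have n0 := jb_pos (k + l + m)
  have h3 := hp.nonneg _ (one_le_jb (k + l + m))
  refine le_of_mul_le_mul_right ?_ n0
  calc _ = p (jb (k + l + m)) * (|lam k l m - xi (k + l + m) / 3| * jb (k + l + m)) := by ring
    _ ≤ p (jb (k + l + m)) * (3 * (jb k * jb l * jb m)) := by gcongr
    _ ≤ _ := by linarith

/-- The nonlinearity loses one derivative. -/
lemma symbol_le (k l m : ℤ) :
    p (jb (k + l + m)) * |lam k l m| ≤ 4 * C * jb (k + l + m) * tri p k l m := by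
  have h1 := nonlocal_symbol_le hp k l m
  have h2 := weight_mul_le_tri hp k l m
  have n1 := one_le_jb (k + l + m)
  have h3 := hp.nonneg _ (one_le_jb (k + l + m))
  have ht := tri_nonneg hp k l m
  have C0 := hp.one_le
  have h4 := jb_add_three_le_mul k l m
  have h5 : |lam k l m| ≤ |lam k l m - xi (k + l + m) / 3| + jb (k + l + m) / 3 := by
    have := abs_add_le (lam k l m - xi (k + l + m) / 3) (xi (k + l + m) / 3)
    rw [sub_add_cancel, abs_div, abs_of_pos (by norm_num : (0 : ℝ) < 3)] at this
    linarith [abs_xi_le_jb (k + l + m)]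
  have h6 : p (jb (k + l + m)) * (jb (k + l + m) / 3) ≤ C * jb (k + l + m) * tri p k l m := by
    refine le_trans ?_ h2
    gcongr
    linarith
  have h7 : 3 * C * tri p k l m ≤ 3 * C * jb (k + l + m) * tri p k l m := by
    have h8 : 0 ≤ 3 * C * tri p k l m := by positivity
    nlinarith
  calc _ ≤ p (jb (k + l + m)) * (|lam k l m - xi (k + l + m) / 3| + jb (k + l + m) / 3) := by
        gcongr
    _ ≤ _ := by linarith

lemma abs_weight_xi_sub_le (x y : ℤ) :
    |p (jb x) ^ 2 * xi x - p (jb y) ^ 2 * xi y|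
      ≤ (C + 1) * |xi x - xi y| * (p (jb x) ^ 2 + p (jb y) ^ 2) := by
  have C1 := hp.one_le
  have main : ∀ x y : ℤ, jb y ≤ jb x → |p (jb x) ^ 2 * xi x - p (jb y) ^ 2 * xi y|
      ≤ (C + 1) * |xi x - xi y| * (p (jb x) ^ 2 + p (jb y) ^ 2) := by
    intro x y h
    have h1 := hp.lip _ _ (one_le_jb y) h
    have h2 := hp.mono (one_le_jb y) h
    have h3 := hp.nonneg _ (one_le_jb y)
    have h4 : 0 ≤ p (jb x) ^ 2 - p (jb y) ^ 2 := by nlinarith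
    have h5 : |(p (jb x) ^ 2 - p (jb y) ^ 2) * xi y| ≤ C * (|xi x - xi y| * p (jb x) ^ 2) := by
      rw [abs_mul, abs_of_nonneg h4]
      calc _ ≤ (p (jb x) ^ 2 - p (jb y) ^ 2) * jb x := by
            gcongr; exact (abs_xi_le_jb y).trans h
        _ ≤ C * ((jb x - jb y) * p (jb x) ^ 2) := by linarith
        _ ≤ _ := by gcongr; linarith [jb_le_add_abs x y]
    have h6 : p (jb x) ^ 2 * xi x - p (jb y) ^ 2 * xi y
      = p (jb x) ^ 2 * (xi x - xi y) + (p (jb x) ^ 2 - p (jb y) ^ 2) * xi y := by ring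
    rw [h6]
    refine (abs_add_le _ _).trans ?_
    rw [abs_mul, abs_of_nonneg (sq_nonneg (p (jb x)))]
    have h7 : 0 ≤ (C + 1) * |xi x - xi y| * p (jb y) ^ 2 := by positivity
    linarith
  rcases le_total (jb y) (jb x) with h | h
  · exact main x y h
  · rw [abs_sub_comm, abs_sub_comm (xi x), add_comm (p (jb x) ^ 2)]
    exact main y x h

/-- The commutator estimate, in symmetrized form: of the four frequencies, the two largest carry
the weight. -/
lemma abs_sum_weight_xi_le_of_dominated {j k l m : ℤ} (h0 : j + k + l + m = 0)
    (hlj : jb l ≤ jb j) (hlk : jb l ≤ jb k) (hmj : jb m ≤ jb j) (hmk : jb m ≤ jb k) :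
    |p (jb j) ^ 2 * xi j + p (jb k) ^ 2 * xi k + p (jb l) ^ 2 * xi l + p (jb m) ^ 2 * xi m|
      ≤ 8 * C * (C + 1) * (p (jb j) * p (jb k) * (jb l * jb m)) := by
  have C1 := hp.one_le
  have pj := hp.nonneg _ (one_le_jb j)
  have pk := hp.nonneg _ (one_le_jb k)
  have pl := hp.nonneg _ (one_le_jb l)
  have pm := hp.nonneg _ (one_le_jb m)
  have l1 := one_le_jb l
  have m1 := one_le_jb m
  have g1 := abs_weight_xi_sub_le hp j (-k)
  have g2 := abs_weight_xi_sub_le hp l (-m)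
  rw [jb_neg, xi_neg, mul_neg, sub_neg_eq_add, sub_neg_eq_add] at g1 g2
  have hx : xi j + xi k = -(xi l + xi m) := by
    have := congrArg xi h0
    rw [xi_add, xi_add, xi_add] at this
    have e0 : xi 0 = 0 := by simp [xi]
    linarith
  rw [hx, abs_neg] at g1
  have hlm : |xi l + xi m| ≤ jb l + jb m :=
    (abs_add_le _ _).trans (add_le_add (abs_xi_le_jb l) (abs_xi_le_jb m))
  have hjk : p (jb j) ≤ C * p (jb k) := by
    have e : jb j ≤ 3 * jb k := by
      have := jb_add_three_le k l m
      rw [show k + l + m = -j by omega, jb_neg] at this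
      linarith
    exact (hp.mono (one_le_jb j) e).trans (hp.triple _ (one_le_jb k))
  have hkj : p (jb k) ≤ C * p (jb j) := by
    have e : jb k ≤ 3 * jb j := by
      have := jb_add_three_le j l m
      rw [show j + l + m = -k by omega, jb_neg] at this
      linarith
    exact (hp.mono (one_le_jb k) e).trans (hp.triple _ (one_le_jb j))
  have hX : 0 ≤ p (jb j) * p (jb k) := by positivity
  have qj : p (jb j) ^ 2 ≤ C * (p (jb j) * p (jb k)) := by nlinarith
  have qk : p (jb k) ^ 2 ≤ C * (p (jb j) * p (jb k)) := by nlinarith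
  have hC : p (jb j) * p (jb k) ≤ C * (p (jb j) * p (jb k)) := le_mul_of_one_le_left hX C1
  have ql : p (jb l) ^ 2 ≤ C * (p (jb j) * p (jb k)) := by
    have a := hp.mono l1 hlj
    have b := hp.mono l1 hlk
    nlinarith [mul_le_mul a b pl pj]
  have qm : p (jb m) ^ 2 ≤ C * (p (jb j) * p (jb k)) := by
    have a := hp.mono m1 hmj
    have b := hp.mono m1 hmk
    nlinarith [mul_le_mul a b pm pj]
  have hlm2 : jb l + jb m ≤ 2 * (jb l * jb m) := by nlinarith
  calc _ ≤ |p (jb j) ^ 2 * xi j + p (jb k) ^ 2 * xi k|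
        + |p (jb l) ^ 2 * xi l + p (jb m) ^ 2 * xi m| := by
        rw [add_assoc (p (jb j) ^ 2 * xi j + p (jb k) ^ 2 * xi k)]
        exact abs_add_le _ _
    _ ≤ (C + 1) * |xi l + xi m| * (p (jb j) ^ 2 + p (jb k) ^ 2)
        + (C + 1) * |xi l + xi m| * (p (jb l) ^ 2 + p (jb m) ^ 2) := add_le_add g1 g2
    _ = (C + 1) * |xi l + xi m| * (p (jb j) ^ 2 + p (jb k) ^ 2 + p (jb l) ^ 2 + p (jb m) ^ 2) := by
        ring
    _ ≤ (C + 1) * (2 * (jb l * jb m)) * (4 * (C * (p (jb j) * p (jb k)))) := by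
        gcongr
        · linarith
        · linarith
    _ = _ := by ring

end Symbols

/-- The sum over the six pairs among four frequencies of `p p ⟨·⟩ ⟨·⟩`, the weight `p` standing at
the chosen pair. -/
def pairs (p : ℝ → ℝ) (j k l m : ℤ) : ℝ :=
  p (jb j) * p (jb k) * (jb l * jb m) + p (jb j) * p (jb l) * (jb k * jb m)
    + p (jb j) * p (jb m) * (jb l * jb k) + p (jb l) * p (jb k) * (jb j * jb m)
    + p (jb m) * p (jb k) * (jb l * jb j) + p (jb l) * p (jb m) * (jb j * jb k)

lemma abs_sum_weight_xi_le {C : ℝ} {p : ℝ → ℝ} (hp : IsWeight C p) {j k l m : ℤ}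
    (h0 : j + k + l + m = 0) :
    |p (jb j) ^ 2 * xi j + p (jb k) ^ 2 * xi k + p (jb l) ^ 2 * xi l + p (jb m) ^ 2 * xi m|
      ≤ 8 * C * (C + 1) * pairs p j k l m := by
  have C1 := hp.one_le
  have pj := hp.nonneg _ (one_le_jb j)
  have pk := hp.nonneg _ (one_le_jb k)
  have pl := hp.nonneg _ (one_le_jb l)
  have pm := hp.nonneg _ (one_le_jb m)
  have j1 := jb_pos j
  have k1 := jb_pos k
  have l1 := jb_pos l
  have m1 := jb_pos m
  have a1 : 0 ≤ p (jb j) * p (jb k) * (jb l * jb m) := by positivity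
  have a2 : 0 ≤ p (jb j) * p (jb l) * (jb k * jb m) := by positivity
  have a3 : 0 ≤ p (jb j) * p (jb m) * (jb l * jb k) := by positivity
  have a4 : 0 ≤ p (jb l) * p (jb k) * (jb j * jb m) := by positivity
  have a5 : 0 ≤ p (jb m) * p (jb k) * (jb l * jb j) := by positivity
  have a6 : 0 ≤ p (jb l) * p (jb m) * (jb j * jb k) := by positivity
  have hC : 0 ≤ 8 * C * (C + 1) := by positivity
  have fin : ∀ {S S' X : ℝ}, |S'| ≤ 8 * C * (C + 1) * X → S = S' → X ≤ pairs p j k l m →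
      |S| ≤ 8 * C * (C + 1) * pairs p j k l m := fun h e hX => by
    rw [e]; exact h.trans (by gcongr)
  have sort : (jb l ≤ jb j ∧ jb l ≤ jb k ∧ jb m ≤ jb j ∧ jb m ≤ jb k) ∨
      (jb k ≤ jb j ∧ jb k ≤ jb l ∧ jb m ≤ jb j ∧ jb m ≤ jb l) ∨
      (jb k ≤ jb j ∧ jb k ≤ jb m ∧ jb l ≤ jb j ∧ jb l ≤ jb m) ∨
      (jb j ≤ jb k ∧ jb j ≤ jb l ∧ jb m ≤ jb k ∧ jb m ≤ jb l) ∨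
      (jb j ≤ jb k ∧ jb j ≤ jb m ∧ jb l ≤ jb k ∧ jb l ≤ jb m) ∨
      (jb j ≤ jb l ∧ jb j ≤ jb m ∧ jb k ≤ jb l ∧ jb k ≤ jb m) := by
    grind
  unfold pairs at *
  rcases sort with ⟨h1, h2, h3, h4⟩ | ⟨h1, h2, h3, h4⟩ | ⟨h1, h2, h3, h4⟩ | ⟨h1, h2, h3, h4⟩ |
    ⟨h1, h2, h3, h4⟩ | ⟨h1, h2, h3, h4⟩
  · exact fin (abs_sum_weight_xi_le_of_dominated hp (by omega) h1 h2 h3 h4) rfl (by linarith)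
  · exact fin (abs_sum_weight_xi_le_of_dominated hp (j := j) (k := l) (l := k) (m := m) (by omega)
      h1 h2 h3 h4) (by ring) (by linarith)
  · exact fin (abs_sum_weight_xi_le_of_dominated hp (j := j) (k := m) (l := k) (m := l) (by omega)
      h1 h2 h3 h4) (by ring) (by linarith)
  · exact fin (abs_sum_weight_xi_le_of_dominated hp (j := k) (k := l) (l := j) (m := m) (by omega)
      h1 h2 h3 h4) (by ring) (by linarith)
  · exact fin (abs_sum_weight_xi_le_of_dominated hp (j := k) (k := m) (l := j) (m := l) (by omega)
      h1 h2 h3 h4) (by ring) (by linarith)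
  · exact fin (abs_sum_weight_xi_le_of_dominated hp (j := l) (k := m) (l := j) (m := k) (by omega)
      h1 h2 h3 h4) (by ring) (by linarith)

/-! ### Quadrilinear sums over resonant frequencies -/

/-- The four frequencies `(j, k, l, m)` add up to zero. -/
def Res (t : ℤ × ℤ × ℤ × ℤ) : Prop := t.1 + (t.2.1 + t.2.2.1 + t.2.2.2) = 0

instance : DecidablePred Res := fun _ => inferInstanceAs (Decidable (_ = _))

/-- Interchange of the first and the second frequency. -/
def swap12 : ℤ × ℤ × ℤ × ℤ ≃ ℤ × ℤ × ℤ × ℤ where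
  toFun t := (t.2.1, t.1, t.2.2.1, t.2.2.2)
  invFun t := (t.2.1, t.1, t.2.2.1, t.2.2.2)
  left_inv _ := rfl
  right_inv _ := rfl

/-- Interchange of the first and the third frequency. -/
def swap13 : ℤ × ℤ × ℤ × ℤ ≃ ℤ × ℤ × ℤ × ℤ where
  toFun t := (t.2.2.1, t.2.1, t.1, t.2.2.2)
  invFun t := (t.2.2.1, t.2.1, t.1, t.2.2.2)
  left_inv _ := rfl
  right_inv _ := rfl

/-- Interchange of the first and the fourth frequency. -/
def swap14 : ℤ × ℤ × ℤ × ℤ ≃ ℤ × ℤ × ℤ × ℤ where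
  toFun t := (t.2.2.2, t.2.1, t.2.2.1, t.1)
  invFun t := (t.2.2.2, t.2.1, t.2.2.1, t.1)
  left_inv _ := rfl
  right_inv _ := rfl

/-- Interchange of the second and the third frequency. -/
def swap23 : ℤ × ℤ × ℤ × ℤ ≃ ℤ × ℤ × ℤ × ℤ where
  toFun t := (t.1, t.2.2.1, t.2.1, t.2.2.2)
  invFun t := (t.1, t.2.2.1, t.2.1, t.2.2.2)
  left_inv _ := rfl
  right_inv _ := rfl

/-- Interchange of the second and the fourth frequency. -/
def swap24 : ℤ × ℤ × ℤ × ℤ ≃ ℤ × ℤ × ℤ × ℤ where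
  toFun t := (t.1, t.2.2.2, t.2.2.1, t.2.1)
  invFun t := (t.1, t.2.2.2, t.2.2.1, t.2.1)
  left_inv _ := rfl
  right_inv _ := rfl

lemma res_swap12 (t) : Res (swap12 t) ↔ Res t := by simp only [Res, swap12, Equiv.coe_fn_mk]; omega
lemma res_swap13 (t) : Res (swap13 t) ↔ Res t := by simp only [Res, swap13, Equiv.coe_fn_mk]; omega
lemma res_swap14 (t) : Res (swap14 t) ↔ Res t := by simp only [Res, swap14, Equiv.coe_fn_mk]; omega
lemma res_swap23 (t) : Res (swap23 t) ↔ Res t := by simp only [Res, swap23, Equiv.coe_fn_mk]; omega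
lemma res_swap24 (t) : Res (swap24 t) ↔ Res t := by simp only [Res, swap24, Equiv.coe_fn_mk]; omega

lemma hasSum_res {f : ℤ × ℤ × ℤ → ℝ} {S : ℝ} (hf : HasSum f S) :
    HasSum (fun t : ℤ × ℤ × ℤ × ℤ => if Res t then f (t.1, t.2.2.1, t.2.2.2) else 0) S := by
  have hg : Function.Injective fun t : ℤ × ℤ × ℤ =>
      ((t.1, -(t.1 + t.2.1 + t.2.2), t.2.1, t.2.2) : ℤ × ℤ × ℤ × ℤ) := by
    rintro ⟨a, b, c⟩ ⟨a', b', c'⟩ h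
    simp only [Prod.mk.injEq] at h ⊢
    tauto
  refine (hg.hasSum_iff fun t ht => if_neg fun h => ht ⟨(t.1, t.2.2.1, t.2.2.2), ?_⟩).mp ?_
  · obtain ⟨j, k, l, m⟩ := t
    simp only [Res] at h
    simp only [Prod.mk.injEq, true_and, and_true]
    omega
  · convert hf using 1
    ext t
    exact if_pos (by simp only [Res]; ring)

/-- The quadrilinear form `ℓ² × ℓ² × ℓ¹ × ℓ¹ → ℝ` over resonant frequencies is bounded.
The parameter `r` is the weight in `α α' ≤ (r α² + α'²/r) / 2`, left free for later optimization. -/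
lemma quad_sum {α α' β : ℤ → ℝ} {A A' B r : ℝ} (hα0 : ∀ n, 0 ≤ α n) (hα'0 : ∀ n, 0 ≤ α' n)
    (hβ0 : ∀ n, 0 ≤ β n) (hα : HasSum (fun n => α n ^ 2) A) (hα' : HasSum (fun n => α' n ^ 2) A')
    (hβ : HasSum β B) (hr : 0 < r) :
    Summable (fun t : ℤ × ℤ × ℤ × ℤ =>
      if Res t then α t.1 * α' t.2.1 * (β t.2.2.1 * β t.2.2.2) else 0) ∧
    ∑' t : ℤ × ℤ × ℤ × ℤ, (if Res t then α t.1 * α' t.2.1 * (β t.2.2.1 * β t.2.2.2) else 0)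
      ≤ (r * A + r⁻¹ * A') / 2 * B ^ 2 := by
  have base : ∀ {γ : ℤ → ℝ} {G : ℝ}, HasSum (fun n => γ n ^ 2) G → HasSum
      (fun t : ℤ × ℤ × ℤ => γ t.1 ^ 2 * (β t.2.1 * β t.2.2)) (G * (B * B)) := by
    intro γ G hG
    have h2 := hβ.mul hβ (hβ.summable.mul_of_nonneg hβ.summable hβ0 hβ0)
    exact hG.mul h2 (hG.summable.mul_of_nonneg h2.summable (fun n => sq_nonneg _)
      (fun n => mul_nonneg (hβ0 _) (hβ0 _)))
  have h1 := hasSum_res (base hα)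
  have h2 := swap12.hasSum_iff.mpr (hasSum_res (base hα'))
  have h3 := (h1.mul_left (r / 2)).add (h2.mul_left (r⁻¹ / 2))
  have hle : ∀ t : ℤ × ℤ × ℤ × ℤ,
      (if Res t then α t.1 * α' t.2.1 * (β t.2.2.1 * β t.2.2.2) else 0) ≤
      r / 2 * (if Res t then α t.1 ^ 2 * (β t.2.2.1 * β t.2.2.2) else 0) + r⁻¹ / 2 *
        (((fun t : ℤ × ℤ × ℤ × ℤ => if Res t then α' t.1 ^ 2 * (β t.2.2.1 * β t.2.2.2) else 0)
          ∘ swap12) t) := by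
    intro t
    simp only [Function.comp, res_swap12]
    split_ifs with h
    · simp only [swap12, Equiv.coe_fn_mk]
      have hb : 0 ≤ β t.2.2.1 * β t.2.2.2 := mul_nonneg (hβ0 _) (hβ0 _)
      have hs : α t.1 * α' t.2.1 ≤ r / 2 * α t.1 ^ 2 + r⁻¹ / 2 * α' t.2.1 ^ 2 := by
        have h4 : 0 ≤ r⁻¹ / 2 * (r * α t.1 - α' t.2.1) ^ 2 := by positivity
        have h5 : r⁻¹ / 2 * (r * α t.1 - α' t.2.1) ^ 2
          = r / 2 * α t.1 ^ 2 + r⁻¹ / 2 * α' t.2.1 ^ 2 - α t.1 * α' t.2.1 := by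
          field_simp
          ring
        linarith
      nlinarith
    · simp
  have h0 : ∀ t : ℤ × ℤ × ℤ × ℤ,
      0 ≤ if Res t then α t.1 * α' t.2.1 * (β t.2.2.1 * β t.2.2.2) else 0 := fun t => by
    have := hα0 t.1
    have := hα'0 t.2.1
    have := hβ0 t.2.2.1
    have := hβ0 t.2.2.2
    split_ifs <;> positivity
  have hs : Summable fun t : ℤ × ℤ × ℤ × ℤ =>
      if Res t then α t.1 * α' t.2.1 * (β t.2.2.1 * β t.2.2.2) else 0 :=
    h3.summable.of_nonneg_of_le h0 hle
  refine ⟨hs, (hs.tsum_le_tsum hle h3.summable).trans ?_⟩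
  rw [h3.tsum_eq]
  exact le_of_eq (by ring)

lemma hasSum_three_perms {T : ℤ × ℤ × ℤ × ℤ → ℝ} (hs : Summable T) :
    HasSum (fun t => T t + T (swap23 t) + T (swap24 t)) (3 * ∑' t, T t) := by
  have h := (hs.hasSum.add (swap23.hasSum_iff.mpr hs.hasSum)).add (swap24.hasSum_iff.mpr hs.hasSum)
  have e : 3 * ∑' t, T t = ∑' t, T t + ∑' t, T t + ∑' t, T t := by ring
  rw [e]
  exact h

lemma hasSum_six_perms {T : ℤ × ℤ × ℤ × ℤ → ℝ} (hs : Summable T) :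
    HasSum (fun t => T t + T (swap23 t) + T (swap24 t)
      + (T (swap13 t) + T (swap14 t) + T (swap13 (swap24 t)))) (6 * ∑' t, T t) := by
  have h := (hasSum_three_perms hs).add (((swap13.hasSum_iff.mpr hs.hasSum).add
    (swap14.hasSum_iff.mpr hs.hasSum)).add ((swap24.trans swap13).hasSum_iff.mpr hs.hasSum))
  have e : 6 * ∑' t, T t = 3 * ∑' t, T t + (∑' t, T t + ∑' t, T t + ∑' t, T t) := by ring
  rw [e]
  exact h

section

variable {a : ℤ → ℂ} {p : ℝ → ℝ} {C E B : ℝ}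

/-- `∑ p p ⟨·⟩⟨·⟩ |a a a a|`, summed over all pairs and all resonant frequencies. -/
lemma hasSum_pairs (hp : IsWeight C p) (hE : HasSum (fun n => (p (jb n) * ‖a n‖) ^ 2) E)
    (hB : HasSum (fun n => jb n * ‖a n‖) B) :
    Summable (fun t : ℤ × ℤ × ℤ × ℤ => if Res t then pairs p t.1 t.2.1 t.2.2.1 t.2.2.2 *
      (‖a t.1‖ * ‖a t.2.1‖ * ‖a t.2.2.1‖ * ‖a t.2.2.2‖) else 0) ∧
    ∑' t : ℤ × ℤ × ℤ × ℤ, (if Res t then pairs p t.1 t.2.1 t.2.2.1 t.2.2.2 *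
      (‖a t.1‖ * ‖a t.2.1‖ * ‖a t.2.2.1‖ * ‖a t.2.2.2‖) else 0) ≤ 6 * (B ^ 2 * E) := by
  have p0 := fun n => mul_nonneg (hp.nonneg _ (one_le_jb n)) (norm_nonneg (a n))
  have b0 := fun n => mul_nonneg (jb_pos n).le (norm_nonneg (a n))
  obtain ⟨hs, hle⟩ := quad_sum p0 p0 b0 hE hE hB one_pos
  obtain ⟨T, hT⟩ : ∃ T : ℤ × ℤ × ℤ × ℤ → ℝ, T = fun t => if Res t then
    p (jb t.1) * ‖a t.1‖ * (p (jb t.2.1) * ‖a t.2.1‖) *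
    (jb t.2.2.1 * ‖a t.2.2.1‖ * (jb t.2.2.2 * ‖a t.2.2.2‖)) else 0 := ⟨_, rfl⟩
  rw [← hT] at hs hle
  have hle' : ∑' t, T t ≤ B ^ 2 * E := hle.trans (le_of_eq (by norm_num; ring))
  have e : (fun t : ℤ × ℤ × ℤ × ℤ => if Res t then pairs p t.1 t.2.1 t.2.2.1 t.2.2.2 *
      (‖a t.1‖ * ‖a t.2.1‖ * ‖a t.2.2.1‖ * ‖a t.2.2.2‖) else 0) =
      fun t => T t + T (swap23 t) + T (swap24 t)
        + (T (swap13 t) + T (swap14 t) + T (swap13 (swap24 t))) := by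
    ext t
    simp only [hT, res_swap13, res_swap14, res_swap23, res_swap24]
    split_ifs with h
    · simp only [pairs, swap13, swap14, swap23, swap24, Equiv.coe_fn_mk]
      ring
    · simp
  have H := hasSum_six_perms hs
  rw [e]
  refine ⟨H.summable, ?_⟩
  rw [H.tsum_eq]
  linarith

/-- A pairing with the nonlinearity is a sum over resonant frequencies. -/
lemma hasSum_pairing {b : ℤ → ℂ} (hs : Summable fun t : ℤ × ℤ × ℤ × ℤ => if Res t then
      b t.1 * (-Complex.I * lam t.2.1 t.2.2.1 t.2.2.2 * (a t.2.1 * a t.2.2.1 * a t.2.2.2)) else 0) :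
    HasSum (fun n => b (-n) * nl a n) (∑' t : ℤ × ℤ × ℤ × ℤ, if Res t then
      b t.1 * (-Complex.I * lam t.2.1 t.2.2.1 t.2.2.2 *
        (a t.2.1 * a t.2.2.1 * a t.2.2.2)) else 0) := by
  have h := hs.hasSum.prod_fiberwise fun j => (hs.prod_factor j).hasSum
  have h2 := (Equiv.neg ℤ).hasSum_iff.mpr h
  refine hasSum_of_forall_eq (fun n => ?_) h2
  simp only [Function.comp, Equiv.neg_apply, nl, ← tsum_mul_left]
  refine tsum_congr fun t => ?_
  by_cases ht : t.1 + t.2.1 + t.2.2 = n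
  · rw [if_pos ht, if_pos (by simp only [Res]; omega)]
  · rw [if_neg ht, if_neg (by simp only [Res]; omega), mul_zero]

/-- The nonlinearity maps the space with weight `p` to the one with weight `p/⟨·⟩`. -/
lemma sum_nl_sq_le (hp : IsWeight C p) (hE : HasSum (fun n => (p (jb n) * ‖a n‖) ^ 2) E)
    (hB : HasSum (fun n => jb n * ‖a n‖) B) (S : Finset ℤ) :
    ∑ n ∈ S, (p (jb n) / jb n * ‖nl a n‖) ^ 2 ≤ (12 * C * B ^ 2) ^ 2 * E := by
  classical
  have C1 := hp.one_le
  have p0 : ∀ n, 0 ≤ p (jb n) := fun n => hp.nonneg _ (one_le_jb n)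
  -- duality: the nonlinearity is paired with its own truncation to `S`, suitably weighted, so that
  -- `X` occurs on both sides and is absorbed by the choice of `r`
  set α : ℤ → ℝ := fun j => if -j ∈ S then p (jb j) / jb j * ‖nl a (-j)‖ else 0 with hα
  set X := ∑ n ∈ S, (p (jb n) / jb n * ‖nl a n‖) ^ 2 with hX
  have hαX : HasSum (fun n => α n ^ 2) X := by
    have h : HasSum (fun n => α (-n) ^ 2) (∑ n ∈ S, α (-n) ^ 2) :=
      hasSum_sum_of_ne_finset_zero fun n hn => by simp [hα, hn]
    have h2 := (Equiv.neg ℤ).hasSum_iff.mpr h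
    have e : ∑ n ∈ S, α (-n) ^ 2 = X := Finset.sum_congr rfl fun n hn => by
      simp [hα, hn, jb_neg]
    rw [e] at h2
    simpa [Function.comp_def] using h2
  have α0 : ∀ n, 0 ≤ α n := fun n => by
    have := p0 n
    have := jb_pos n
    simp only [hα]; split_ifs <;> positivity
  have pa0 := fun n => mul_nonneg (p0 n) (norm_nonneg (a n))
  have b0 := fun n => mul_nonneg (jb_pos n).le (norm_nonneg (a n))
  obtain ⟨T, hT⟩ : ∃ T : ℤ × ℤ × ℤ × ℤ → ℝ, T = fun t => if Res t then
    α t.1 * (p (jb t.2.1) * ‖a t.2.1‖) *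
    (jb t.2.2.1 * ‖a t.2.2.1‖ * (jb t.2.2.2 * ‖a t.2.2.2‖)) else 0 := ⟨_, rfl⟩
  set b : ℤ → ℂ := fun j => if -j ∈ S then
    ((p (jb j) / jb j) ^ 2 : ℝ) * (starRingEnd ℂ) (nl a (-j)) else 0 with hb
  have hbound : ∀ t : ℤ × ℤ × ℤ × ℤ, ‖if Res t then b t.1 * (-Complex.I *
      lam t.2.1 t.2.2.1 t.2.2.2 * (a t.2.1 * a t.2.2.1 * a t.2.2.2)) else 0‖
      ≤ 4 * C * (T t + T (swap23 t) + T (swap24 t)) := by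
    rintro ⟨j, k, l, m⟩
    simp only [hT, res_swap23, res_swap24]
    split_ifs with h
    · simp only [swap23, swap24, Equiv.coe_fn_mk]
      have hj : jb (k + l + m) = jb j := by
        rw [← jb_neg]; congr 1; simp only [Res] at h; omega
      have hsym := symbol_le hp k l m
      rw [hj] at hsym
      have hj0 := jb_pos j
      have hsym2 : p (jb j) / jb j * |lam k l m| ≤ 4 * C * tri p k l m := by
        rw [div_mul_eq_mul_div, div_le_iff₀ hj0]; linarith
      have hbj : ‖b j‖ = p (jb j) / jb j * α j := by
        simp only [hb, hα]
        split_ifs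
        · rw [norm_mul, Complex.norm_real, RCLike.norm_conj, Real.norm_of_nonneg (sq_nonneg _)]
          ring
        · simp
      simp only [norm_mul, norm_neg, Complex.norm_I, Complex.norm_real, Real.norm_eq_abs, one_mul,
        hbj]
      calc _ = (p (jb j) / jb j * |lam k l m|) * (α j * (‖a k‖ * ‖a l‖ * ‖a m‖)) := by ring
        _ ≤ (4 * C * tri p k l m) * (α j * (‖a k‖ * ‖a l‖ * ‖a m‖)) := by
            have := α0 j
            gcongr
        _ = _ := by unfold tri; ring
    · simp
  have key : ∀ r : ℝ, 0 < r → X ≤ 6 * C * B ^ 2 * (r * X + r⁻¹ * E) := by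
    intro r hr
    obtain ⟨hs, hle⟩ := quad_sum α0 pa0 b0 hαX hE hB hr
    rw [← hT] at hs hle
    have H := (hasSum_three_perms hs).mul_left (4 * C)
    have hsn := H.summable.of_nonneg_of_le (fun t => norm_nonneg _) hbound
    have h1 := hasSum_pairing hsn.of_norm
    have h2 : HasSum (fun n => b (-n) * nl a n) (X : ℂ) := by
      have h : HasSum (fun n => b (-n) * nl a n) (∑ n ∈ S, b (-n) * nl a n) :=
        hasSum_sum_of_ne_finset_zero fun n hn => by simp [hb, hn]
      convert h using 1
      rw [hX, Complex.ofReal_sum]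
      refine Finset.sum_congr rfl fun n hn => ?_
      simp only [hb, neg_neg, hn, if_true, jb_neg]
      rw [mul_assoc, Complex.conj_mul', mul_pow]
      push_cast
      ring
    have h3 : ‖(X : ℂ)‖ ≤ 4 * C * (3 * ∑' t, T t) := by
      rw [← h1.unique h2]
      exact (norm_tsum_le_tsum_norm hsn).trans
        ((hsn.tsum_le_tsum hbound H.summable).trans (le_of_eq H.tsum_eq))
    rw [Complex.norm_real] at h3
    have h4 : ∑' t, T t ≤ (r * X + r⁻¹ * E) / 2 * B ^ 2 := hle
    calc X ≤ ‖X‖ := Real.le_norm_self X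
      _ ≤ 4 * C * (3 * ∑' t, T t) := h3
      _ = 12 * C * ∑' t, T t := by ring
      _ ≤ 12 * C * ((r * X + r⁻¹ * E) / 2 * B ^ 2) := by gcongr
      _ = _ := by ring
  have E0 : 0 ≤ E := hE.nonneg fun n => sq_nonneg _
  rcases (by positivity : 0 ≤ 12 * C * B ^ 2).eq_or_lt with hD | hD
  · have := key 1 one_pos
    rw [← hD]
    nlinarith
  · have h := key (12 * C * B ^ 2)⁻¹ (by positivity)
    rw [inv_inv] at h
    have e : 6 * C * B ^ 2 * ((12 * C * B ^ 2)⁻¹ * X + 12 * C * B ^ 2 * E)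
        = X / 2 + (12 * C * B ^ 2) ^ 2 * E / 2 := by
      have : 12 * C * B ^ 2 ≠ 0 := hD.ne'
      have hx : 6 * C * B ^ 2 * (12 * C * B ^ 2)⁻¹ = 1 / 2 := by
        rw [mul_inv_eq_iff_eq_mul₀ this]; ring
      linear_combination X * hx
    linarith

/-- The energy estimate: for a trigonometric polynomial, the weighted energy `∑ p² |a|²` grows at
most at the rate `(∑ ⟨·⟩ |a|)² ∑ p² |a|²`, although the nonlinearity loses one derivative. -/
lemma abs_energy_le (hp : IsWeight C p) (S : Finset ℤ) (hS : ∀ n, n ∉ S → a n = 0)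
    (ha : ∀ n, a (-n) = (starRingEnd ℂ) (a n)) :
    |∑ n ∈ S, p (jb n) ^ 2 * ((starRingEnd ℂ) (a n) * nl a n).re|
      ≤ 26 * C ^ 2 * ((∑ n ∈ S, jb n * ‖a n‖) ^ 2 * ∑ n ∈ S, (p (jb n) * ‖a n‖) ^ 2) := by
  have C1 := hp.one_le
  have hE : HasSum (fun n => (p (jb n) * ‖a n‖) ^ 2) (∑ n ∈ S, (p (jb n) * ‖a n‖) ^ 2) :=
    hasSum_sum_of_ne_finset_zero fun n hn => by simp [hS n hn]
  have hB : HasSum (fun n => jb n * ‖a n‖) (∑ n ∈ S, jb n * ‖a n‖) :=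
    hasSum_sum_of_ne_finset_zero fun n hn => by simp [hS n hn]
  set E := ∑ n ∈ S, (p (jb n) * ‖a n‖) ^ 2
  set B := ∑ n ∈ S, jb n * ‖a n‖
  obtain ⟨hPs, hPle⟩ := hasSum_pairs hp hE hB
  obtain ⟨P, hP⟩ : ∃ P : ℤ × ℤ × ℤ × ℤ → ℝ, P = fun t => if Res t then
      pairs p t.1 t.2.1 t.2.2.1 t.2.2.2 *
      (‖a t.1‖ * ‖a t.2.1‖ * ‖a t.2.2.1‖ * ‖a t.2.2.2‖) else 0 := ⟨_, rfl⟩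
  rw [← hP] at hPs hPle
  -- the nonlocal part of the nonlinearity
  obtain ⟨N, hN⟩ : ∃ N : ℤ × ℤ × ℤ × ℤ → ℂ, N = fun t => if Res t then
      ((p (jb t.1) ^ 2 * (lam t.2.1 t.2.2.1 t.2.2.2 - xi (t.2.1 + t.2.2.1 + t.2.2.2) / 3) : ℝ) : ℂ)
      * (a t.1 * a t.2.1 * a t.2.2.1 * a t.2.2.2) else 0 := ⟨_, rfl⟩
  have hNle : ∀ t, ‖N t‖ ≤ 3 * C * P t := by
    rintro ⟨j, k, l, m⟩
    simp only [hN, hP]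
    split_ifs with h
    · have hj : jb (k + l + m) = jb j := by
        rw [← jb_neg]; congr 1; simp only [Res] at h; omega
      have hsym := nonlocal_symbol_le hp k l m
      rw [hj] at hsym
      have pj := hp.nonneg _ (one_le_jb j)
      have pk := hp.nonneg _ (one_le_jb k)
      have pl := hp.nonneg _ (one_le_jb l)
      have pm := hp.nonneg _ (one_le_jb m)
      have j0 := jb_pos j
      have k0 := jb_pos k
      have l0 := jb_pos l
      have m0 := jb_pos m
      have htri : p (jb j) * tri p k l m ≤ pairs p j k l m := by
        have a1 : 0 ≤ p (jb l) * p (jb k) * (jb j * jb m) := by positivity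
        have a2 : 0 ≤ p (jb m) * p (jb k) * (jb l * jb j) := by positivity
        have a3 : 0 ≤ p (jb l) * p (jb m) * (jb j * jb k) := by positivity
        unfold pairs tri
        linarith
      simp only [norm_mul, Complex.norm_real, Real.norm_eq_abs, abs_of_nonneg pj,
        abs_pow]
      rw [← mul_assoc (3 * C)]
      gcongr ?_ * _
      calc _ = p (jb j) * (p (jb j) * |lam k l m - xi (k + l + m) / 3|) := by ring
        _ ≤ p (jb j) * (3 * C * tri p k l m) := by gcongr
        _ = 3 * C * (p (jb j) * tri p k l m) := by ring
        _ ≤ _ := by gcongr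
    · simp
  have hNs : Summable fun t => ‖N t‖ :=
    (hPs.mul_left (3 * C)).of_nonneg_of_le (fun _ => norm_nonneg _) hNle
  have hNb : ‖∑' t, N t‖ ≤ 3 * C * (6 * (B ^ 2 * E)) := by
    refine (norm_tsum_le_tsum_norm hNs).trans ?_
    refine (hNs.tsum_le_tsum hNle (hPs.mul_left _)).trans ?_
    rw [tsum_mul_left]
    gcongr
  -- the transport part, symmetrized by exchanging `j` with each of the other frequencies
  obtain ⟨G, hG⟩ : ∃ G : ℤ × ℤ × ℤ × ℤ → ℂ, G = fun t => if Res t then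
      ((p (jb t.1) ^ 2 * xi t.1 : ℝ) : ℂ)
      * (a t.1 * a t.2.1 * a t.2.2.1 * a t.2.2.2) else 0 := ⟨_, rfl⟩
  have hGs : Summable G := by
    refine summable_of_ne_finset_zero (s := S ×ˢ S ×ˢ S ×ˢ S) fun t ht => ?_
    have : a t.1 * a t.2.1 * a t.2.2.1 * a t.2.2.2 = 0 := by
      by_contra h0
      refine ht ?_
      simp only [mul_eq_zero, not_or] at h0
      obtain ⟨⟨⟨h1, h2⟩, h3⟩, h4⟩ := h0
      simp only [Finset.mem_product]
      exact ⟨not_imp_comm.mp (hS _) h1, not_imp_comm.mp (hS _) h2, not_imp_comm.mp (hS _) h3,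
        not_imp_comm.mp (hS _) h4⟩
    simp [hG, this]
  have hG4 : HasSum (fun t => G t + G (swap12 t) + G (swap13 t) + G (swap14 t))
      (4 * ∑' t, G t) := by
    have h := ((hGs.hasSum.add (swap12.hasSum_iff.mpr hGs.hasSum)).add
      (swap13.hasSum_iff.mpr hGs.hasSum)).add (swap14.hasSum_iff.mpr hGs.hasSum)
    have e : 4 * ∑' t, G t = ∑' t, G t + ∑' t, G t + ∑' t, G t + ∑' t, G t := by ring
    rw [e]
    exact h
  have hG4le : ∀ t, ‖G t + G (swap12 t) + G (swap13 t) + G (swap14 t)‖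
      ≤ 8 * C * (C + 1) * P t := by
    rintro ⟨j, k, l, m⟩
    simp only [hG, hP, res_swap12, res_swap13, res_swap14]
    split_ifs with h
    · simp only [swap12, swap13, swap14, Equiv.coe_fn_mk]
      have hsym := abs_sum_weight_xi_le hp (j := j) (k := k) (l := l) (m := m)
        (by simp only [Res] at h; omega)
      have e : ((p (jb j) ^ 2 * xi j : ℝ) : ℂ) * (a j * a k * a l * a m)
          + ((p (jb k) ^ 2 * xi k : ℝ) : ℂ) * (a k * a j * a l * a m)
          + ((p (jb l) ^ 2 * xi l : ℝ) : ℂ) * (a l * a k * a j * a m)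
          + ((p (jb m) ^ 2 * xi m : ℝ) : ℂ) * (a m * a k * a l * a j)
          = ((p (jb j) ^ 2 * xi j + p (jb k) ^ 2 * xi k + p (jb l) ^ 2 * xi l
            + p (jb m) ^ 2 * xi m : ℝ) : ℂ) * (a j * a k * a l * a m) := by
        push_cast; ring
      rw [e, norm_mul, Complex.norm_real, Real.norm_eq_abs, ← mul_assoc (8 * C * (C + 1))]
      simp only [norm_mul]
      gcongr
    · simp
  have hG4s : Summable fun t => ‖G t + G (swap12 t) + G (swap13 t) + G (swap14 t)‖ :=
    (hPs.mul_left (8 * C * (C + 1))).of_nonneg_of_le (fun _ => norm_nonneg _) hG4le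
  have hGb : ‖4 * ∑' t, G t‖ ≤ 8 * C * (C + 1) * (6 * (B ^ 2 * E)) := by
    rw [← hG4.tsum_eq]
    refine (norm_tsum_le_tsum_norm hG4s).trans ?_
    refine (hG4s.tsum_le_tsum hG4le (hPs.mul_left _)).trans ?_
    rw [tsum_mul_left]
    gcongr
  -- the pairing of `p² a` with the nonlinearity
  have hsplit := (hNs.of_norm.hasSum.mul_left (-Complex.I)).add
    (hGs.hasSum.mul_left (Complex.I / 3))
  set b : ℤ → ℂ := fun j => (p (jb j) ^ 2 : ℝ) * a j with hb
  have hterm : (fun t : ℤ × ℤ × ℤ × ℤ => if Res t then b t.1 * (-Complex.I *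
      lam t.2.1 t.2.2.1 t.2.2.2 * (a t.2.1 * a t.2.2.1 * a t.2.2.2)) else 0)
      = fun t => -Complex.I * N t + Complex.I / 3 * G t := by
    ext t
    obtain ⟨j, k, l, m⟩ := t
    simp only [hN, hG, hb]
    split_ifs with h
    · have hx : xi j = -xi (k + l + m) := by
        rw [← xi_neg]; congr 1; simp only [Res] at h; omega
      rw [hx]
      push_cast
      ring
    · simp
  have hpair := hasSum_pairing (a := a) (b := b) (by rw [hterm]; exact hsplit.summable)
  rw [hterm, hsplit.tsum_eq] at hpair
  have hfin : HasSum (fun n => b (-n) * nl a n) (∑ n ∈ S, b (-n) * nl a n) :=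
    hasSum_sum_of_ne_finset_zero fun n hn => by simp [hb, ha, hS n hn]
  have hre : ∑ n ∈ S, p (jb n) ^ 2 * ((starRingEnd ℂ) (a n) * nl a n).re
      = (∑ n ∈ S, b (-n) * nl a n).re := by
    rw [Complex.re_sum]
    refine Finset.sum_congr rfl fun n _ => ?_
    simp only [hb, ha, jb_neg, mul_assoc, Complex.re_ofReal_mul]
  rw [hre, hfin.unique hpair]
  have hBE : 0 ≤ B ^ 2 * E :=
    mul_nonneg (sq_nonneg _) (hE.nonneg fun n => sq_nonneg _)
  have hGb' : ‖∑' t, G t‖ ≤ 12 * C * (C + 1) * (B ^ 2 * E) := by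
    rw [norm_mul, Complex.norm_ofNat] at hGb
    linarith
  calc _ ≤ ‖-Complex.I * ∑' t, N t + Complex.I / 3 * ∑' t, G t‖ := Complex.abs_re_le_norm _
    _ ≤ ‖-Complex.I * ∑' t, N t‖ + ‖Complex.I / 3 * ∑' t, G t‖ := norm_add_le _ _
    _ = ‖∑' t, N t‖ + ‖∑' t, G t‖ / 3 := by
        simp only [norm_mul, norm_neg, Complex.norm_I, one_mul, norm_div, Complex.norm_ofNat]
        ring
    _ ≤ (22 * C + 4 * C ^ 2) * (B ^ 2 * E) := by linarith
    _ ≤ _ := by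
        gcongr
        nlinarith

end

/-! ### Galerkin approximations -/

lemma lam_neg (k l m : ℤ) : lam (-k) (-l) (-m) = -lam k l m := by
  have e : -k + -l + -m = -(k + l + m) := by ring
  simp only [lam, e, xi_neg, symb_neg]
  ring

/-- The nonlinearity commutes with the reflection that fixes the coefficients of real functions. -/
lemma nl_reflect (a : ℤ → ℂ) (n : ℤ) :
    nl (fun k => (starRingEnd ℂ) (a (-k))) n = (starRingEnd ℂ) (nl a (-n)) := by
  rw [nl, nl, Complex.conj_tsum, ← (Equiv.neg (ℤ × ℤ × ℤ)).tsum_eq]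
  refine tsum_congr fun t => ?_
  simp only [Equiv.neg_apply, Prod.fst_neg, Prod.snd_neg, neg_neg, lam_neg, apply_ite (starRingEnd ℂ),
    map_mul, map_neg, Complex.conj_I, Complex.conj_ofReal, map_zero]
  refine if_congr (by omega) ?_ rfl
  push_cast
  ring

lemma nl_eq_sum {a : ℤ → ℂ} {S : Finset ℤ} (hS : ∀ n, n ∉ S → a n = 0) (n : ℤ) :
    nl a n = ∑ t ∈ S ×ˢ S ×ˢ S, if t.1 + t.2.1 + t.2.2 = n then
      -Complex.I * lam t.1 t.2.1 t.2.2 * (a t.1 * a t.2.1 * a t.2.2) else 0 := by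
  refine tsum_eq_sum fun t ht => ?_
  have : a t.1 * a t.2.1 * a t.2.2 = 0 := by
    by_contra h0
    refine ht ?_
    simp only [mul_eq_zero, not_or] at h0
    obtain ⟨⟨h1, h2⟩, h3⟩ := h0
    simp only [Finset.mem_product]
    exact ⟨not_imp_comm.mp (hS _) h1, not_imp_comm.mp (hS _) h2, not_imp_comm.mp (hS _) h3⟩
  simp [this]

/-- The energy `∑_{n ∈ S} p(⟨n⟩)² |a n|²` of the modes in `S`. -/
def en (p : ℝ → ℝ) (S : Finset ℤ) (a : ℤ → ℂ) : ℝ := ∑ n ∈ S, (p (jb n) * ‖a n‖) ^ 2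

lemma en_nonneg (p : ℝ → ℝ) (S : Finset ℤ) (a : ℤ → ℂ) : 0 ≤ en p S a :=
  Finset.sum_nonneg fun _ _ => sq_nonneg _

/-- Extension by zero of a sequence indexed by a finite set of frequencies. -/
def extend (S : Finset ℤ) (x : S → ℂ) (n : ℤ) : ℂ := if h : n ∈ S then x ⟨n, h⟩ else 0

lemma contDiff_extend (S : Finset ℤ) (n : ℤ) : ContDiff ℝ 1 fun x : S → ℂ => extend S x n := by
  by_cases h : n ∈ S
  · simp only [extend, h, dif_pos]
    exact contDiff_apply ℝ ℂ _
  · simp only [extend, h, dif_neg, not_false_eq_true]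
    exact contDiff_const

lemma extend_of_notMem {S : Finset ℤ} (x : S → ℂ) {n : ℤ} (h : n ∉ S) : extend S x n = 0 :=
  dif_neg h

/-- The Galerkin vector field, cut off where the `H²` energy exceeds `2R`. -/
def field (R : ℝ) (S : Finset ℤ) (x : S → ℂ) (n : S) : ℂ :=
  Real.smoothTransition (2 - en (wt 2 1) S (extend S x) / R) • nl (extend S x) n

lemma contDiff_field (R : ℝ) (S : Finset ℤ) : ContDiff ℝ 1 (field R S) := by
  refine contDiff_pi.mpr fun n => ?_
  have h0 : ContDiff ℝ 1 fun x : S → ℂ => en (wt 2 1) S (extend S x) := by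
    simp only [en, mul_pow]
    exact ContDiff.sum fun k _ => contDiff_const.mul ((contDiff_extend S k).norm_sq ℝ)
  have h1 : ContDiff ℝ 1 fun x : S → ℂ =>
      Real.smoothTransition (2 - en (wt 2 1) S (extend S x) / R) :=
    Real.smoothTransition.contDiff.comp (contDiff_const.sub (h0.div_const R))
  have h2 : ContDiff ℝ 1 fun x : S → ℂ => nl (extend S x) n := by
    have e : (fun x : S → ℂ => nl (extend S x) n) = fun x => ∑ t ∈ S ×ˢ S ×ˢ S,
        if t.1 + t.2.1 + t.2.2 = n then -Complex.I * lam t.1 t.2.1 t.2.2 *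
          (extend S x t.1 * extend S x t.2.1 * extend S x t.2.2) else 0 :=
      funext fun x => nl_eq_sum (fun k => extend_of_notMem x) n
    rw [e]
    refine ContDiff.sum fun t _ => ?_
    split_ifs
    · exact contDiff_const.mul (((contDiff_extend S _).mul (contDiff_extend S _)).mul
        (contDiff_extend S _))
    · exact contDiff_const
  exact h1.smul h2

lemma wt_two_one (n : ℤ) : wt 2 1 (jb n) = jb n ^ 2 := by
  rw [wt, div_one, min_eq_left (one_le_jb n), Real.sqrt_one, mul_one, Real.rpow_ofNat]

lemma hasCompactSupport_field {R : ℝ} (hR : 0 < R) (S : Finset ℤ) :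
    HasCompactSupport (field R S) := by
  refine HasCompactSupport.intro (isCompact_closedBall 0 √(2 * R)) fun x hx => ?_
  have h : 2 * R ≤ en (wt 2 1) S (extend S x) := by
    by_contra! h
    refine hx ?_
    rw [mem_closedBall_zero_iff, pi_norm_le_iff_of_nonneg (Real.sqrt_nonneg _)]
    rintro ⟨n, hn⟩
    refine Real.le_sqrt_of_sq_le (le_trans ?_ h.le)
    refine le_trans ?_ (Finset.single_le_sum (f := fun n => (wt 2 1 (jb n) * ‖extend S x n‖) ^ 2)
      (fun _ _ => sq_nonneg _) hn)
    have e : extend S x n = x ⟨n, hn⟩ := dif_pos hn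
    rw [wt_two_one, e, mul_pow]
    exact le_mul_of_one_le_left (sq_nonneg _) (one_le_pow₀ (one_le_pow₀ (one_le_jb n)))
  ext n
  rw [field, Real.smoothTransition.zero_of_nonpos, zero_smul, Pi.zero_apply]
  rw [sub_nonpos, le_div_iff₀ hR]
  exact h

lemma field_reflect {R : ℝ} {S : Finset ℤ} (hS : ∀ n ∈ S, -n ∈ S) (x : S → ℂ) (n : S) :
    field R S (fun k => (starRingEnd ℂ) (x ⟨-k, hS k k.2⟩)) n
      = (starRingEnd ℂ) (field R S x ⟨-n, hS n n.2⟩) := by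
  have hS' : ∀ n, -n ∈ S ↔ n ∈ S := fun n => ⟨fun h => by simpa using hS _ h, hS n⟩
  have e : extend S (fun k => (starRingEnd ℂ) (x ⟨-k, hS k k.2⟩))
      = fun k => (starRingEnd ℂ) (extend S x (-k)) := by
    ext k
    by_cases hk : k ∈ S
    · simp [extend, hk, hS k hk]
    · simp [extend, hk, hS']
  have e2 : en (wt 2 1) S (fun k => (starRingEnd ℂ) (extend S x (-k)))
      = en (wt 2 1) S (extend S x) := by
    refine Finset.sum_nbij' (fun k => -k) (fun k => -k) (fun k hk => hS k hk)
      (fun k hk => hS k hk) (by simp) (by simp) fun k _ => ?_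
    simp only [RCLike.norm_conj, jb_neg]
  rw [field, e, e2, nl_reflect, field]
  simp

/-- The symmetric frequency window `{-N, …, N}`. -/
def window (N : ℕ) : Finset ℤ := Finset.Icc (-N) N

lemma neg_mem_window {N : ℕ} (n : ℤ) (hn : n ∈ window N) : -n ∈ window N := by
  simp only [window, Finset.mem_Icc] at *
  omega

/-- The Galerkin approximation to Novikov's equation, with the factor `θ` of the cut-off. -/
structure IsGalerkin (R : ℝ) (N : ℕ) (a₀ : ℤ → ℂ) (a : ℝ → ℤ → ℂ) (θ : ℝ → ℝ) : Prop where
  init : ∀ n ∈ window N, a 0 n = a₀ n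
  supp : ∀ t, ∀ n, n ∉ window N → a t n = 0
  symm : ∀ t ∈ Set.Ioo (-2 : ℝ) 2, ∀ n, a t (-n) = (starRingEnd ℂ) (a t n)
  nonneg : ∀ t, 0 ≤ θ t
  le_one : ∀ t, θ t ≤ 1
  eq_one : ∀ t, en (wt 2 1) (window N) (a t) ≤ R → θ t = 1
  eq_zero : ∀ t, 2 * R ≤ en (wt 2 1) (window N) (a t) → θ t = 0
  eqn : ∀ t ∈ Set.Ioo (-2 : ℝ) 2, ∀ n ∈ window N,
    HasDerivAt (fun τ => a τ n) (θ t * nl (a t) n) t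

/-- The cut-off field is continuously differentiable with compact support, so that its trajectories
exist on `[-2, 2]`; the symmetry `a(-n) = conj a(n)` of the datum persists by uniqueness. -/
lemma exists_isGalerkin {R : ℝ} (hR : 0 < R) (N : ℕ) {a₀ : ℤ → ℂ}
    (ha₀ : ∀ n, a₀ (-n) = (starRingEnd ℂ) (a₀ n)) : ∃ a θ, IsGalerkin R N a₀ a θ := by
  set S := window N with hS
  have hcd := contDiff_field R S
  have hcs := hasCompactSupport_field hR S
  obtain ⟨K, hK⟩ := hcd.lipschitzWith_of_hasCompactSupport hcs one_ne_zero
  obtain ⟨M, hM⟩ := hcs.exists_bound_of_continuous hcd.continuous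
  have hPL : IsPicardLindelof (fun _ => field R S) (tmin := -2) (tmax := 2)
      ⟨0, by norm_num, by norm_num⟩ (fun n : S => a₀ n) (M.toNNReal * 2) 0 M.toNNReal K := by
    refine IsPicardLindelof.of_time_independent
      (fun x _ => (hM x).trans (Real.le_coe_toNNReal M)) hK.lipschitzOnWith ?_
    simp
  obtain ⟨x, hx0, hx⟩ := hPL.exists_eq_forall_mem_Icc_hasDerivWithinAt₀
  have hx' : ∀ t ∈ Set.Ioo (-2 : ℝ) 2, HasDerivAt x (field R S (x t)) t := fun t ht =>
    (hx t (Set.Ioo_subset_Icc_self ht)).hasDerivAt (Icc_mem_nhds ht.1 ht.2)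
  have hneg : ∀ n ∈ S, -n ∈ S := fun n hn => neg_mem_window n hn
  set y : ℝ → S → ℂ := fun t k => (starRingEnd ℂ) (x t ⟨-k, hneg k k.2⟩) with hy
  have hy' : ∀ t ∈ Set.Ioo (-2 : ℝ) 2, HasDerivAt y (field R S (y t)) t := fun t ht => by
    refine hasDerivAt_pi.mpr fun n => ?_
    rw [field_reflect hneg]
    exact (hasDerivAt_pi.mp (hx' t ht) _).star
  have hxy : Set.EqOn x y (Set.Ioo (-2) 2) := by
    refine ODE_solution_unique_of_mem_Ioo (v := fun _ => field R S) (s := fun _ => Set.univ)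
      (K := K) (t₀ := 0) (fun _ _ => hK.lipschitzOnWith) (by norm_num)
      (fun t ht => ⟨hx' t ht, trivial⟩) (fun t ht => ⟨hy' t ht, trivial⟩) ?_
    ext n
    simp only [hy]
    have h1 : x 0 = fun n : S => a₀ n := hx0
    simp [h1, ha₀]
  refine ⟨fun t => extend S (x t),
    fun t => Real.smoothTransition (2 - en (wt 2 1) S (extend S (x t)) / R), ?_⟩
  refine ⟨fun n hn => ?_, fun t n hn => dif_neg hn, fun t ht n => ?_,
    fun t => Real.smoothTransition.nonneg _, fun t => Real.smoothTransition.le_one _,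
    fun t ht => ?_, fun t ht => ?_, fun t ht n hn => ?_⟩
  · have h1 : x 0 = fun n : S => a₀ n := hx0
    simp only [extend, ← hS] at hn ⊢
    rw [dif_pos hn, h1]
  · by_cases hn : n ∈ S
    · simp only [extend, hn, hneg n hn, dif_pos]
      have h2 := congrFun (hxy ht) ⟨-n, hneg n hn⟩
      simpa [hy] using h2
    · have hn' : -n ∉ S := fun h => hn (by simpa using hneg _ h)
      simp [extend, hn, hn']
  · refine Real.smoothTransition.one_of_one_le ?_
    have : en (wt 2 1) S (extend S (x t)) / R ≤ 1 := (div_le_one hR).mpr ht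
    linarith
  · refine Real.smoothTransition.zero_of_nonpos ?_
    rw [sub_nonpos, le_div_iff₀ hR]
    exact ht
  · have h := hasDerivAt_pi.mp (hx' t ht) ⟨n, hn⟩
    have e : (fun τ => extend S (x τ) n) = fun τ => x τ ⟨n, hn⟩ := funext fun τ => dif_pos hn
    simp only [e]
    simpa only [field, Complex.real_smul] using h

/-! ### Uniform bounds for the Galerkin approximations -/

lemma abs_le_jb (n : ℤ) : |(n : ℝ)| ≤ jb n := by
  refine le_trans ?_ (abs_xi_le_jb n)
  rw [xi, abs_mul, abs_of_pos Real.two_pi_pos]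
  exact le_mul_of_one_le_left (abs_nonneg _) (by linarith [Real.pi_gt_three])

lemma summable_jb_rpow {b : ℝ} (hb : 1 < b) : Summable fun n : ℤ => jb n ^ (-b) := by
  have h1 : Summable fun n : ℤ => if n = 0 then (1 : ℝ) else 0 :=
    summable_of_ne_finset_zero (s := {0}) fun n hn => by simpa using hn
  refine ((Real.summable_abs_int_rpow hb).add h1).of_nonneg_of_le
    (fun n => Real.rpow_nonneg (jb_pos n).le _) fun n => ?_
  split_ifs with h
  · have : jb n ^ (-b) ≤ 1 := Real.rpow_le_one_of_one_le_of_nonpos (one_le_jb n) (by linarith)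
    have := Real.rpow_nonneg (abs_nonneg (n : ℝ)) (-b)
    linarith
  · rw [add_zero]
    have hn : 0 < |(n : ℝ)| := by positivity
    exact Real.rpow_le_rpow_of_nonpos hn (abs_le_jb n) (by linarith)

/-- The constant of the embedding of `H²` into the space normed by `∑ ⟨·⟩ |a|`. -/
def sobConst : ℝ := ∑' n : ℤ, jb n ^ (-2 : ℝ)

lemma summable_sobConst : Summable fun n : ℤ => jb n ^ (-2 : ℝ) := summable_jb_rpow one_lt_two

lemma one_le_sobConst : 1 ≤ sobConst := by
  have h := summable_sobConst.le_tsum 0 fun n _ => Real.rpow_nonneg (jb_pos n).le _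
  have e : jb 0 = 1 := by simp [jb, symb]
  rwa [e, Real.one_rpow] at h

lemma sum_jb_sq_le (S : Finset ℤ) (a : ℤ → ℂ) :
    (∑ n ∈ S, jb n * ‖a n‖) ^ 2 ≤ sobConst * en (wt 2 1) S a := by
  have h := Finset.sum_mul_sq_le_sq_mul_sq S (fun n => (jb n)⁻¹)
    (fun n => wt 2 1 (jb n) * ‖a n‖)
  have e : ∀ n, (jb n)⁻¹ * (wt 2 1 (jb n) * ‖a n‖) = jb n * ‖a n‖ := fun n => by
    have := (jb_pos n).ne'
    rw [wt_two_one]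
    field_simp
  simp only [e] at h
  refine h.trans (mul_le_mul_of_nonneg_right ?_ (en_nonneg _ _ _))
  have e2 : ∀ n, (jb n)⁻¹ ^ 2 = jb n ^ (-2 : ℝ) := fun n => by
    rw [Real.rpow_neg (jb_pos n).le, Real.rpow_ofNat, inv_pow]
  simp only [e2]
  exact summable_sobConst.sum_le_tsum _ fun n _ => Real.rpow_nonneg (jb_pos n).le _

/-- Grönwall's inequality, forwards and backwards in time. -/
lemma gronwall_two_sided {f f' : ℝ → ℝ} {a b D : ℝ} (h0 : (0 : ℝ) ∈ Set.Icc a b)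
    (hf : ∀ t ∈ Set.Icc a b, HasDerivWithinAt f (f' t) (Set.Icc a b) t)
    (hD : ∀ t ∈ Set.Icc a b, |f' t| ≤ D * f t) :
    ∀ t ∈ Set.Icc a b, f t ≤ f 0 * Real.exp (D * |t|) := by
  intro t ht
  have hint : interior (Set.Icc a b) ⊆ Set.Icc a b := interior_subset
  have hexp : ∀ c t : ℝ, HasDerivAt (fun t => Real.exp (c * t)) (Real.exp (c * t) * c) t :=
    fun c t => by simpa using ((hasDerivAt_id t).const_mul c).exp
  have hd : ∀ c : ℝ, ∀ t ∈ Set.Icc a b, HasDerivWithinAt (fun t => f t * Real.exp (c * t))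
      (f' t * Real.exp (c * t) + f t * (Real.exp (c * t) * c)) (Set.Icc a b) t :=
    fun c t ht => (hf t ht).mul (hexp c t).hasDerivWithinAt
  have key : ∀ c t : ℝ, f t * Real.exp (c * t) ≤ f 0 →
      f t ≤ f 0 * Real.exp (-c * t) := fun c t h => by
    have h2 := mul_le_mul_of_nonneg_right h (Real.exp_pos (-c * t)).le
    rwa [mul_assoc, ← Real.exp_add, show c * t + -c * t = 0 by ring, Real.exp_zero, mul_one] at h2
  rcases le_total 0 t with h | h
  · have hanti : AntitoneOn (fun t => f t * Real.exp (-D * t)) (Set.Icc a b) :=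
      antitoneOn_of_hasDerivWithinAt_nonpos (convex_Icc a b)
        (fun t ht => (hd _ t ht).continuousWithinAt)
        (fun t ht => (hd _ t (hint ht)).mono hint) fun t ht => by
          have h1 := (abs_le.mp (hD t (hint ht))).2
          have h2 := Real.exp_pos (-D * t)
          nlinarith
    have h1 := hanti h0 ht h
    simp only [mul_zero, Real.exp_zero, mul_one] at h1
    have := key _ _ h1
    rw [abs_of_nonneg h]
    rwa [neg_neg] at this
  · have hmono : MonotoneOn (fun t => f t * Real.exp (D * t)) (Set.Icc a b) :=
      monotoneOn_of_hasDerivWithinAt_nonneg (convex_Icc a b)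
        (fun t ht => (hd _ t ht).continuousWithinAt)
        (fun t ht => (hd _ t (hint ht)).mono hint) fun t ht => by
          have h1 := (abs_le.mp (hD t (hint ht))).1
          have h2 := Real.exp_pos (D * t)
          nlinarith
    have h1 := hmono ht h0 h
    simp only [mul_zero, Real.exp_zero, mul_one] at h1
    have := key _ _ h1
    rwa [abs_of_nonpos h, mul_neg, ← neg_mul]

/-- The growth rate, per unit of `H²` energy, of the energy with a weight of constant `C`. -/
def rate (C : ℝ) : ℝ := 104 * C ^ 2 * sobConst

lemma hasDerivAt_norm_sq {f : ℝ → ℂ} {f' : ℂ} {t : ℝ} (h : HasDerivAt f f' t) :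
    HasDerivAt (fun t => ‖f t‖ ^ 2) (2 * ((starRingEnd ℂ) (f t) * f').re) t := by
  have h1 := h.norm_sq
  simpa [Complex.inner, mul_comm] using h1

/-- Weighted energies of the Galerkin approximations grow at a rate independent of `N`, since the
cut-off factor times the `H²` energy is at most `2R`. -/
lemma IsGalerkin.en_le {R : ℝ} (hR : 0 < R) {N : ℕ} {a₀ : ℤ → ℂ} {a : ℝ → ℤ → ℂ} {θ : ℝ → ℝ}
    (h : IsGalerkin R N a₀ a θ) {C : ℝ} {p : ℝ → ℝ} (hp : IsWeight C p)
    {t : ℝ} (ht : t ∈ Set.Icc (-1 : ℝ) 1) :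
    en p (window N) (a t) ≤ en p (window N) a₀ * Real.exp (rate C * R * |t|) := by
  set S := window N with hS
  have hI : ∀ t ∈ Set.Icc (-1 : ℝ) 1, t ∈ Set.Ioo (-2 : ℝ) 2 := fun t ht =>
    ⟨by linarith [ht.1], by linarith [ht.2]⟩
  have hd : ∀ t ∈ Set.Icc (-1 : ℝ) 1, HasDerivAt (fun t => en p S (a t))
      (2 * θ t * ∑ n ∈ S, p (jb n) ^ 2 * ((starRingEnd ℂ) (a t n) * nl (a t) n).re) t := by
    intro t ht
    have h1 : HasDerivAt (fun t => ∑ n ∈ S, p (jb n) ^ 2 * ‖a t n‖ ^ 2)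
        (∑ n ∈ S, p (jb n) ^ 2 * (2 * ((starRingEnd ℂ) (a t n) * (θ t * nl (a t) n)).re)) t :=
      HasDerivAt.fun_sum fun n hn =>
        (hasDerivAt_norm_sq (h.eqn t (hI t ht) n hn)).const_mul _
    simp only [en, mul_pow]
    refine h1.congr_deriv ?_
    rw [Finset.mul_sum]
    refine Finset.sum_congr rfl fun n _ => ?_
    rw [mul_left_comm ((starRingEnd ℂ) (a t n)), Complex.re_ofReal_mul]
    ring
  have hb : ∀ t ∈ Set.Icc (-1 : ℝ) 1,
      |2 * θ t * ∑ n ∈ S, p (jb n) ^ 2 * ((starRingEnd ℂ) (a t n) * nl (a t) n).re|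
        ≤ rate C * R * en p S (a t) := by
    intro t ht
    have h1 := abs_energy_le hp S (h.supp t) (h.symm t (hI t ht))
    have h2 := sum_jb_sq_le S (a t)
    have h3 : θ t * en (wt 2 1) S (a t) ≤ 2 * R := by
      rcases le_total (2 * R) (en (wt 2 1) S (a t)) with h4 | h4
      · rw [h.eq_zero t h4, zero_mul]
        positivity
      · exact (mul_le_of_le_one_left (en_nonneg _ _ _) (h.le_one t)).trans h4
    have h5 := en_nonneg p S (a t)
    have h6 := h.nonneg t
    have h7 := zero_le_one.trans one_le_sobConst
    rw [abs_mul, abs_of_nonneg (by positivity : 0 ≤ 2 * θ t)]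
    calc _ ≤ 2 * θ t * (26 * C ^ 2 * (sobConst * en (wt 2 1) S (a t) * en p S (a t))) := by
          refine mul_le_mul_of_nonneg_left (h1.trans ?_) (by positivity)
          exact mul_le_mul_of_nonneg_left (mul_le_mul_of_nonneg_right h2 h5) (by positivity)
      _ = 52 * C ^ 2 * sobConst * (θ t * en (wt 2 1) S (a t)) * en p S (a t) := by ring
      _ ≤ 52 * C ^ 2 * sobConst * (2 * R) * en p S (a t) := by gcongr
      _ = _ := by rw [rate]; ring
  have h0 := gronwall_two_sided (f := fun t => en p S (a t)) (by norm_num)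
    (fun t ht => (hd t ht).hasDerivWithinAt) hb t ht
  have e0 : en p S (a 0) = en p S a₀ :=
    Finset.sum_congr rfl fun n hn => by rw [h.init n hn]
  simpa only [e0] using h0

/-- A lower bound for the time of existence, in terms of a bound `R/2` of the `H²` energy:
until then the `H²` energy at most doubles. -/
def lifespan (R : ℝ) : ℝ := min 1 (Real.log 2 / (rate (max (3 ^ ((2 : ℝ) + 1)) (2 * 2 + 1)) * R))

lemma rate_pos {C : ℝ} (hC : 0 < C) : 0 < rate C := by
  have := one_le_sobConst
  unfold rate
  positivity

lemma lifespan_pos {R : ℝ} (hR : 0 < R) : 0 < lifespan R := by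
  have h := rate_pos (C := max (3 ^ ((2 : ℝ) + 1)) (2 * 2 + 1)) (by positivity)
  have := Real.log_pos one_lt_two
  unfold lifespan
  positivity

lemma IsGalerkin.uncut {R : ℝ} (hR : 0 < R) {N : ℕ} {a₀ : ℤ → ℂ} {a : ℝ → ℤ → ℂ} {θ : ℝ → ℝ}
    (h : IsGalerkin R N a₀ a θ) (h0 : en (wt 2 1) (window N) a₀ ≤ R / 2)
    {t : ℝ} (ht : |t| ≤ lifespan R) : θ t = 1 := by
  have h1 : |t| ≤ 1 := ht.trans (min_le_left _ _)
  have h2 := h.en_le hR (isWeight_wt (s := 2) (L := 1) one_le_two le_rfl) (abs_le.mp h1)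
  set D := rate (max (3 ^ ((2 : ℝ) + 1)) (2 * 2 + 1)) with hD
  have hD0 : 0 < D := rate_pos (by positivity)
  have h3 : D * R * |t| ≤ Real.log 2 := by
    have := ht.trans (min_le_right _ _)
    rw [le_div_iff₀ (by positivity)] at this
    linarith
  have h4 : Real.exp (D * R * |t|) ≤ 2 := by
    rw [← Real.exp_log (two_pos (α := ℝ))]
    exact Real.exp_le_exp.mpr h3
  refine h.eq_one t (h2.trans ?_)
  calc _ ≤ R / 2 * 2 := mul_le_mul h0 h4 (Real.exp_pos _).le (by positivity)
    _ = R := by ring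

/-! ### Continuity of the nonlinearity -/

section Nonlinearity

variable {a b : ℤ → ℂ} {m d : ℤ → ℝ}

lemma hasSum_jb_triple {m₁ m₂ m₃ : ℤ → ℝ} (h₁ : Summable fun n => jb n * m₁ n)
    (h₂ : Summable fun n => jb n * m₂ n) (h₃ : Summable fun n => jb n * m₃ n)
    (p₁ : ∀ n, 0 ≤ m₁ n) (p₂ : ∀ n, 0 ≤ m₂ n) (p₃ : ∀ n, 0 ≤ m₃ n) :
    HasSum (fun t : ℤ × ℤ × ℤ => jb t.1 * m₁ t.1 * (jb t.2.1 * m₂ t.2.1 * (jb t.2.2 * m₃ t.2.2)))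
      ((∑' n, jb n * m₁ n) * ((∑' n, jb n * m₂ n) * ∑' n, jb n * m₃ n)) := by
  have q₁ := fun n => mul_nonneg (jb_pos n).le (p₁ n)
  have q₂ := fun n => mul_nonneg (jb_pos n).le (p₂ n)
  have q₃ := fun n => mul_nonneg (jb_pos n).le (p₃ n)
  have h23 := h₂.hasSum.mul h₃.hasSum (h₂.mul_of_nonneg h₃ q₂ q₃)
  exact h₁.hasSum.mul h23 (h₁.mul_of_nonneg h23.summable q₁ fun t => mul_nonneg (q₂ _) (q₃ _))

lemma norm_nl_term_le (hm : ∀ k, ‖a k‖ ≤ m k) (n : ℤ) (t : ℤ × ℤ × ℤ) :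
    ‖if t.1 + t.2.1 + t.2.2 = n then
      -Complex.I * lam t.1 t.2.1 t.2.2 * (a t.1 * a t.2.1 * a t.2.2) else 0‖
    ≤ 4 * (jb t.1 * m t.1 * (jb t.2.1 * m t.2.1 * (jb t.2.2 * m t.2.2))) := by
  have m0 : ∀ k, 0 ≤ m k := fun k => (norm_nonneg _).trans (hm k)
  have := jb_pos t.1
  have := jb_pos t.2.1
  have := jb_pos t.2.2
  have := m0 t.1
  have := m0 t.2.1
  have := m0 t.2.2
  split_ifs
  · simp only [norm_mul, norm_neg, Complex.norm_I, one_mul, Complex.norm_real, Real.norm_eq_abs]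
    calc _ ≤ 4 * (jb t.1 * jb t.2.1 * jb t.2.2) * (m t.1 * m t.2.1 * m t.2.2) := by
          gcongr
          · exact abs_lam_le _ _ _
          · exact hm _
          · exact hm _
          · exact hm _
      _ = _ := by ring
  · rw [norm_zero]; positivity

lemma summable_nl (hm : ∀ k, ‖a k‖ ≤ m k) (hs : Summable fun k => jb k * m k) (n : ℤ) :
    Summable fun t : ℤ × ℤ × ℤ => if t.1 + t.2.1 + t.2.2 = n then
      -Complex.I * lam t.1 t.2.1 t.2.2 * (a t.1 * a t.2.1 * a t.2.2) else 0 := by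
  have m0 : ∀ k, 0 ≤ m k := fun k => (norm_nonneg _).trans (hm k)
  exact (((hasSum_jb_triple hs hs hs m0 m0 m0).summable.mul_left 4).of_nonneg_of_le
    (fun _ => norm_nonneg _) (norm_nl_term_le hm n)).of_norm

/-- The coefficients of the nonlinearity are continuous under dominated pointwise convergence. -/
lemma tendsto_nl {X : Type*} {l : Filter X} {A : X → ℤ → ℂ} (hm : ∀ᶠ x in l, ∀ k, ‖A x k‖ ≤ m k)
    (m0 : ∀ k, 0 ≤ m k) (hs : Summable fun k => jb k * m k)
    (hA : ∀ k, Tendsto (fun x => A x k) l (𝓝 (a k))) (n : ℤ) :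
    Tendsto (fun x => nl (A x) n) l (𝓝 (nl a n)) := by
  refine tendsto_tsum_of_dominated_convergence
    ((hasSum_jb_triple hs hs hs m0 m0 m0).summable.mul_left 4) (fun t => ?_)
    (hm.mono fun x hx => norm_nl_term_le hx n)
  split_ifs
  · exact (((hA _).mul (hA _)).mul (hA _)).const_mul _
  · exact tendsto_const_nhds

/-- The nonlinearity, being cubic, is Lipschitz on the set of sequences dominated by `m`. -/
lemma norm_nl_sub_le (ha : ∀ k, ‖a k‖ ≤ m k) (hb : ∀ k, ‖b k‖ ≤ m k)
    (hd : ∀ k, ‖a k - b k‖ ≤ d k) (hs : Summable fun k => jb k * m k)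
    (hds : Summable fun k => jb k * d k) (n : ℤ) :
    ‖nl a n - nl b n‖ ≤ 12 * (∑' k, jb k * m k) ^ 2 * ∑' k, jb k * d k := by
  have m0 : ∀ k, 0 ≤ m k := fun k => (norm_nonneg _).trans (ha k)
  have d0 : ∀ k, 0 ≤ d k := fun k => (norm_nonneg _).trans (hd k)
  have H := (((hasSum_jb_triple hds hs hs d0 m0 m0).add (hasSum_jb_triple hs hds hs m0 d0 m0)).add
    (hasSum_jb_triple hs hs hds m0 m0 d0)).mul_left 4
  rw [nl, nl, ← (summable_nl ha hs n).tsum_sub (summable_nl hb hs n)]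
  refine (tsum_of_norm_bounded H fun t => ?_).trans (le_of_eq (by ring))
  have := jb_pos t.1
  have := jb_pos t.2.1
  have := jb_pos t.2.2
  have := m0 t.1
  have := m0 t.2.1
  have := m0 t.2.2
  have := d0 t.1
  have := d0 t.2.1
  have := d0 t.2.2
  split_ifs
  · rw [← mul_sub, norm_mul, norm_mul, norm_neg, Complex.norm_I, one_mul, Complex.norm_real,
      Real.norm_eq_abs]
    have e : a t.1 * a t.2.1 * a t.2.2 - b t.1 * b t.2.1 * b t.2.2
        = (a t.1 - b t.1) * a t.2.1 * a t.2.2 + b t.1 * (a t.2.1 - b t.2.1) * a t.2.2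
          + b t.1 * b t.2.1 * (a t.2.2 - b t.2.2) := by ring
    have h3 : ‖a t.1 * a t.2.1 * a t.2.2 - b t.1 * b t.2.1 * b t.2.2‖
        ≤ d t.1 * m t.2.1 * m t.2.2 + m t.1 * d t.2.1 * m t.2.2 + m t.1 * m t.2.1 * d t.2.2 := by
      rw [e]
      refine (norm_add₃_le).trans ?_
      simp only [norm_mul]
      gcongr <;> first | exact ha _ | exact hb _ | exact hd _
    calc _ ≤ 4 * (jb t.1 * jb t.2.1 * jb t.2.2) *
          (d t.1 * m t.2.1 * m t.2.2 + m t.1 * d t.2.1 * m t.2.2 + m t.1 * m t.2.1 * d t.2.2) := by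
          gcongr
          exact abs_lam_le _ _ _
      _ = _ := by ring
  · rw [sub_zero, norm_zero]
    positivity

lemma nl_zero (n : ℤ) : nl 0 n = 0 := by simp [nl]

lemma norm_nl_le (ha : ∀ k, ‖a k‖ ≤ m k) (hs : Summable fun k => jb k * m k) (n : ℤ) :
    ‖nl a n‖ ≤ 12 * (∑' k, jb k * m k) ^ 3 := by
  have h := norm_nl_sub_le (b := 0) ha (fun k => by simpa using (norm_nonneg _).trans (ha k))
    (fun k => by simpa using ha k) hs hs n
  rw [nl_zero, sub_zero] at h
  exact h.trans (le_of_eq (by ring))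

end Nonlinearity

/-! ### Passage to the limit -/

lemma wt_one (s : ℝ) (n : ℤ) : wt s 1 (jb n) = jb n ^ s := by
  rw [wt, div_one, min_eq_left (one_le_jb n), Real.sqrt_one, mul_one]

lemma wt_nonneg (s L : ℝ) (n : ℤ) : 0 ≤ wt s L (jb n) := by
  have := jb_pos n
  unfold wt
  positivity

lemma wt_le_wt_one {s L : ℝ} (hL : 1 ≤ L) (n : ℤ) : wt s L (jb n) ≤ wt s 1 (jb n) := by
  have h0 := jb_pos n
  unfold wt
  rw [div_one]
  have : jb n / L ≤ jb n := div_le_self h0.le hL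
  gcongr

lemma summable_wt {s L : ℝ} (hL : 1 ≤ L) {a : ℤ → ℂ}
    (h : Summable fun n => (wt s 1 (jb n) * ‖a n‖) ^ 2) :
    Summable fun n => (wt s L (jb n) * ‖a n‖) ^ 2 :=
  h.of_nonneg_of_le (fun _ => sq_nonneg _) fun n => by
    have h1 := wt_le_wt_one (s := s) hL n
    have h2 := wt_nonneg s L n
    gcongr

lemma norm_le_of_en_le {s M : ℝ} {a : ℤ → ℂ} (h : ∀ S, en (wt s 1) S a ≤ M) (n : ℤ) :
    ‖a n‖ ≤ √M * jb n ^ (-s) := by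
  have h1 := h {n}
  rw [en, Finset.sum_singleton, wt_one] at h1
  have h2 := Real.le_sqrt_of_sq_le h1
  have h3 : 0 < jb n ^ s := Real.rpow_pos_of_pos (jb_pos n) _
  rw [Real.rpow_neg (jb_pos n).le, ← div_eq_mul_inv, le_div_iff₀ h3]
  linarith

lemma jb_mul_rpow_neg (s M : ℝ) (n : ℤ) :
    jb n * (M * jb n ^ (-s)) = M * jb n ^ (-(s - 1)) := by
  rw [show -(s - 1) = -s + 1 by ring, Real.rpow_add_one (jb_pos n).ne']
  ring

lemma summable_jb_mul_rpow {s : ℝ} (hs : 2 < s) (M : ℝ) :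
    Summable fun n : ℤ => jb n * (M * jb n ^ (-s)) := by
  simp only [jb_mul_rpow_neg]
  exact (summable_jb_rpow (by linarith)).mul_left M

/-- Equicontinuity of the nonlinearity along equi-Lipschitz dominated families. -/
lemma exists_modulus {m : ℤ → ℝ} (m0 : ∀ k, 0 ≤ m k) (hm : Summable fun k => jb k * m k)
    {V : ℝ} {ε : ℝ} (hε : 0 < ε) :
    ∃ δ > 0, ∀ a b : ℤ → ℂ, (∀ k, ‖a k‖ ≤ m k) → (∀ k, ‖b k‖ ≤ m k) →
      (∀ k, ‖a k - b k‖ ≤ V * δ) → ∀ n, ‖nl a n - nl b n‖ ≤ ε := by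
  have h1 : Tendsto (fun δ : ℝ => 12 * (∑' k, jb k * m k) ^ 2 *
      ∑' k, jb k * min |V * δ| (2 * m k)) (𝓝 0)
      (𝓝 (12 * (∑' k, jb k * m k) ^ 2 * ∑' k : ℤ, (0 : ℝ))) := by
    refine Tendsto.const_mul _ (tendsto_tsum_of_dominated_convergence (hm.mul_left 2)
      (fun k => ?_) (Eventually.of_forall fun δ k => ?_))
    · have : Continuous fun δ : ℝ => jb k * min |V * δ| (2 * m k) := by fun_prop
      have h := this.tendsto 0
      simpa [m0 k] using h
    · have h2 : 0 ≤ min |V * δ| (2 * m k) := le_min (abs_nonneg _) (by linarith [m0 k])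
      rw [Real.norm_of_nonneg (mul_nonneg (jb_pos k).le h2)]
      calc _ ≤ jb k * (2 * m k) := mul_le_mul_of_nonneg_left (min_le_right _ _) (jb_pos k).le
        _ = _ := by ring
  rw [tsum_zero, mul_zero] at h1
  have h2 := (h1.mono_left (nhdsWithin_le_nhds (s := Set.Ioi 0))).eventually (gt_mem_nhds hε)
  have h3 : ∀ᶠ δ : ℝ in 𝓝[>] 0, 0 < δ := self_mem_nhdsWithin
  obtain ⟨δ, hδ, hδ0⟩ := (h2.and h3).exists
  refine ⟨δ, hδ0, fun a b ha hb hab n => (norm_nl_sub_le ha hb (fun k => ?_) hm ?_ n).trans hδ.le⟩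
  · refine le_min ((hab k).trans (le_abs_self _)) ?_
    linarith [norm_sub_le (a k) (b k), ha k, hb k]
  · refine (hm.mul_left 2).of_nonneg_of_le (fun k => ?_) fun k => ?_
    · have h2 : 0 ≤ min |V * δ| (2 * m k) := le_min (abs_nonneg _) (by linarith [m0 k])
      exact mul_nonneg (jb_pos k).le h2
    · calc _ ≤ jb k * (2 * m k) := mul_le_mul_of_nonneg_left (min_le_right _ _) (jb_pos k).le
        _ = _ := by ring

/-- Local solvability on the Fourier side. Besides the equation, the limit inherits the energy
bounds of the Galerkin approximations for all the weights `wt s L`, with one constant. -/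
theorem exists_local_coeff {s R : ℝ} (hs : 5 / 2 < s) (hR : 0 < R) {a₀ : ℤ → ℂ}
    (ha₀ : ∀ n, a₀ (-n) = (starRingEnd ℂ) (a₀ n))
    (hsum : Summable fun n => (wt s 1 (jb n) * ‖a₀ n‖) ^ 2)
    (hen : ∀ S, en (wt 2 1) S a₀ ≤ R / 2) :
    ∃ (a : ℝ → ℤ → ℂ) (D : ℝ), (∀ n, a 0 n = a₀ n) ∧
      (∀ t ∈ Set.Icc (-lifespan R) (lifespan R), ∀ n, a t (-n) = (starRingEnd ℂ) (a t n)) ∧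
      (∀ L, 1 ≤ L → ∀ t ∈ Set.Icc (-lifespan R) (lifespan R), ∀ S,
        en (wt s L) S (a t) ≤ D * ∑' n, (wt s L (jb n) * ‖a₀ n‖) ^ 2) ∧
      (∀ t ∈ Set.Icc (-lifespan R) (lifespan R), ∀ n, HasDerivWithinAt (fun τ => a τ n)
        (nl (a t) n) (Set.Icc (-lifespan R) (lifespan R)) t) := by
  set I := Set.Icc (-lifespan R) (lifespan R) with hI
  have hl0 := lifespan_pos hR
  have hl1 : lifespan R ≤ 1 := min_le_left _ _
  have hI1 : ∀ t ∈ I, t ∈ Set.Icc (-1 : ℝ) 1 := fun t ht =>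
    ⟨by linarith [ht.1], by linarith [ht.2]⟩
  have hI2 : ∀ t ∈ I, t ∈ Set.Ioo (-2 : ℝ) 2 := fun t ht =>
    ⟨by linarith [ht.1], by linarith [ht.2]⟩
  have h0I : (0 : ℝ) ∈ I := ⟨by linarith, by linarith⟩
  choose A θ hA using fun N => exists_isGalerkin hR N ha₀
  have hθ : ∀ N, ∀ t ∈ I, θ N t = 1 := fun N t ht => (hA N).uncut hR (hen _) (abs_le.mpr ht)
  set C := max ((3 : ℝ) ^ (s + 1)) (2 * s + 1) with hC
  have hC0 : 0 < C := by positivity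
  set D := Real.exp (rate C * R) with hD
  have hAen : ∀ N L, 1 ≤ L → ∀ t ∈ I, ∀ S, en (wt s L) S (A N t)
      ≤ D * ∑' n, (wt s L (jb n) * ‖a₀ n‖) ^ 2 := by
    intro N L hL t ht S
    have h1 := (hA N).en_le hR (isWeight_wt (by linarith : (1 : ℝ) ≤ s) hL) (hI1 t ht)
    have h2 : en (wt s L) S (A N t) ≤ en (wt s L) (window N) (A N t) := by
      rw [en, ← Finset.sum_filter_add_sum_filter_not S (fun n => n ∈ window N)]
      have e : ∑ n ∈ S with n ∉ window N, (wt s L (jb n) * ‖A N t n‖) ^ 2 = 0 :=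
        Finset.sum_eq_zero fun n hn => by
          rw [(hA N).supp t n (Finset.mem_filter.mp hn).2]; simp
      rw [e, add_zero]
      exact Finset.sum_le_sum_of_subset_of_nonneg
        (fun n hn => (Finset.mem_filter.mp hn).2) fun _ _ _ => sq_nonneg _
    have h3 : en (wt s L) (window N) a₀ ≤ ∑' n, (wt s L (jb n) * ‖a₀ n‖) ^ 2 :=
      (summable_wt hL hsum).sum_le_tsum _ fun _ _ => sq_nonneg _
    have h4 : Real.exp (rate C * R * |t|) ≤ D := by
      refine Real.exp_le_exp.mpr (mul_le_of_le_one_right ?_ (abs_le.mpr (hI1 t ht)))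
      exact mul_nonneg (rate_pos hC0).le hR.le
    calc _ ≤ en (wt s L) (window N) a₀ * Real.exp (rate C * R * |t|) := h2.trans h1
      _ ≤ (∑' n, (wt s L (jb n) * ‖a₀ n‖) ^ 2) * D :=
          mul_le_mul h3 h4 (Real.exp_pos _).le (tsum_nonneg fun _ => sq_nonneg _)
      _ = _ := mul_comm _ _
  set M := √(D * ∑' n, (wt s 1 (jb n) * ‖a₀ n‖) ^ 2) with hM
  set m : ℤ → ℝ := fun n => M * jb n ^ (-s) with hm
  have hAm : ∀ N, ∀ t ∈ I, ∀ n, ‖A N t n‖ ≤ m n := fun N t ht n =>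
    norm_le_of_en_le (hAen N 1 le_rfl t ht) n
  have m0 : ∀ n, 0 ≤ m n := fun n =>
    mul_nonneg (Real.sqrt_nonneg _) (Real.rpow_nonneg (jb_pos n).le _)
  have hms : Summable fun n => jb n * m n := summable_jb_mul_rpow (by linarith) M
  -- the limit is taken along an ultrafilter, at each time and frequency separately
  have hlim : ∀ t n, ∃ z, t ∈ I → Tendsto (fun N => A N t n) (hyperfilter ℕ : Filter ℕ) (𝓝 z) := by
    intro t n
    by_cases ht : t ∈ I
    · have hc := isCompact_closedBall (0 : ℂ) (m n)
      obtain ⟨z, -, hz⟩ := hc.ultrafilter_le_nhds ((hyperfilter ℕ).map fun N : ℕ => A N t n) (by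
        rw [le_principal_iff]
        exact Filter.mem_map.mpr
          (univ_mem' fun N : ℕ => mem_closedBall_zero_iff.mpr (hAm N t ht n)))
      exact ⟨z, fun _ => hz⟩
    · exact ⟨0, fun h => absurd h ht⟩
  choose a ha using hlim
  have hwin : ∀ n : ℤ, ∀ᶠ N : ℕ in (hyperfilter ℕ : Filter ℕ), n ∈ window N := fun n => by
    have h : ∀ᶠ N : ℕ in atTop, n ∈ window N :=
      (eventually_ge_atTop n.natAbs).mono fun N hN => by
        simp only [window, Finset.mem_Icc]
        omega
    exact Nat.hyperfilter_le_atTop h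
  have hAd : ∀ N, ∀ n ∈ window N, ∀ t ∈ I, HasDerivWithinAt (fun τ => A N τ n)
      (nl (A N t) n) I t := fun N n hn t ht => by
    have h := ((hA N).eqn t (hI2 t ht) n hn).hasDerivWithinAt (s := I)
    rwa [hθ N t ht, Complex.ofReal_one, one_mul] at h
  set V := 12 * (∑' k, jb k * m k) ^ 3 with hV
  have hV0 : 0 ≤ V :=
    mul_nonneg (by norm_num) (pow_nonneg (tsum_nonneg fun k => mul_nonneg (jb_pos k).le (m0 k)) 3)
  have hAlip : ∀ N, ∀ n, ∀ t ∈ I, ∀ r ∈ I, ‖A N r n - A N t n‖ ≤ V * |r - t| := by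
    intro N n t ht r hr
    by_cases hn : n ∈ window N
    · exact (convex_Icc _ _).norm_image_sub_le_of_norm_hasDerivWithin_le (hAd N n hn)
        (fun x hx => norm_nl_le (hAm N x hx) hms n) ht hr
    · rw [(hA N).supp t n hn, (hA N).supp r n hn, sub_zero, norm_zero]
      positivity
  refine ⟨a, D, fun n => ?_, fun t ht n => ?_, fun L hL t ht S => ?_, fun t ht n => ?_⟩
  · refine tendsto_nhds_unique (ha 0 n h0I) (tendsto_const_nhds.congr' ?_)
    exact (hwin n).mono fun N hN => ((hA N).init n hN).symm
  · refine tendsto_nhds_unique (ha t (-n) ht) ?_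
    have h := (Complex.continuous_conj.tendsto _).comp (ha t n ht)
    exact h.congr fun N => ((hA N).symm t (hI2 t ht) n).symm
  · have h : Tendsto (fun N => en (wt s L) S (A N t)) (hyperfilter ℕ : Filter ℕ)
        (𝓝 (en (wt s L) S (a t))) :=
      tendsto_finsetSum S fun n _ => (((ha t n ht).norm.const_mul _).pow 2)
    exact le_of_tendsto h (Eventually.of_forall fun N => hAen N L hL t ht S)
  · have hnl : Tendsto (fun N => nl (A N t) n) (hyperfilter ℕ : Filter ℕ) (𝓝 (nl (a t) n)) :=
      tendsto_nl (Eventually.of_forall fun N => hAm N t ht) m0 hms (fun k => ha t k ht) n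
    rw [hasDerivWithinAt_iff_isLittleO, Asymptotics.isLittleO_iff]
    intro ε hε
    obtain ⟨δ, hδ, hmod⟩ := exists_modulus (V := V) m0 hms hε
    have hnear1 : ∀ᶠ r in 𝓝[I] t, r ∈ I := self_mem_nhdsWithin
    have hnear2 : ∀ᶠ r in 𝓝[I] t, |r - t| < δ :=
      nhdsWithin_le_nhds (Metric.ball_mem_nhds t hδ)
    have hnear := hnear1.and hnear2
    refine hnear.mono fun r hr => ?_
    have hlimr : Tendsto (fun N => ‖A N r n - A N t n - (r - t) • nl (A N t) n‖)
        (hyperfilter ℕ : Filter ℕ) (𝓝 ‖a r n - a t n - (r - t) • nl (a t) n‖) :=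
      (((ha r n hr.1).sub (ha t n ht)).sub (hnl.const_smul _)).norm
    refine le_of_tendsto hlimr ((hwin n).mono fun N hn => ?_)
    have hsub : Set.uIcc t r ⊆ I := Set.OrdConnected.uIcc_subset Set.ordConnected_Icc ht hr.1
    have hder : ∀ x ∈ Set.uIcc t r, HasDerivWithinAt (fun τ => A N τ n - τ • nl (A N t) n)
        (nl (A N x) n - nl (A N t) n) (Set.uIcc t r) x := fun x hx => by
      have h := (hAd N n hn x (hsub hx)).mono hsub
      have h2 := (hasDerivWithinAt_id x (Set.uIcc t r)).smul_const (nl (A N t) n)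
      rw [one_smul] at h2
      exact h.sub h2
    have h := (convex_uIcc t r).norm_image_sub_le_of_norm_hasDerivWithin_le hder
      (fun x hx => hmod (A N x) (A N t) (hAm N x (hsub hx)) (hAm N t ht) (fun k => ?_) n)
      Set.left_mem_uIcc Set.right_mem_uIcc
    · refine le_of_eq_of_le ?_ h
      congr 1
      rw [sub_smul]
      ring
    · refine (hAlip N k t ht x (hsub hx)).trans ?_
      have hx2 := Set.abs_sub_left_of_mem_uIcc hx
      gcongr
      linarith [hr.2]

/-! ### Sobolev functions and their Fourier coefficients -/

lemma symb_rpow_mul_sq (s : ℝ) (n : ℤ) (r : ℝ) :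
    symb n ^ s * r ^ 2 = (wt s 1 (jb n) * r) ^ 2 := by
  rw [wt_one, mul_pow, ← jb_sq, ← Real.rpow_natCast, ← Real.rpow_natCast (jb n ^ s),
    ← Real.rpow_mul (jb_pos n).le, ← Real.rpow_mul (jb_pos n).le, mul_comm s]

lemma hsENorm_le_iff {s ε : ℝ} (hε : 0 ≤ ε) (f : UnitAddCircle → ℝ) :
    hsENorm s f ≤ ENNReal.ofReal ε ^ (1 / 2 : ℝ) ↔ ∀ S, en (wt s 1) S (coeff f) ≤ ε := by
  rw [hsENorm, ENNReal.rpow_le_rpow_iff (by norm_num), ENNReal.tsum_eq_iSup_sum, iSup_le_iff]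
  refine forall_congr' fun S => ?_
  simp only [symb_rpow_mul_sq]
  rw [← ENNReal.ofReal_sum_of_nonneg fun _ _ => sq_nonneg _, ENNReal.ofReal_le_ofReal_iff hε, en]

lemma tendsto_hsENorm_zero_iff {X : Type*} {l : Filter X} {s : ℝ}
    {F : X → UnitAddCircle → ℝ} :
    Tendsto (fun x => hsENorm s (F x)) l (𝓝 0) ↔
      ∀ ε > 0, ∀ᶠ x in l, ∀ S, en (wt s 1) S (coeff (F x)) ≤ ε := by
  rw [ENNReal.tendsto_nhds_zero]
  constructor
  · intro h ε hε
    refine (h (ENNReal.ofReal ε ^ (1 / 2 : ℝ)) ?_).mono fun x hx => (hsENorm_le_iff hε.le _).mp hx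
    exact ENNReal.rpow_pos (ENNReal.ofReal_pos.mpr hε) ENNReal.ofReal_ne_top
  · intro h ε hε
    rcases eq_or_ne ε ⊤ with rfl | htop
    · exact Eventually.of_forall fun _ => le_top
    · have h1 : 0 < ε.toReal := ENNReal.toReal_pos hε.ne' htop
      refine (h (ε.toReal ^ 2) (by positivity)).mono fun x hx => ?_
      refine ((hsENorm_le_iff (by positivity) _).mpr hx).trans (le_of_eq ?_)
      rw [ENNReal.ofReal_rpow_of_nonneg (by positivity) (by norm_num), ← Real.sqrt_eq_rpow,
        Real.sqrt_sq h1.le, ENNReal.ofReal_toReal htop]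

lemma hsENorm_lt_top_iff {s : ℝ} {f : UnitAddCircle → ℝ} :
    hsENorm s f < ∞ ↔ Summable fun n => (wt s 1 (jb n) * ‖coeff f n‖) ^ 2 := by
  rw [hsENorm, ENNReal.rpow_lt_top_iff_of_pos (by norm_num)]
  simp only [symb_rpow_mul_sq]
  constructor
  · intro h
    have h2 := ENNReal.summable_toReal h.ne
    simpa only [ENNReal.toReal_ofReal (sq_nonneg _)] using h2
  · intro h
    rw [← ENNReal.ofReal_tsum_of_nonneg (fun _ => sq_nonneg _) h]
    exact ENNReal.ofReal_lt_top

lemma summable_symb_mul {s : ℝ} (hs : 5 / 2 < s) {a : ℤ → ℂ}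
    (h : Summable fun n => (wt s 1 (jb n) * ‖a n‖) ^ 2) : Summable fun n => symb n * ‖a n‖ := by
  have h2 := summable_jb_rpow (b := 2 * s - 4) (by linarith)
  refine (h.add h2).of_nonneg_of_le (fun n => mul_nonneg (symb_pos n).le (norm_nonneg _))
    fun n => ?_
  have hj := jb_pos n
  have e : symb n = jb n ^ s * jb n ^ (2 - s) := by
    rw [← jb_sq, ← Real.rpow_add hj, ← Real.rpow_natCast]
    norm_num
  have e2 : jb n ^ (-(2 * s - 4)) = (jb n ^ (2 - s)) ^ 2 := by
    rw [← Real.rpow_natCast, ← Real.rpow_mul hj.le]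
    congr 1
    push_cast
    ring
  rw [wt_one, e, e2]
  nlinarith [sq_nonneg (jb n ^ s * ‖a n‖ - jb n ^ (2 - s)), sq_nonneg (jb n ^ s * ‖a n‖),
    sq_nonneg (jb n ^ (2 - s))]

lemma summable_norm_of_symb {a : ℤ → ℂ} (h : Summable fun n => symb n * ‖a n‖) :
    Summable fun n => ‖a n‖ :=
  h.of_nonneg_of_le (fun _ => norm_nonneg _) fun n =>
    le_mul_of_one_le_left (norm_nonneg _) (one_le_symb n)

lemma HasTrig.coeff_id {f : UnitAddCircle → ℝ} {a : ℤ → ℂ} (hf : HasTrig f id a) :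
    coeff f = a := by
  ext n
  rw [← (hf.coeff_eq n).tsum_eq]
  exact tsum_ite_eq n a

lemma hasTrig_coeff {f : UnitAddCircle → ℝ} (hf : Continuous f)
    (h : Summable fun n => ‖coeff f n‖) : HasTrig f id (coeff f) where
  summable := h
  hasSum x := by
    have hc : Continuous fun x => (f x : ℂ) := Complex.continuous_ofReal.comp hf
    exact has_pointwise_sum_fourier_series_of_summable (f := ⟨_, hc⟩) h.of_norm x

lemma MemHs.summable {s : ℝ} {f : UnitAddCircle → ℝ} (hf : MemHs s f) :
    Summable fun n => (wt s 1 (jb n) * ‖coeff f n‖) ^ 2 := hsENorm_lt_top_iff.mp hf.2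

lemma MemHs.summable_symb {s : ℝ} (hs : 5 / 2 < s) {f : UnitAddCircle → ℝ} (hf : MemHs s f) :
    Summable fun n => symb n * ‖coeff f n‖ := summable_symb_mul hs hf.summable

lemma MemHs.hasTrig {s : ℝ} (hs : 5 / 2 < s) {f : UnitAddCircle → ℝ} (hf : MemHs s f) :
    HasTrig f id (coeff f) := hasTrig_coeff hf.1 (summable_norm_of_symb (hf.summable_symb hs))

lemma coeff_quotient_sub_rhs {s : ℝ} (hs : 5 / 2 < s) {f g : UnitAddCircle → ℝ}
    (hf : MemHs s f) (hg : MemHs s g) (r : ℝ) (n : ℤ) :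
    coeff (fun x => (f x - g x) / r - rhs g x) n
      = (coeff f n - coeff g n) / r - nl (coeff g) n := by
  have h1 := (hg.hasTrig hs).rhs (hg.summable_symb hs)
  have hc : Continuous fun x => (f x - g x) / r := (hf.1.sub hg.1).div_const r
  rw [coeff_sub hc h1.continuous, coeff_div, coeff_sub hf.1 hg.1,
    coeff_rhs (hg.hasTrig hs) (hg.summable_symb hs)]

/-- The real function with Fourier coefficients `a`. -/
def synth (a : ℤ → ℂ) (x : UnitAddCircle) : ℝ := (∑' n, a n * mode n x).re

lemma hasTrig_synth {a : ℤ → ℂ} (h : Summable fun n => ‖a n‖)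
    (ha : ∀ n, a (-n) = (starRingEnd ℂ) (a n)) : HasTrig (synth a) id a where
  summable := h
  hasSum x := by
    have hs : HasSum (fun n => a n * mode n x) (∑' n, a n * mode n x) :=
      (Summable.of_norm (by simpa using h)).hasSum
    have h1 := hs.map (starRingEnd ℂ) Complex.continuous_conj
    have h2 : (starRingEnd ℂ) (∑' n, a n * mode n x) = ∑' n, a n * mode n x := by
      refine h1.unique (hasSum_of_forall_eq (fun n => ?_) ((Equiv.neg ℤ).hasSum_iff.mpr hs))
      simp [ha, conj_mode]
    rw [synth, Complex.conj_eq_iff_re.mp h2]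
    exact hs

/-! ### Convergence in weighted spaces -/

lemma en_add_le (p : ℝ → ℝ) (S : Finset ℤ) (a b : ℤ → ℂ) :
    en p S (fun n => a n - b n) ≤ 2 * en p S a + 2 * en p S b := by
  simp only [en, Finset.mul_sum, ← Finset.sum_add_distrib]
  refine Finset.sum_le_sum fun n _ => ?_
  have h : ‖a n - b n‖ ^ 2 ≤ 2 * ‖a n‖ ^ 2 + 2 * ‖b n‖ ^ 2 := by
    have h1 := norm_sub_le (a n) (b n)
    have h2 := norm_nonneg (a n - b n)
    nlinarith [sq_nonneg (‖a n‖ - ‖b n‖)]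
  simp only [mul_pow]
  nlinarith [mul_le_mul_of_nonneg_left h (sq_nonneg (p (jb n)))]

/-- Pointwise convergence to zero with uniformly small tails is convergence in `H^s`. -/
lemma eventually_en_le {X : Type*} {l : Filter X} {s : ℝ} {z : X → ℤ → ℂ}
    (hz : ∀ n, Tendsto (fun x => z x n) l (𝓝 0))
    (htail : ∀ ε > 0, ∃ L, 1 ≤ L ∧ ∀ᶠ x in l, ∀ S, en (wt s L) S (z x) ≤ ε) :
    ∀ ε > 0, ∀ᶠ x in l, ∀ S, en (wt s 1) S (z x) ≤ ε := by
  intro ε hε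
  obtain ⟨L, hL, hev⟩ := htail (ε / 2) (by linarith)
  have hF : {n : ℤ | jb n < L}.Finite := by
    refine (Set.finite_Icc (-⌈L⌉) ⌈L⌉).subset fun n hn => ?_
    have h1 : |(n : ℝ)| ≤ ⌈L⌉ := (abs_le_jb n).trans ((le_of_lt hn).trans (Int.le_ceil L))
    rw [abs_le] at h1
    exact ⟨by exact_mod_cast h1.1, by exact_mod_cast h1.2⟩
  set F := hF.toFinset
  have h1 : Tendsto (fun x => en (wt s 1) F (z x)) l (𝓝 (∑ n ∈ F, (wt s 1 (jb n) * ‖(0 : ℂ)‖) ^ 2)) :=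
    tendsto_finsetSum F fun n _ => (((hz n).norm.const_mul _).pow 2)
  simp only [norm_zero, mul_zero, ne_eq, OfNat.ofNat_ne_zero, not_false_eq_true, zero_pow,
    Finset.sum_const_zero] at h1
  filter_upwards [hev, h1.eventually (gt_mem_nhds (by linarith : (0 : ℝ) < ε / 2))] with x hx1 hx2 S
  have h2 : ∀ n ∈ S, (wt s 1 (jb n) * ‖z x n‖) ^ 2 ≤
      (if n ∈ F then (wt s 1 (jb n) * ‖z x n‖) ^ 2 else 0) + (wt s L (jb n) * ‖z x n‖) ^ 2 := by
    intro n _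
    split_ifs with hn
    · linarith [sq_nonneg (wt s L (jb n) * ‖z x n‖)]
    · have hn' : L ≤ jb n := by simpa [F] using hn
      have e : wt s L (jb n) = wt s 1 (jb n) := by
        rw [wt_one, wt, min_eq_left, Real.sqrt_one, mul_one]
        rwa [one_le_div (by linarith)]
      rw [e, zero_add]
  calc en (wt s 1) S (z x) ≤ _ := Finset.sum_le_sum h2
    _ = (∑ n ∈ S, if n ∈ F then (wt s 1 (jb n) * ‖z x n‖) ^ 2 else 0) + en (wt s L) S (z x) := by
        rw [Finset.sum_add_distrib, en]
    _ ≤ en (wt s 1) F (z x) + en (wt s L) S (z x) := by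
        gcongr
        rw [← Finset.sum_filter, Finset.filter_mem_eq_inter]
        exact Finset.sum_le_sum_of_subset_of_nonneg Finset.inter_subset_right
          fun _ _ _ => sq_nonneg _
    _ ≤ ε := by linarith [hx1 S]

lemma tendsto_tsum_wt {s : ℝ} {a : ℤ → ℂ} (h : Summable fun n => (wt s 1 (jb n) * ‖a n‖) ^ 2) :
    Tendsto (fun L => ∑' n, (wt s L (jb n) * ‖a n‖) ^ 2) atTop (𝓝 0) := by
  have h1 : Tendsto (fun L => ∑' n, (wt s L (jb n) * ‖a n‖) ^ 2) atTop
      (𝓝 (∑' _ : ℤ, (0 : ℝ))) := by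
    refine tendsto_tsum_of_dominated_convergence h (fun n => ?_)
      ((eventually_ge_atTop 1).mono fun L hL n => ?_)
    · have e1 : Tendsto (fun L : ℝ => jb n / L) atTop (𝓝 0) := tendsto_const_nhds.div_atTop tendsto_id
      have e2 : Tendsto (fun L : ℝ => (wt s L (jb n) * ‖a n‖) ^ 2) atTop
          (𝓝 ((jb n ^ s * √(min 1 0) * ‖a n‖) ^ 2)) :=
        ((((Real.continuous_sqrt.tendsto _).comp (tendsto_const_nhds.min e1)).const_mul _).mul_const
          _).pow 2
      simpa using e2
    · rw [Real.norm_of_nonneg (sq_nonneg _)]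
      have h1 := wt_le_wt_one (s := s) hL n
      have h2 := wt_nonneg s L n
      gcongr
  rwa [tsum_zero] at h1

/-- The mean value inequality in a weighted `ℓ²` norm. -/
lemma en_sub_le_of_hasDerivWithinAt {I : Set ℝ} (hI : Convex ℝ I) {p : ℝ → ℝ} {S : Finset ℤ}
    {a g : ℝ → ℤ → ℂ} {Q : ℝ} (ha : ∀ t ∈ I, ∀ n, HasDerivWithinAt (fun τ => a τ n) (g t n) I t)
    (hg : ∀ t ∈ I, en p S (g t) ≤ Q) {t r : ℝ} (ht : t ∈ I) (hr : r ∈ I) :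
    en p S (fun n => a r n - a t n) ≤ Q * (r - t) ^ 2 := by
  have e : ∀ b : ℤ → ℂ, en p S b
      = ‖(WithLp.toLp 2 fun n : S => (p (jb n) : ℂ) * b n : EuclideanSpace ℂ S)‖ ^ 2 := by
    intro b
    rw [EuclideanSpace.norm_sq_eq, en, ← Finset.sum_coe_sort]
    refine Finset.sum_congr rfl fun n _ => ?_
    simp [mul_pow]
  have hd : ∀ t ∈ I, HasDerivWithinAt
      (fun τ => (WithLp.toLp 2 fun n : S => (p (jb n) : ℂ) * a τ n : EuclideanSpace ℂ S))
      (WithLp.toLp 2 fun n : S => (p (jb n) : ℂ) * g t n) I t := by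
    intro t ht
    have h : HasDerivWithinAt (fun τ => fun n : S => (p (jb n) : ℂ) * a τ n)
        (fun n : S => (p (jb n) : ℂ) * g t n) I t :=
      hasDerivWithinAt_pi.mpr fun n => (ha t ht n).const_mul _
    exact ((PiLp.continuousLinearEquiv 2 ℝ fun _ : S => ℂ).symm :
      (S → ℂ) →L[ℝ] EuclideanSpace ℂ S).hasFDerivAt.comp_hasDerivWithinAt t h
  have h := hI.norm_image_sub_le_of_norm_hasDerivWithin_le (C := √Q) hd
    (fun x hx => Real.le_sqrt_of_sq_le (by rw [← e]; exact hg x hx)) ht hr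
  have hQ : 0 ≤ Q := (en_nonneg _ _ _).trans (hg t ht)
  have e2 : en p S (fun n => a r n - a t n) = ‖(WithLp.toLp 2 fun n : S => (p (jb n) : ℂ) * a r n :
      EuclideanSpace ℂ S) - WithLp.toLp 2 fun n : S => (p (jb n) : ℂ) * a t n‖ ^ 2 := by
    rw [e]
    congr 2
    ext n
    simp [mul_sub]
  rw [e2]
  calc _ ≤ (√Q * ‖r - t‖) ^ 2 := by gcongr
    _ = _ := by rw [mul_pow, Real.sq_sqrt hQ, Real.norm_eq_abs, sq_abs]

lemma wt_sub_one (s L : ℝ) (n : ℤ) : wt (s - 1) L (jb n) = wt s L (jb n) / jb n := by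
  rw [wt, wt, Real.rpow_sub_one (jb_pos n).ne']
  ring

/-! ### Local existence -/

/-- Local solvability in `H^s`, on a time interval whose length depends on the `H²` norm of the
datum only. -/
theorem exists_isSolution_local {s R : ℝ} (hs : 5 / 2 < s) (hR : 0 < R) {f : UnitAddCircle → ℝ}
    (hf : MemHs s f) (hen : ∀ S, en (wt 2 1) S (coeff f) ≤ R / 2) :
    ∃ v, IsSolution s f (Set.Icc (-lifespan R) (lifespan R)) v := by
  obtain ⟨a, D, h0, hsymm, hbd, hder⟩ := exists_local_coeff hs hR (coeff_neg_index f) hf.summable hen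
  set I := Set.Icc (-lifespan R) (lifespan R) with hI
  have hconv : Convex ℝ I := convex_Icc _ _
  have htail : ∀ ε > 0, ∃ L, 1 ≤ L ∧ D * ∑' n, (wt s L (jb n) * ‖coeff f n‖) ^ 2 ≤ ε := by
    intro ε hε
    have h1 := (tendsto_tsum_wt hf.summable).const_mul D
    rw [mul_zero] at h1
    obtain ⟨L, hL1, hL2⟩ := ((h1.eventually (gt_mem_nhds hε)).and (eventually_ge_atTop 1)).exists
    exact ⟨L, hL2, hL1.le⟩
  have hsum : ∀ L, 1 ≤ L → ∀ t ∈ I, Summable fun n => (wt s L (jb n) * ‖a t n‖) ^ 2 :=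
    fun L hL t ht => summable_of_sum_le (fun _ => sq_nonneg _) (hbd L hL t ht)
  have hsymb : ∀ t ∈ I, Summable fun n => symb n * ‖a t n‖ :=
    fun t ht => summable_symb_mul hs (hsum 1 le_rfl t ht)
  have htrig : ∀ t ∈ I, HasTrig (synth (a t)) id (a t) := fun t ht =>
    hasTrig_synth (summable_norm_of_symb (hsymb t ht)) (hsymm t ht)
  have hmem : ∀ t ∈ I, MemHs s (synth (a t)) := fun t ht => by
    refine ⟨(htrig t ht).continuous, hsENorm_lt_top_iff.mpr ?_⟩
    rw [(htrig t ht).coeff_id]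
    exact hsum 1 le_rfl t ht
  -- the nonlinearity has uniformly small tails in the weight `wt (s - 1) L`
  set m : ℤ → ℝ := fun n => √(D * ∑' n, (wt s 1 (jb n) * ‖coeff f n‖) ^ 2) * jb n ^ (-s) with hm
  have ham : ∀ t ∈ I, ∀ n, ‖a t n‖ ≤ m n := fun t ht n => norm_le_of_en_le (hbd 1 le_rfl t ht) n
  have hms : Summable fun n => jb n * m n := summable_jb_mul_rpow (by linarith) _
  set B := ∑' n, jb n * m n with hB
  set C := max ((3 : ℝ) ^ (s + 1)) (2 * s + 1) with hC
  have hnl : ∀ L, 1 ≤ L → ∀ t ∈ I, ∀ S, en (wt (s - 1) L) S (nl (a t))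
      ≤ (12 * C * B ^ 2) ^ 2 * (D * ∑' n, (wt s L (jb n) * ‖coeff f n‖) ^ 2) := by
    intro L hL t ht S
    have hBs : Summable fun n => jb n * ‖a t n‖ :=
      hms.of_nonneg_of_le (fun n => mul_nonneg (jb_pos n).le (norm_nonneg _))
        fun n => mul_le_mul_of_nonneg_left (ham t ht n) (jb_pos n).le
    have h1 := sum_nl_sq_le (isWeight_wt (by linarith : (1 : ℝ) ≤ s) hL) (hsum L hL t ht).hasSum
      hBs.hasSum S
    simp only [en, wt_sub_one]
    refine h1.trans ?_
    have hB1 : ∑' n, jb n * ‖a t n‖ ≤ B := hBs.tsum_le_tsum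
      (fun n => mul_le_mul_of_nonneg_left (ham t ht n) (jb_pos n).le) hms
    have hB0 : 0 ≤ ∑' n, jb n * ‖a t n‖ :=
      tsum_nonneg fun n => mul_nonneg (jb_pos n).le (norm_nonneg _)
    have hE1 : ∑' n, (wt s L (jb n) * ‖a t n‖) ^ 2
        ≤ D * ∑' n, (wt s L (jb n) * ‖coeff f n‖) ^ 2 :=
      (hsum L hL t ht).tsum_le_of_sum_le (hbd L hL t ht)
    have hE0 : 0 ≤ ∑' n, (wt s L (jb n) * ‖a t n‖) ^ 2 := tsum_nonneg fun n => sq_nonneg _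
    gcongr
  refine ⟨fun t => synth (a t), ?_, hmem, fun t ht => ?_, fun t ht => ?_⟩
  · have e : a 0 = coeff f := funext h0
    ext x
    have h := ((hf.hasTrig hs).hasSum x).tsum_eq
    simp only [id] at h
    simp only [e]
    rw [synth, h, Complex.ofReal_re]
  · rw [tendsto_hsENorm_zero_iff]
    have hco : ∀ᶠ τ in 𝓝[I] t, coeff (fun x => synth (a τ) x - synth (a t) x)
        = fun n => a τ n - a t n :=
      (eventually_mem_nhdsWithin).mono fun τ hτ => by
        ext n
        rw [coeff_sub (hmem τ hτ).1 (hmem t ht).1, (htrig τ hτ).coeff_id, (htrig t ht).coeff_id]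
    have hz := eventually_en_le (s := s) (l := 𝓝[I] t) (z := fun τ n => a τ n - a t n)
      (fun n => by
        have h := (hder t ht n).continuousWithinAt.tendsto.sub_const (a t n)
        rwa [sub_self] at h)
      (fun ε hε => by
        obtain ⟨L, hL, hLε⟩ := htail (ε / 4) (by linarith)
        refine ⟨L, hL, (eventually_mem_nhdsWithin).mono fun τ hτ S => ?_⟩
        have h1 := en_add_le (wt s L) S (a τ) (a t)
        linarith [hbd L hL τ hτ S, hbd L hL t ht S])
    intro ε hε
    filter_upwards [hco, hz ε hε] with τ h1 h2
    rwa [h1]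
  · rw [tendsto_hsENorm_zero_iff]
    have hco : ∀ᶠ τ in 𝓝[I \ {t}] t,
        coeff (fun x => (synth (a τ) x - synth (a t) x) / (τ - t) - rhs (synth (a t)) x)
        = fun n => (a τ n - a t n) / ((τ - t : ℝ) : ℂ) - nl (a t) n :=
      (eventually_mem_nhdsWithin).mono fun τ hτ => by
        ext n
        rw [coeff_quotient_sub_rhs hs (hmem τ hτ.1) (hmem t ht), (htrig τ hτ.1).coeff_id,
          (htrig t ht).coeff_id]
    have hz := eventually_en_le (s := s - 1) (l := 𝓝[I \ {t}] t)
      (z := fun τ n => (a τ n - a t n) / ((τ - t : ℝ) : ℂ) - nl (a t) n)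
      (fun n => by
        have h := (hasDerivWithinAt_iff_tendsto_slope.mp (hder t ht n)).sub_const (nl (a t) n)
        rw [sub_self] at h
        refine h.congr fun τ => ?_
        rw [slope_def_module, Complex.real_smul, Complex.ofReal_inv, div_eq_inv_mul])
      (fun ε hε => by
        set Z := (12 * C * B ^ 2) ^ 2 with hZ
        obtain ⟨L, hL, hLε⟩ := htail (ε / (4 * (Z + 1))) (by positivity)
        refine ⟨L, hL, (eventually_mem_nhdsWithin).mono fun τ hτ S => ?_⟩
        have hτt : τ - t ≠ 0 := sub_ne_zero.mpr hτ.2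
        set Q := Z * (D * ∑' n, (wt s L (jb n) * ‖coeff f n‖) ^ 2) with hQ
        have h1 := en_add_le (wt (s - 1) L) S (fun n => (a τ n - a t n) / ((τ - t : ℝ) : ℂ))
          (nl (a t))
        have h2 := en_sub_le_of_hasDerivWithinAt hconv hder
          (fun r hr => hnl L hL r hr S) ht hτ.1
        have h3 : en (wt (s - 1) L) S (fun n => (a τ n - a t n) / ((τ - t : ℝ) : ℂ)) ≤ Q := by
          have e : en (wt (s - 1) L) S (fun n => (a τ n - a t n) / ((τ - t : ℝ) : ℂ))
              = en (wt (s - 1) L) S (fun n => a τ n - a t n) / (τ - t) ^ 2 := by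
            rw [en, en, Finset.sum_div]
            refine Finset.sum_congr rfl fun n _ => ?_
            rw [norm_div, Complex.norm_real, Real.norm_eq_abs, mul_div_assoc', div_pow, sq_abs]
          rw [e, div_le_iff₀ (by positivity)]
          exact h2
        have h4 := hnl L hL t ht S
        have h5 : Q ≤ ε / 4 := by
          have hZ0 : 0 ≤ Z := sq_nonneg _
          calc Q ≤ Z * (ε / (4 * (Z + 1))) := by
                rw [hQ]; gcongr
            _ ≤ ε / 4 := by
                rw [mul_div_assoc', div_le_div_iff₀ (by positivity) (by positivity)]
                nlinarith
        linarith)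
    intro ε hε
    filter_upwards [hco, hz ε hε] with τ h1 h2
    rwa [h1]

/-! ### The `H²` norm is controlled by the `C¹` norm -/

/-- Cyclic permutation of the last three frequencies. -/
def rot : ℤ × ℤ × ℤ × ℤ ≃ ℤ × ℤ × ℤ × ℤ where
  toFun t := (t.1, t.2.2.1, t.2.2.2, t.2.1)
  invFun t := (t.1, t.2.2.2, t.2.1, t.2.2.1)
  left_inv _ := rfl
  right_inv _ := rfl

/-- Interchange of the first with the second and of the third with the fourth frequency. -/
def flip12 : ℤ × ℤ × ℤ × ℤ ≃ ℤ × ℤ × ℤ × ℤ where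
  toFun t := (t.2.1, t.1, t.2.2.2, t.2.2.1)
  invFun t := (t.2.1, t.1, t.2.2.2, t.2.2.1)
  left_inv _ := rfl
  right_inv _ := rfl

/-- Interchange of the first with the third and of the second with the fourth frequency. -/
def flip13 : ℤ × ℤ × ℤ × ℤ ≃ ℤ × ℤ × ℤ × ℤ where
  toFun t := (t.2.2.1, t.2.2.2, t.1, t.2.1)
  invFun t := (t.2.2.1, t.2.2.2, t.1, t.2.1)
  left_inv _ := rfl
  right_inv _ := rfl

lemma res_rot (t) : Res (rot t) ↔ Res t := by simp only [Res, rot, Equiv.coe_fn_mk]; omega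
lemma res_flip12 (t) : Res (flip12 t) ↔ Res t := by
  simp only [Res, flip12, Equiv.coe_fn_mk]; omega
lemma res_flip13 (t) : Res (flip13 t) ↔ Res t := by
  simp only [Res, flip13, Equiv.coe_fn_mk]; omega

/-- A sum over quadruples vanishes when its terms cancel under the even permutations. The twelve
even permutations are the products of the double transpositions with the powers of `rot`. -/
lemma tsum_eq_zero_of_even_perms {U : ℤ × ℤ × ℤ × ℤ → ℂ} (hU : Summable U)
    (h : ∀ t, (U t + U (rot t) + U (rot (rot t)))
      + (U (flip12 t) + U (rot (flip12 t)) + U (rot (rot (flip12 t))))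
      + (U (flip13 t) + U (rot (flip13 t)) + U (rot (rot (flip13 t))))
      + (U (flip12 (flip13 t)) + U (rot (flip12 (flip13 t))) + U (rot (rot (flip12 (flip13 t)))))
      = 0) : ∑' t, U t = 0 := by
  have h1 := (hU.hasSum.add (rot.hasSum_iff.mpr hU.hasSum)).add
    ((rot.trans rot).hasSum_iff.mpr hU.hasSum)
  have h2 := ((h1.add (flip12.hasSum_iff.mpr h1)).add (flip13.hasSum_iff.mpr h1)).add
    ((flip13.trans flip12).hasSum_iff.mpr h1)
  have h3 := (hasSum_of_forall_eq (fun t => (h t).symm) h2).unique hasSum_zero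
  linear_combination h3 / 12

/-- The symbol of the pairing of `Λ⁴ u` with the nonlinearity is controlled by the norm of
`H^{5/2}`. -/
lemma symb_sq_mul_abs_lam_le {j k l m : ℤ} (h : Res (j, k, l, m)) :
    symb j ^ 2 * |lam k l m| ≤ 4 * max (3 ^ ((5 : ℝ) / 2 + 1)) (2 * (5 / 2) + 1)
      * pairs (wt (5 / 2) 1) j k l m := by
  have hp := isWeight_wt (by norm_num : (1 : ℝ) ≤ 5 / 2) le_rfl
  set C := max ((3 : ℝ) ^ ((5 : ℝ) / 2 + 1)) (2 * (5 / 2) + 1)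
  have C1 := hp.one_le
  have hj : jb (k + l + m) = jb j := by
    rw [← jb_neg]; congr 1; simp only [Res] at h; omega
  have hsym := symbol_le hp k l m
  rw [hj] at hsym
  have pj := hp.nonneg _ (one_le_jb j)
  have pk := hp.nonneg _ (one_le_jb k)
  have pl := hp.nonneg _ (one_le_jb l)
  have pm := hp.nonneg _ (one_le_jb m)
  have j0 := jb_pos j
  have k0 := jb_pos k
  have l0 := jb_pos l
  have m0 := jb_pos m
  have htri : wt (5 / 2) 1 (jb j) * tri (wt (5 / 2) 1) k l m ≤ pairs (wt (5 / 2) 1) j k l m := by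
    set p := wt (5 / 2) 1
    have a1 : 0 ≤ p (jb l) * p (jb k) * (jb j * jb m) := by positivity
    have a2 : 0 ≤ p (jb m) * p (jb k) * (jb l * jb j) := by positivity
    have a3 : 0 ≤ p (jb l) * p (jb m) * (jb j * jb k) := by positivity
    unfold pairs tri
    linarith
  have e : symb j ^ 2 * jb j = wt (5 / 2) 1 (jb j) * wt (5 / 2) 1 (jb j) := by
    rw [wt_one, ← Real.rpow_add j0, ← jb_sq, ← pow_mul, ← pow_succ, ← Real.rpow_natCast]
    norm_num
  refine le_of_mul_le_mul_right ?_ j0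
  calc symb j ^ 2 * |lam k l m| * jb j = symb j ^ 2 * jb j * |lam k l m| := by ring
    _ = wt (5 / 2) 1 (jb j) * (wt (5 / 2) 1 (jb j) * |lam k l m|) := by rw [e]; ring
    _ ≤ wt (5 / 2) 1 (jb j) * (4 * C * jb j * tri (wt (5 / 2) 1) k l m) := by gcongr
    _ = 4 * C * (wt (5 / 2) 1 (jb j) * tri (wt (5 / 2) 1) k l m) * jb j := by ring
    _ ≤ _ := by gcongr

/-- The momentum `m = u - u_xx`. -/
def mom (f : UnitAddCircle → ℝ) (x : UnitAddCircle) : ℝ := f x - dx (dx f) x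

lemma HasTrig.mom {f : UnitAddCircle → ℝ} {a : ℤ → ℂ} (hf : HasTrig f id a)
    (ha : Summable fun n => symb n * ‖a n‖) : HasTrig (mom f) id (fun n => symb n * a n) := by
  refine (hf.add (((hf.dx_id ha).dx (summable_xi_dx ha)).smul (-1))).congr (fun x => ?_)
    (fun _ => rfl) fun n => ?_
  · rw [Novikov.mom]; ring
  · simp only [id, symb_eq]
    push_cast
    linear_combination (-(xi n : ℂ) ^ 2 * a n) * Complex.I_sq

/-- The energy identity `(1/2) d/dt ∫ m² = -2 ∫ u u_x m²` for `m = u - u_xx`, as a statement on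
the Fourier coefficients. -/
lemma hasSum_momentum_pairing {f : UnitAddCircle → ℝ} {a : ℤ → ℂ} (hf : HasTrig f id a)
    (hsymm : ∀ n, a (-n) = (starRingEnd ℂ) (a n))
    (ha : Summable fun n => symb n * ‖a n‖)
    (hE : Summable fun n => (wt (5 / 2) 1 (jb n) * ‖a n‖) ^ 2) :
    HasSum (fun n => symb n ^ 2 * ((starRingEnd ℂ) (a n) * nl a n))
      (-2 * coeff (fun x => f x * (dx f x * (mom f x * mom f x))) 0) := by
  have hB : Summable fun n => jb n * ‖a n‖ :=
    ha.of_nonneg_of_le (fun n => mul_nonneg (jb_pos n).le (norm_nonneg _)) fun n => by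
      gcongr
      rw [← jb_sq]
      nlinarith [one_le_jb n]
  obtain ⟨hPs, -⟩ := hasSum_pairs (isWeight_wt (by norm_num : (1 : ℝ) ≤ 5 / 2) le_rfl)
    hE.hasSum hB.hasSum
  set C := max ((3 : ℝ) ^ ((5 : ℝ) / 2 + 1)) (2 * (5 / 2) + 1)
  -- the pairing of `Λ⁴ u` with the nonlinearity
  obtain ⟨N, hN⟩ : ∃ N : ℤ × ℤ × ℤ × ℤ → ℂ, N = fun t => if Res t then
      symb t.1 ^ 2 * a t.1 * (-Complex.I * lam t.2.1 t.2.2.1 t.2.2.2 *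
        (a t.2.1 * a t.2.2.1 * a t.2.2.2)) else 0 := ⟨_, rfl⟩
  have hNs : Summable N := by
    refine Summable.of_norm ((hPs.mul_left (4 * C)).of_nonneg_of_le (fun _ => norm_nonneg _) ?_)
    rintro ⟨j, k, l, m⟩
    simp only [hN]
    split_ifs with h
    · have hsym := symb_sq_mul_abs_lam_le h
      simp only [norm_mul, norm_neg, Complex.norm_I, Complex.norm_real, Real.norm_eq_abs, one_mul,
        norm_pow, abs_of_pos (symb_pos j)]
      calc _ = symb j ^ 2 * |lam k l m| * (‖a j‖ * ‖a k‖ * ‖a l‖ * ‖a m‖) := by ring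
        _ ≤ 4 * C * pairs (wt (5 / 2) 1) j k l m * (‖a j‖ * ‖a k‖ * ‖a l‖ * ‖a m‖) := by gcongr
        _ = _ := by ring
    · simp
  have h1 := hasSum_pairing (a := a) (b := fun j => symb j ^ 2 * a j) (by rw [← hN]; exact hNs)
  rw [← hN] at h1
  -- the integral of `u u_x m²`
  have hm := hf.mom ha
  have h2 := (hf.mul ((hf.dx_id ha).mul (hm.mul hm))).coeff_eq 0
  obtain ⟨G, hG⟩ : ∃ G : ℤ × ℤ × ℤ × ℤ → ℂ, G = fun t => if Res t then
      a t.1 * (Complex.I * xi t.2.1 * a t.2.1 * (symb t.2.2.1 * a t.2.2.1 *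
        (symb t.2.2.2 * a t.2.2.2))) else 0 := ⟨_, rfl⟩
  have h3 : HasSum G (coeff (fun x => f x * (dx f x * (mom f x * mom f x))) 0) := by
    refine hasSum_of_forall_eq (fun t => ?_) h2
    simp only [hG, Res, id, add_assoc]
  have h4 : ∑' t, (N t + 2 * G t) = 0 := by
    refine tsum_eq_zero_of_even_perms (hNs.add (h3.summable.mul_left 2)) fun t => ?_
    simp only [hN, hG, res_rot, res_flip12, res_flip13]
    obtain ⟨j, k, l, m⟩ := t
    by_cases h : Res (j, k, l, m)
    · simp only [if_pos h]
      simp only [rot, flip12, flip13, Equiv.coe_fn_mk]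
      -- the symbol of the pairing, cleared of its denominator
      have hlam : ∀ j k l m : ℤ, j + (k + l + m) = 0 → ((symb j : ℝ) : ℂ) ^ 2 * (lam k l m : ℝ) =
          ((-(symb j ^ 2 * xi j / 3) - symb j * (xi j * (1 - 3 / 2 * (xi l * xi m))
            + 1 / 2 * (xi k * xi l * xi m)) : ℝ) : ℂ) := by
        intro j k l m h
        have hj := (symb_pos j).ne'
        rw [← Complex.ofReal_pow, ← Complex.ofReal_mul, lam,
          show k + l + m = -j by omega, xi_neg, symb_neg]
        congr 1
        field_simp
        ring
      have hs : ∀ j k l m : ℤ, j + (k + l + m) = 0 → symb j ^ 2 * a j * (-Complex.I * lam k l m *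
          (a k * a l * a m)) + 2 * (a j * (Complex.I * xi k * a k * (symb l * a l *
          (symb m * a m)))) = Complex.I * (((symb j ^ 2 * xi j / 3) +
            symb j * (xi j * (1 - 3 / 2 * (xi l * xi m)) + 1 / 2 * (xi k * xi l * xi m))
            + 2 * (xi k * symb l * symb m) : ℝ) : ℂ) * (a j * a k * a l * a m) := by
        intro j k l m h
        have e := hlam j k l m h
        push_cast at e ⊢
        linear_combination (-Complex.I * (a j * a k * a l * a m)) * e
      have h0 : j + (k + l + m) = 0 := h
      have hx : xi m = -xi j - xi k - xi l := by
        rw [show m = -(j + (k + l)) by omega, xi_neg, xi_add, xi_add]; ring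
      rw [hs j k l m (by omega), hs j l m k (by omega), hs j m k l (by omega),
        hs k j m l (by omega), hs k m l j (by omega), hs k l j m (by omega),
        hs l m j k (by omega), hs l j k m (by omega), hs l k m j (by omega),
        hs m l k j (by omega), hs m k j l (by omega), hs m j l k (by omega)]
      simp only [symb_eq, hx]
      push_cast
      ring
    · simp only [if_neg h, mul_zero, add_zero]
  rw [hNs.tsum_add (h3.summable.mul_left 2), tsum_mul_left, h3.tsum_eq] at h4
  have e : -2 * coeff (fun x => f x * (dx f x * (mom f x * mom f x))) 0 = ∑' t, N t := by
    linear_combination -h4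
  rw [e]
  refine hasSum_of_forall_eq (fun n => ?_) h1
  simp only [symb_neg, hsymm]
  ring

/-- Parseval's identity for the momentum. -/
lemma hasSum_mom_sq {f : UnitAddCircle → ℝ} {a : ℤ → ℂ} (hf : HasTrig f id a)
    (hsymm : ∀ n, a (-n) = (starRingEnd ℂ) (a n)) (ha : Summable fun n => symb n * ‖a n‖) :
    HasSum (fun n => (symb n * ‖a n‖) ^ 2)
      (∫ x, mom f x * mom f x ∂AddCircle.haarAddCircle) := by
  have hm := hf.mom ha
  have h := (hm.mul hm).coeff_eq 0
  have hinj : Function.Injective fun n : ℤ => ((n, -n) : ℤ × ℤ) := fun m n h => by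
    simpa using congrArg Prod.fst h
  have h2 := (hinj.hasSum_iff fun t ht => if_neg fun h0 => ht ⟨t.1, by
    obtain ⟨k, l⟩ := t
    simp only [id] at h0
    simp only [Prod.mk.injEq, true_and]
    omega⟩).mpr h
  have e : coeff (fun x => mom f x * mom f x) 0
      = ((∫ x, mom f x * mom f x ∂AddCircle.haarAddCircle : ℝ) : ℂ) := by
    rw [coeff, fourierCoeff, ← integral_complex_ofReal]
    simp
  rw [e] at h2
  refine Complex.hasSum_ofReal.mp (hasSum_of_forall_eq (fun n => ?_) h2)
  simp only [Function.comp, id, add_neg_cancel, if_true, symb_neg, hsymm]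
  push_cast
  linear_combination -(symb n : ℂ) ^ 2 * Complex.mul_conj' (a n)

lemma norm_coeff_momentum_le {f : UnitAddCircle → ℝ} {a : ℤ → ℂ} {K : ℝ} (hf : HasTrig f id a)
    (hsymm : ∀ n, a (-n) = (starRingEnd ℂ) (a n)) (ha : Summable fun n => symb n * ‖a n‖)
    (hK : c1ENorm f ≤ ENNReal.ofReal K) (hK0 : 0 < K) :
    ‖coeff (fun x => f x * (dx f x * (mom f x * mom f x))) 0‖
      ≤ K ^ 2 * ∑' n, (symb n * ‖a n‖) ^ 2 := by
  have hm := hf.mom ha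
  have hfK : ∀ x, |f x| ≤ K := fun x => by
    have h : ‖f x‖ₑ ≤ ENNReal.ofReal K := (le_iSup (fun x => ‖f x‖ₑ) x).trans
      (le_self_add.trans hK)
    rwa [Real.enorm_eq_ofReal_abs, ENNReal.ofReal_le_ofReal_iff hK0.le] at h
  have hdK : ∀ x, |dx f x| ≤ K := fun x => by
    have h : ‖dx f x‖ₑ ≤ ENNReal.ofReal K := (le_iSup (fun x => ‖dx f x‖ₑ) x).trans
      (le_add_self.trans hK)
    rwa [Real.enorm_eq_ofReal_abs, ENNReal.ofReal_le_ofReal_iff hK0.le] at h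
  rw [(hasSum_mom_sq hf hsymm ha).tsum_eq, ← integral_const_mul, coeff, fourierCoeff]
  have hc : Continuous fun x => K ^ 2 * (mom f x * mom f x) :=
    continuous_const.mul (hm.continuous.mul hm.continuous)
  refine norm_integral_le_of_norm_le
    (hc.integrable_of_hasCompactSupport (HasCompactSupport.of_compactSpace _))
    (Eventually.of_forall fun x => ?_)
  simp only [neg_zero, fourier_zero, one_smul, Complex.norm_real, Real.norm_eq_abs, abs_mul,
    abs_mul_abs_self]
  have h1 := mul_le_mul (hfK x) (hdK x) (abs_nonneg _) hK0.le
  nlinarith [mul_le_mul_of_nonneg_right h1 (mul_self_nonneg (mom f x))]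

lemma wt_one_mono {s r : ℝ} (h : s ≤ r) (n : ℤ) : wt s 1 (jb n) ≤ wt r 1 (jb n) := by
  rw [wt_one, wt_one]
  exact Real.rpow_le_rpow_of_exponent_le (one_le_jb n) h

lemma en_wt_mono {s r : ℝ} (h : s ≤ r) (S : Finset ℤ) (a : ℤ → ℂ) :
    en (wt s 1) S a ≤ en (wt r 1) S a := by
  refine Finset.sum_le_sum fun n _ => ?_
  have := wt_one_mono h n
  have := wt_nonneg s 1 n
  gcongr

/-- The pairing of `H^{3/2}` with `H^{5/2}` given by the inner product of `H²`. -/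
def pairH2 (x y : ℤ → ℂ) : ℝ := ∑' n, symb n ^ 2 * ((starRingEnd ℂ) (x n) * y n).re

lemma pairH2_bound {x y : ℤ → ℂ} {X Y : ℝ} (hx : ∀ S, en (wt (3 / 2) 1) S x ≤ X)
    (hy : ∀ S, en (wt (5 / 2) 1) S y ≤ Y) :
    (Summable fun n => symb n ^ 2 * ((starRingEnd ℂ) (x n) * y n).re) ∧
      |pairH2 x y| ≤ √X * √Y := by
  have hle : ∀ S : Finset ℤ,
      ∑ n ∈ S, ‖symb n ^ 2 * ((starRingEnd ℂ) (x n) * y n).re‖ ≤ √X * √Y := by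
    intro S
    calc ∑ n ∈ S, ‖symb n ^ 2 * ((starRingEnd ℂ) (x n) * y n).re‖
        ≤ ∑ n ∈ S, (wt (3 / 2) 1 (jb n) * ‖x n‖) * (wt (5 / 2) 1 (jb n) * ‖y n‖) := by
          refine Finset.sum_le_sum fun n _ => ?_
          have e : symb n ^ 2 = wt (3 / 2) 1 (jb n) * wt (5 / 2) 1 (jb n) := by
            rw [wt_one, wt_one, ← Real.rpow_add (jb_pos n), ← jb_sq, ← pow_mul,
              ← Real.rpow_natCast]
            norm_num
          have h := Complex.abs_re_le_norm ((starRingEnd ℂ) (x n) * y n)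
          rw [norm_mul, RCLike.norm_conj] at h
          rw [norm_mul, Real.norm_of_nonneg (sq_nonneg _), Real.norm_eq_abs]
          calc _ ≤ symb n ^ 2 * (‖x n‖ * ‖y n‖) := by gcongr
            _ = _ := by rw [e]; ring
      _ ≤ √(en (wt (3 / 2) 1) S x) * √(en (wt (5 / 2) 1) S y) :=
          Real.sum_mul_le_sqrt_mul_sqrt _ _ _
      _ ≤ _ := by
          gcongr
          · exact hx S
          · exact hy S
  have hs := summable_of_sum_le (fun n => norm_nonneg _) hle
  exact ⟨hs.of_norm, (norm_tsum_le_tsum_norm hs).trans (hs.tsum_le_of_sum_le hle)⟩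

/-- The `H²` energy is differentiable along a differentiable curve of `H^{3/2}` that is continuous
in `H^{5/2}`. -/
lemma hasDerivWithinAt_tsum_sq {I : Set ℝ} {t : ℝ} {a : ℝ → ℤ → ℂ} {g : ℤ → ℂ} {G A : ℝ}
    (hsum : ∀ τ ∈ I, Summable fun n => (symb n * ‖a τ n‖) ^ 2) (ht : t ∈ I)
    (hg : ∀ S, en (wt (3 / 2) 1) S g ≤ G) (hA : ∀ S, en (wt (5 / 2) 1) S (a t) ≤ A)
    (hc : ∀ ε > 0, ∀ᶠ τ in 𝓝[I \ {t}] t, ∀ S, en (wt (5 / 2) 1) S (fun n => a τ n - a t n) ≤ ε)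
    (hd : ∀ ε > 0, ∀ᶠ τ in 𝓝[I \ {t}] t, ∀ S,
      en (wt (3 / 2) 1) S (fun n => (a τ n - a t n) / ((τ - t : ℝ) : ℂ) - g n) ≤ ε) :
    HasDerivWithinAt (fun τ => ∑' n, (symb n * ‖a τ n‖) ^ 2) (2 * pairH2 g (a t)) I t := by
  rw [hasDerivWithinAt_iff_tendsto_slope, Metric.tendsto_nhds]
  intro η hη
  set M := 2 + 2 * √A + √G with hM
  have M0 : 0 < M := by positivity
  set δ := min 1 (η / (2 * M)) with hδ
  have δ0 : 0 < δ := by positivity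
  filter_upwards [hc (δ ^ 2) (by positivity), hd (δ ^ 2) (by positivity), eventually_mem_nhdsWithin]
    with τ h1 h2 hτ
  have hτt : τ - t ≠ 0 := sub_ne_zero.mpr hτ.2
  set d : ℤ → ℂ := fun n => a τ n - a t n with hdd
  set z : ℤ → ℂ := fun n => (a τ n - a t n) / ((τ - t : ℝ) : ℂ) - g n with hz
  obtain ⟨s1, b1⟩ := pairH2_bound h2 h1
  obtain ⟨s2, b2⟩ := pairH2_bound h2 hA
  obtain ⟨s3, b3⟩ := pairH2_bound hg h1
  obtain ⟨s4, -⟩ := pairH2_bound hg hA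
  -- with `d = a τ - a t` and `d / (τ - t) = z + g`, the difference quotient of `|a|²` is
  -- `Re (conj (z + g) (d + 2 a t))`, where `z` and `d` are small
  have key : slope (fun τ => ∑' n, (symb n * ‖a τ n‖) ^ 2) t τ
      = pairH2 z d + 2 * pairH2 z (a t) + pairH2 g d + 2 * pairH2 g (a t) := by
    have hR := ((s1.hasSum.add (s2.hasSum.mul_left 2)).add s3.hasSum).add (s4.hasSum.mul_left 2)
    have hL := ((hsum τ hτ.1).hasSum.sub (hsum t ht).hasSum).mul_left (τ - t)⁻¹
    rw [slope_def_module, smul_eq_mul]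
    refine hL.unique (hasSum_of_forall_eq (fun n => ?_) hR)
    have e1 : ‖a τ n‖ ^ 2 - ‖a t n‖ ^ 2
        = ((starRingEnd ℂ) (a τ n - a t n) * (d n + 2 * a t n)).re := by
      rw [← Complex.normSq_eq_norm_sq, ← Complex.normSq_eq_norm_sq, Complex.normSq_apply,
        Complex.normSq_apply]
      simp [hdd]
      ring
    have e2 : (starRingEnd ℂ) (a τ n - a t n)
        = ((τ - t : ℝ) : ℂ) * ((starRingEnd ℂ) (z n) + (starRingEnd ℂ) (g n)) := by
      have h : a τ n - a t n = ((τ - t : ℝ) : ℂ) * (z n + g n) := by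
        have : ((τ - t : ℝ) : ℂ) ≠ 0 := Complex.ofReal_ne_zero.mpr hτt
        simp only [hz]
        field_simp
        ring
      rw [h, map_mul, Complex.conj_ofReal, map_add]
    rw [e2, mul_assoc, Complex.re_ofReal_mul] at e1
    have e3 : (((starRingEnd ℂ) (z n) + (starRingEnd ℂ) (g n)) * (d n + 2 * a t n)).re
        = ((starRingEnd ℂ) (z n) * d n).re + 2 * ((starRingEnd ℂ) (z n) * a t n).re
          + ((starRingEnd ℂ) (g n) * d n).re + 2 * ((starRingEnd ℂ) (g n) * a t n).re := by
      simp
      ring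
    rw [e3] at e1
    rw [mul_pow, mul_pow, ← mul_sub, e1]
    field_simp
  rw [Real.dist_eq, key, add_sub_cancel_right]
  rw [Real.sqrt_sq δ0.le] at b1 b2 b3
  have hδ1 : δ ≤ 1 := min_le_left _ _
  have hδ2 : δ * (2 * M) ≤ η := by
    rw [← le_div_iff₀ (by positivity)]; exact min_le_right _ _
  calc |pairH2 z d + 2 * pairH2 z (a t) + pairH2 g d|
      ≤ |pairH2 z d| + 2 * |pairH2 z (a t)| + |pairH2 g d| := by
        refine (abs_add_le _ _).trans ?_
        gcongr
        refine (abs_add_le _ _).trans ?_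
        rw [abs_mul, abs_two]
    _ ≤ δ * δ + 2 * (δ * √A) + √G * δ := by gcongr
    _ ≤ δ * M := by rw [hM]; nlinarith [Real.sqrt_nonneg A, Real.sqrt_nonneg G]
    _ < η := by nlinarith

/-- A solution whose `C¹` norm is bounded by `K` has an `H²` norm that grows at most like
`exp(2K²|t|)`. -/
lemma IsSolution.en_le {s : ℝ} (hs : 5 / 2 < s) {f : UnitAddCircle → ℝ} {a b K : ℝ} (hK0 : 0 < K)
    {v : ℝ → UnitAddCircle → ℝ} (hv : IsSolution s f (Set.Icc a b) v) (h0 : 0 ∈ Set.Icc a b)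
    (hK : ∀ t ∈ Set.Icc a b, c1ENorm (v t) ≤ ENNReal.ofReal K) {t : ℝ} (ht : t ∈ Set.Icc a b)
    (S : Finset ℤ) :
    en (wt 2 1) S (coeff (v t))
      ≤ (∑' n, (symb n * ‖coeff f n‖) ^ 2) * Real.exp (4 * K ^ 2 * |t|) := by
  set I := Set.Icc a b
  have h52 : ∀ t ∈ I, Summable fun n => (wt (5 / 2) 1 (jb n) * ‖coeff (v t) n‖) ^ 2 :=
    fun t ht => (hv.mem t ht).summable.of_nonneg_of_le (fun _ => sq_nonneg _) fun n => by
      have := wt_one_mono hs.le n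
      have := wt_nonneg (5 / 2) 1 n
      gcongr
  have e2 : ∀ n, wt 2 1 (jb n) = symb n := fun n => by rw [wt_two_one, jb_sq]
  have h2 : ∀ t ∈ I, Summable fun n => (symb n * ‖coeff (v t) n‖) ^ 2 :=
    fun t ht => (h52 t ht).of_nonneg_of_le (fun _ => sq_nonneg _) fun n => by
      have := wt_one_mono (by norm_num : (2 : ℝ) ≤ 5 / 2) n
      have := (symb_pos n).le
      rw [← e2] at *
      gcongr
  have hnl : ∀ t ∈ I, ∃ G, ∀ S, en (wt (3 / 2) 1) S (nl (coeff (v t))) ≤ G := by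
    intro t ht
    have hB : Summable fun n => jb n * ‖coeff (v t) n‖ :=
      ((hv.mem t ht).summable_symb hs).of_nonneg_of_le
        (fun n => mul_nonneg (jb_pos n).le (norm_nonneg _)) fun n => by
          gcongr
          rw [← jb_sq]
          nlinarith [one_le_jb n]
    have h := sum_nl_sq_le (isWeight_wt (by norm_num : (1 : ℝ) ≤ 5 / 2) le_rfl)
      (h52 t ht).hasSum hB.hasSum
    simp only [← wt_sub_one, show (5 : ℝ) / 2 - 1 = 3 / 2 by norm_num] at h
    exact ⟨_, h⟩
  have hder : ∀ t ∈ I, HasDerivWithinAt (fun τ => ∑' n, (symb n * ‖coeff (v τ) n‖) ^ 2)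
      (2 * pairH2 (nl (coeff (v t))) (coeff (v t))) I t := by
    intro t ht
    obtain ⟨G, hG⟩ := hnl t ht
    refine hasDerivWithinAt_tsum_sq h2 ht hG
      (fun S => (h52 t ht).sum_le_tsum S fun _ _ => sq_nonneg _) (fun ε hε => ?_) fun ε hε => ?_
    · have h := tendsto_hsENorm_zero_iff.mp ((hv.cont t ht).mono_left
        (nhdsWithin_mono t (Set.sdiff_subset (t := {t})))) ε hε
      filter_upwards [h, eventually_mem_nhdsWithin] with τ hτ hτI S
      refine (en_wt_mono hs.le S _).trans ?_
      have e : (fun n => coeff (v τ) n - coeff (v t) n) = coeff (fun x => v τ x - v t x) :=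
        funext fun n => (coeff_sub (hv.mem τ hτI.1).1 (hv.mem t ht).1 n).symm
      rw [e]
      exact hτ S
    · have h := tendsto_hsENorm_zero_iff.mp (hv.eqn t ht) ε hε
      filter_upwards [h, eventually_mem_nhdsWithin] with τ hτ hτI S
      refine (en_wt_mono (by linarith : 3 / 2 ≤ s - 1) S _).trans ?_
      have e : (fun n => (coeff (v τ) n - coeff (v t) n) / ((τ - t : ℝ) : ℂ) - nl (coeff (v t)) n)
          = coeff (fun x => (v τ x - v t x) / (τ - t) - rhs (v t) x) :=
        funext fun n => (coeff_quotient_sub_rhs hs (hv.mem τ hτI.1) (hv.mem t ht) _ n).symm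
      rw [e]
      exact hτ S
  have hle : ∀ t ∈ I, |2 * pairH2 (nl (coeff (v t))) (coeff (v t))|
      ≤ 4 * K ^ 2 * ∑' n, (symb n * ‖coeff (v t) n‖) ^ 2 := by
    intro t ht
    have hT := (hv.mem t ht).hasTrig hs
    have hsy := (hv.mem t ht).summable_symb hs
    have h1 := hasSum_momentum_pairing hT (coeff_neg_index _) hsy (h52 t ht)
    have h3 := Complex.hasSum_re h1
    have e : pairH2 (nl (coeff (v t))) (coeff (v t)) = (-2 * coeff (fun x =>
        v t x * (dx (v t) x * (mom (v t) x * mom (v t) x))) 0).re := by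
      rw [← h3.tsum_eq, pairH2]
      refine tsum_congr fun n => ?_
      rw [← Complex.ofReal_pow, Complex.re_ofReal_mul, ← Complex.conj_re, map_mul,
        Complex.conj_conj, mul_comm (nl _ n)]
    rw [e, abs_mul, abs_two]
    have h4 := Complex.abs_re_le_norm (-2 * coeff (fun x =>
        v t x * (dx (v t) x * (mom (v t) x * mom (v t) x))) 0)
    rw [norm_mul, norm_neg, Complex.norm_ofNat] at h4
    have h5 := norm_coeff_momentum_le hT (coeff_neg_index _) hsy (hK t ht) hK0
    linarith
  have h := gronwall_two_sided h0 hder hle t ht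
  rw [hv.init] at h
  refine le_trans ?_ h
  simp only [en, e2]
  exact (h2 t ht).sum_le_tsum S fun _ _ => sq_nonneg _

/-! ### Restriction, translation and concatenation of solutions -/

/-- The conditions that make `u` a solution on `I`, at the single time `t`. -/
structure SolvesAt (s : ℝ) (I : Set ℝ) (u : ℝ → UnitAddCircle → ℝ) (t : ℝ) : Prop where
  mem : MemHs s (u t)
  cont : Tendsto (fun τ => hsENorm s (fun x => u τ x - u t x)) (𝓝[I] t) (𝓝 0)
  eqn : Tendsto (fun τ => hsENorm (s - 1) (fun x => (u τ x - u t x) / (τ - t) - rhs (u t) x))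
    (𝓝[I \ {t}] t) (𝓝 0)

lemma IsSolution.solvesAt {s : ℝ} {f : UnitAddCircle → ℝ} {I : Set ℝ}
    {u : ℝ → UnitAddCircle → ℝ} (h : IsSolution s f I u) {t : ℝ} (ht : t ∈ I) :
    SolvesAt s I u t := ⟨h.mem t ht, h.cont t ht, h.eqn t ht⟩

lemma isSolution_of_solvesAt {s : ℝ} {f : UnitAddCircle → ℝ} {I : Set ℝ}
    {u : ℝ → UnitAddCircle → ℝ} (h0 : u 0 = f) (h : ∀ t ∈ I, SolvesAt s I u t) :
    IsSolution s f I u :=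
  ⟨h0, fun t ht => (h t ht).mem, fun t ht => (h t ht).cont, fun t ht => (h t ht).eqn⟩

section

variable {s : ℝ} {I J : Set ℝ} {u v : ℝ → UnitAddCircle → ℝ} {t : ℝ}

lemma SolvesAt.congr (h : SolvesAt s I u t) (huv : Set.EqOn v u I) (ht : t ∈ I) :
    SolvesAt s I v t where
  mem := by rw [huv ht]; exact h.mem
  cont := h.cont.congr' <| eventually_mem_nhdsWithin.mono fun τ hτ => by
    simp only [huv ht, huv hτ]
  eqn := h.eqn.congr' <| eventually_mem_nhdsWithin.mono fun τ hτ => by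
    simp only [huv ht, huv hτ.1]

lemma SolvesAt.mono (h : SolvesAt s I u t) (hIJ : I ∈ 𝓝[J] t) : SolvesAt s J u t where
  mem := h.mem
  cont := h.cont.mono_left (nhdsWithin_le_iff.mpr hIJ)
  eqn := h.eqn.mono_left <| nhdsWithin_le_iff.mpr <|
    inter_mem (nhdsWithin_mono t Set.sdiff_subset hIJ)
      (mem_of_superset self_mem_nhdsWithin fun _ h => h.2)

/-- The equation is invariant under translations of time. -/
lemma SolvesAt.comp_sub (h : SolvesAt s I u t) (c : ℝ) :
    SolvesAt s ((· - c) ⁻¹' I) (fun τ => u (τ - c)) (t + c) := by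
  have hc : Tendsto (· - c) (𝓝 (t + c)) (𝓝 t) := by
    simpa using (continuous_sub_right c).tendsto (t + c)
  refine ⟨by simpa using h.mem, ?_, ?_⟩
  · have h1 : Tendsto (· - c) (𝓝[(· - c) ⁻¹' I] (t + c)) (𝓝[I] t) :=
      tendsto_nhdsWithin_iff.mpr ⟨hc.mono_left nhdsWithin_le_nhds, eventually_mem_nhdsWithin⟩
    simpa [Function.comp_def] using h.cont.comp h1
  · have h1 : Tendsto (· - c) (𝓝[((· - c) ⁻¹' I) \ {t + c}] (t + c)) (𝓝[I \ {t}] t) :=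
      tendsto_nhdsWithin_iff.mpr ⟨hc.mono_left nhdsWithin_le_nhds,
        eventually_mem_nhdsWithin.mono fun τ hτ => ⟨hτ.1, fun h0 => hτ.2 (by
          simp only [Set.mem_singleton_iff] at h0 ⊢; linarith)⟩⟩
    have h2 := h.eqn.comp h1
    simpa [Function.comp_def, sub_sub, add_comm c t] using h2

/-- A function that solves the equation on two closed sets of times solves it on their union. -/
lemma solvesAt_union (hIc : IsClosed I) (hJc : IsClosed J) (hI : ∀ t ∈ I, SolvesAt s I u t)
    (hJ : ∀ t ∈ J, SolvesAt s J u t) (ht : t ∈ I ∪ J) : SolvesAt s (I ∪ J) u t := by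
  have hbot : ∀ {A : Set ℝ}, IsClosed A → t ∉ A → 𝓝[A] t = ⊥ := fun hA h => by
    rwa [← notMem_closure_iff_nhdsWithin_eq_bot, hA.closure_eq]
  have key : ∀ {A : Set ℝ}, IsClosed A → (∀ t ∈ A, SolvesAt s A u t) →
      Tendsto (fun τ => hsENorm s (fun x => u τ x - u t x)) (𝓝[A] t) (𝓝 0) ∧
      Tendsto (fun τ => hsENorm (s - 1) (fun x => (u τ x - u t x) / (τ - t) - rhs (u t) x))
        (𝓝[A \ {t}] t) (𝓝 0) := fun {A} hA h => by
    by_cases h0 : t ∈ A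
    · exact ⟨(h t h0).cont, (h t h0).eqn⟩
    · rw [Set.sdiff_singleton_eq_self h0, hbot hA h0]
      exact ⟨tendsto_bot, tendsto_bot⟩
  refine ⟨ht.elim (fun h => (hI t h).mem) fun h => (hJ t h).mem, ?_, ?_⟩
  · rw [nhdsWithin_union]
    exact (key hIc hI).1.sup (key hJc hJ).1
  · rw [Set.union_sdiff_distrib, nhdsWithin_union]
    exact (key hIc hI).2.sup (key hJc hJ).2

end

lemma IsSolution.mono {s : ℝ} {f : UnitAddCircle → ℝ} {I J : Set ℝ}
    {u : ℝ → UnitAddCircle → ℝ} (h : IsSolution s f I u) (hJ : J ⊆ I) : IsSolution s f J u :=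
  isSolution_of_solvesAt h.init fun _ ht =>
    (h.solvesAt (hJ ht)).mono (mem_of_superset self_mem_nhdsWithin hJ)

/-- Two solutions on adjacent closed sets of times, the second one given in translated time, are
concatenated. -/
lemma IsSolution.concat {s c : ℝ} {f g : UnitAddCircle → ℝ} {I J : Set ℝ}
    {u v : ℝ → UnitAddCircle → ℝ} (hu : IsSolution s f I u) (hv : IsSolution s g J v)
    (hI : IsClosed I) (hJ : IsClosed J) (h0 : 0 ∈ I) (hg : u c = g)
    (hIJ : ∀ t ∈ I, t - c ∈ J → t = c) :
    ∃ w, IsSolution s f (I ∪ (· - c) ⁻¹' J) w ∧ Set.EqOn w u I := by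
  classical
  set w : ℝ → UnitAddCircle → ℝ := fun t => if t ∈ I then u t else v (t - c) with hw
  have e1 : Set.EqOn w u I := fun t ht => if_pos ht
  have e2 : Set.EqOn w (fun t => v (t - c)) ((· - c) ⁻¹' J) := fun t ht => by
    by_cases h : t ∈ I
    · obtain rfl := hIJ t h ht
      simp only [hw, if_pos h, sub_self, hg, hv.init]
    · exact if_neg h
  refine ⟨w, isSolution_of_solvesAt ((e1 h0).trans hu.init) fun t ht => ?_, e1⟩
  refine solvesAt_union hI (hJ.preimage (continuous_sub_right c))
    (fun t ht => (hu.solvesAt ht).congr e1 ht) (fun t ht => ?_) ht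
  have h := ((hv.solvesAt ht).comp_sub c).congr e2 (by simpa using ht)
  rwa [sub_add_cancel] at h

/-- A solution on a compact interval is continued in both directions, for a time that depends only
on the `H²` norm at the end points. -/
lemma IsSolution.exists_continuation {s R : ℝ} (hs : 5 / 2 < s) (hR : 0 < R)
    {f : UnitAddCircle → ℝ} {a b : ℝ} {u : ℝ → UnitAddCircle → ℝ}
    (hu : IsSolution s f (Set.Icc a b) u) (h0 : 0 ∈ Set.Icc a b)
    (hen : ∀ t ∈ Set.Icc a b, ∀ S, en (wt 2 1) S (coeff (u t)) ≤ R / 2) :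
    ∃ w, IsSolution s f (Set.Icc (a - lifespan R) (b + lifespan R)) w
      ∧ Set.EqOn w u (Set.Icc a b) := by
  have hab : a ≤ b := h0.1.trans h0.2
  have hl := lifespan_pos hR
  have ha : a ∈ Set.Icc a b := Set.left_mem_Icc.mpr hab
  have hb : b ∈ Set.Icc a b := Set.right_mem_Icc.mpr hab
  obtain ⟨v, hv⟩ := exists_isSolution_local hs hR (hu.mem b hb) (hen b hb)
  obtain ⟨v', hv'⟩ := exists_isSolution_local hs hR (hu.mem a ha) (hen a ha)
  obtain ⟨w, hw, hwu⟩ := hu.concat (c := b)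
    (hv.mono (Set.Icc_subset_Icc_left (by linarith : -lifespan R ≤ 0)))
    isClosed_Icc isClosed_Icc h0 rfl fun t ht ht' => le_antisymm ht.2 (by linarith [ht'.1])
  have h1 : IsSolution s f (Set.Icc a (b + lifespan R)) w := hw.mono fun t ht => by
    rcases le_total t b with h | h
    · exact Or.inl ⟨ht.1, h⟩
    · exact Or.inr ⟨by linarith, by linarith [ht.2]⟩
  obtain ⟨w', hw', hwu'⟩ := h1.concat (c := a)
    (hv'.mono (Set.Icc_subset_Icc_right (by linarith : 0 ≤ lifespan R)))
    isClosed_Icc isClosed_Icc ⟨h0.1, by linarith [h0.2]⟩ (hwu ha)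
    fun t ht ht' => le_antisymm (by linarith [ht'.2]) ht.1
  refine ⟨w', hw'.mono fun t ht => ?_, fun t ht => (hwu' ⟨ht.1, by linarith [ht.2]⟩).trans (hwu ht)⟩
  rcases le_total a t with h | h
  · exact Or.inl ⟨h, ht.2⟩
  · exact Or.inr ⟨by linarith [ht.1], by linarith⟩

/-! ### Continuation to all times -/

/-- A solution on every member of an increasing sequence of time intervals, obtained by successive
extension, defines a solution on their union. -/
lemma exists_isSolution_of_steps {s : ℝ} {f : UnitAddCircle → ℝ} {I : ℕ → Set ℝ} {J : Set ℝ}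
    {u : ℝ → UnitAddCircle → ℝ} (hI : Monotone I) (h0 : 0 ∈ I 0)
    (hJ : ∀ t ∈ J, ∃ k, t ∈ I k ∧ I k ∈ 𝓝[J] t) (hu : IsSolution s f (I 0) u)
    (hstep : ∀ k v, IsSolution s f (I k) v → Set.EqOn v u (I 0) →
      ∃ w, IsSolution s f (I (k + 1)) w ∧ Set.EqOn w v (I k)) :
    ∃ v, IsSolution s f J v ∧ Set.EqOn v u (I 0) := by
  classical
  choose! F hF using hstep
  set V : ℕ → ℝ → UnitAddCircle → ℝ := fun k => Nat.rec u (fun k v => F k v) k with hV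
  have hV1 : ∀ k, IsSolution s f (I k) (V k) ∧ Set.EqOn (V k) u (I 0) := by
    intro k
    induction k with
    | zero => exact ⟨hu, fun _ _ => rfl⟩
    | succ k ih =>
      have h := hF k (V k) ih.1 ih.2
      exact ⟨h.1, fun t ht => (h.2 (hI (Nat.zero_le k) ht)).trans (ih.2 ht)⟩
  have hV2 : ∀ k m, k ≤ m → Set.EqOn (V m) (V k) (I k) := by
    intro k m hkm
    induction m, hkm using Nat.le_induction with
    | base => exact fun _ _ => rfl
    | succ m hm ih =>
      exact fun t ht => ((hF m (V m) (hV1 m).1 (hV1 m).2).2 (hI hm ht)).trans (ih ht)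
  set v : ℝ → UnitAddCircle → ℝ := fun t => if h : ∃ k, t ∈ I k then V (Nat.find h) t else u t
    with hv
  have hvV : ∀ k, Set.EqOn v (V k) (I k) := fun k t ht => by
    have h : ∃ k, t ∈ I k := ⟨k, ht⟩
    simp only [hv, dif_pos h]
    exact (hV2 _ _ (Nat.find_min' h ht) (Nat.find_spec h)).symm
  refine ⟨v, isSolution_of_solvesAt ((hvV 0 h0).trans hu.init) fun t ht => ?_, hvV 0⟩
  obtain ⟨k, hk, hkJ⟩ := hJ t ht
  exact (((hV1 k).1.solvesAt hk).congr (hvV k) hk).mono hkJ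

/-- A priori bounded solutions are continued by a unit of time, in finitely many short steps. -/
lemma exists_unit_continuation {s : ℝ} (hs : 5 / 2 < s) {f : UnitAddCircle → ℝ} {K T δ : ℝ}
    (hK0 : 0 < K) (hT : 0 ≤ T) (hδ0 : 0 ≤ δ) (hδ1 : δ ≤ 1) {u : ℝ → UnitAddCircle → ℝ}
    (hK : ∀ r, 0 ≤ r → ∀ v, IsSolution s f (Set.Icc (-(δ * r)) (T + r)) v →
      Set.EqOn v u (Set.Icc 0 T) → ∀ t ∈ Set.Icc (-(δ * r)) (T + r),
      c1ENorm (v t) ≤ ENNReal.ofReal K)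
    {r : ℝ} (hr : 0 ≤ r) {v : ℝ → UnitAddCircle → ℝ}
    (hv : IsSolution s f (Set.Icc (-(δ * r)) (T + r)) v) (hvu : Set.EqOn v u (Set.Icc 0 T)) :
    ∃ w, IsSolution s f (Set.Icc (-(δ * (r + 1))) (T + (r + 1))) w ∧
      Set.EqOn w v (Set.Icc (-(δ * r)) (T + r)) := by
  -- `R/2` bounds the `H²` energy of every continuation up to the time `r + 1`
  set R := 2 * ((∑' n, (symb n * ‖coeff f n‖) ^ 2) * Real.exp (4 * K ^ 2 * (T + r + 1)) + 1)
    with hR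
  have hE : 0 ≤ ∑' n, (symb n * ‖coeff f n‖) ^ 2 := tsum_nonneg fun _ => sq_nonneg _
  have hR0 : 0 < R := by positivity
  have hl := lifespan_pos hR0
  obtain ⟨m, hm⟩ := exists_nat_one_div_lt hl
  set h : ℝ := 1 / ((m : ℝ) + 1) with hh
  have hm0 : (0 : ℝ) < m + 1 := by positivity
  have h0 : 0 < h := by positivity
  have key : ∀ n : ℕ, n ≤ m + 1 →
      ∃ w, IsSolution s f (Set.Icc (-(δ * (r + n * h))) (T + (r + n * h))) w ∧
        Set.EqOn w v (Set.Icc (-(δ * r)) (T + r)) := by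
    intro n
    induction n with
    | zero => exact fun _ => ⟨v, by simpa using hv, fun _ _ => rfl⟩
    | succ n ih =>
      intro hn
      obtain ⟨w, hw, hwv⟩ := ih (by omega)
      set r' := r + n * h with hr'
      have hr'0 : 0 ≤ r' := by positivity
      have hr'1 : r' ≤ r + 1 := by
        have h1 : (n : ℝ) ≤ m + 1 := by exact_mod_cast (by omega : n ≤ m + 1)
        have h2 : n * h ≤ (m + 1) * h := by gcongr
        have h3 : (m + 1) * h = 1 := mul_one_div_cancel hm0.ne'
        linarith
      have hδr := mul_nonneg hδ0 hr
      have hδr' := mul_nonneg hδ0 hr'0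
      have hδr1 : δ * r' ≤ r' := mul_le_of_le_one_left hr'0 hδ1
      have hrr : r ≤ r' := by
        have : 0 ≤ n * h := by positivity
        linarith
      have hsub : Set.Icc (-(δ * r)) (T + r) ⊆ Set.Icc (-(δ * r')) (T + r') :=
        Set.Icc_subset_Icc (by gcongr) (by gcongr)
      have hmem0 : (0 : ℝ) ∈ Set.Icc (-(δ * r')) (T + r') := ⟨by linarith, by linarith⟩
      have hwu : Set.EqOn w u (Set.Icc 0 T) := fun t ht =>
        (hwv ⟨by linarith [ht.1], by linarith [ht.2]⟩).trans (hvu ht)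
      obtain ⟨w', hw', hww⟩ := hw.exists_continuation hs hR0 hmem0 fun t ht S => by
        refine (hw.en_le hs hK0 hmem0 (hK r' hr'0 w hw hwu) ht S).trans ?_
        have habs : |t| ≤ T + r + 1 := abs_le.mpr ⟨by linarith [ht.1], by linarith [ht.2]⟩
        have : Real.exp (4 * K ^ 2 * |t|) ≤ Real.exp (4 * K ^ 2 * (T + r + 1)) := by gcongr
        have := mul_le_mul_of_nonneg_left this hE
        rw [hR]
        linarith
      refine ⟨w', hw'.mono (Set.Icc_subset_Icc ?_ ?_), fun t ht => (hww (hsub ht)).trans (hwv ht)⟩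
      · have e : δ * (r + (n + 1 : ℕ) * h) = δ * r' + δ * h := by push_cast; ring
        have : δ * h ≤ h := mul_le_of_le_one_left h0.le hδ1
        rw [e]
        linarith
      · push_cast
        linarith
  have hm1 : ((m + 1 : ℕ) : ℝ) * h = 1 := by
    push_cast
    exact mul_one_div_cancel hm0.ne'
  have := key (m + 1) le_rfl
  rwa [hm1] at this

end Novikov

end

theorem proposition2 (s : ℝ) (hs : 5 / 2 < s) (T : ℝ) (hT : 0 < T)
    (u₀ : UnitAddCircle → ℝ) (u : ℝ → UnitAddCircle → ℝ)
    (hu : Novikov.IsSolution s u₀ (Set.Icc 0 T) u)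
    (J : Set ℝ) (hJ : J = Set.Ici 0 ∨ J = Set.univ)
    (K : ℝ) (hK : 0 < K)
    (hbound : ∀ a b : ℝ, a ≤ 0 → T ≤ b → Set.Icc a b ⊆ J →
      ∀ v : ℝ → UnitAddCircle → ℝ,
        Novikov.IsSolution s u₀ (Set.Icc a b) v → Set.EqOn v u (Set.Icc 0 T) →
        ∀ t ∈ Set.Icc a b, Novikov.c1ENorm (v t) ≤ ENNReal.ofReal K) :
    ∃ v : ℝ → UnitAddCircle → ℝ,
      Novikov.IsSolution s u₀ J v ∧ Set.EqOn v u (Set.Icc 0 T) := by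
  -- the intervals `[-δk, T + k]` exhaust `J`, with `δ = 0` for `[0, ∞)` and `δ = 1` for `ℝ`
  obtain ⟨δ, hδ0, hδ1, hsub, hnhds⟩ : ∃ δ : ℝ, 0 ≤ δ ∧ δ ≤ 1 ∧
      (∀ r, 0 ≤ r → Set.Icc (-(δ * r)) (T + r) ⊆ J) ∧
      ∀ t ∈ J, ∀ r, |t| < r → t ∈ Set.Icc (-(δ * r)) (T + r) ∧
        Set.Icc (-(δ * r)) (T + r) ∈ 𝓝[J] t := by
    have hev : ∀ t r : ℝ, |t| < r → ∀ᶠ τ in 𝓝 t, |τ| < r := fun t r h =>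
      continuous_abs.continuousAt.eventually_lt continuousAt_const h
    rcases hJ with rfl | rfl
    · refine ⟨0, le_rfl, zero_le_one, fun r _ t ht => by simpa using ht.1, fun t ht r h => ?_⟩
      simp only [zero_mul, neg_zero]
      refine ⟨⟨ht, by linarith [le_abs_self t]⟩, ?_⟩
      filter_upwards [nhdsWithin_le_nhds (hev t r h), self_mem_nhdsWithin] with τ h1 h2
      exact ⟨h2, by linarith [le_abs_self τ]⟩
    · refine ⟨1, zero_le_one, le_rfl, fun r _ => Set.subset_univ _, fun t _ r h => ?_⟩
      simp only [one_mul]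
      have hI : ∀ τ, |τ| < r → τ ∈ Set.Icc (-r) (T + r) := fun τ h =>
        ⟨(abs_lt.mp h).1.le, by linarith [(abs_lt.mp h).2]⟩
      exact ⟨hI t h, nhdsWithin_le_nhds ((hev t r h).mono hI)⟩
  have hI0 : Set.Icc (-(δ * ((0 : ℕ) : ℝ))) (T + ((0 : ℕ) : ℝ)) = Set.Icc 0 T := by simp
  have h := Novikov.exists_isSolution_of_steps (s := s) (f := u₀) (J := J) (u := u)
    (I := fun k : ℕ => Set.Icc (-(δ * k)) (T + k))
    (fun k m hkm => by
      have : (k : ℝ) ≤ m := by exact_mod_cast hkm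
      exact Set.Icc_subset_Icc (by gcongr) (by gcongr))
    (by simpa using hT.le)
    (fun t ht => by
      obtain ⟨k, hk⟩ := exists_nat_gt |t|
      exact ⟨k, hnhds t ht k hk⟩)
    (by rw [hI0]; exact hu)
    (fun k v hv hvu => by
      rw [hI0] at hvu
      have := Novikov.exists_unit_continuation hs hK hT.le hδ0 hδ1
        (fun r hr v hv hvu => hbound _ _ (by nlinarith) (by linarith) (hsub r hr) v hv hvu)
        k.cast_nonneg hv hvu
      simpa using this)
  rwa [hI0] at h
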